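/- Let $(\mathbb{C},\otimes,E)$ be a symmetric monoidal category. **Conventions.** For $F:\mathbb{J}\to\mathbf{Set}$ and $G:\mathbb{J}^{op}\to\mathbf{Set}$, write $F(\bullet)\diamond G(\bullet)=\int^{U\in\mathbb{J}}F(U)\times G(U)$ for the coend, i.e. the set of triples $(U,x\in F(U),y\in G(U))$ modulo the equivalence relation generated by $(U',F(m)x,y)\sim(U,x,G(m)y)$ for $m:U\to U'$, $x\in F(U)$, $y\in G(U')$. A *promonoidal structure* $(\triangleleft,N)$ on a category $\mathbb{V}$ consists of a profunctor of splits $\mathbb{V}(A;X\triangleleft Y)$ (contravariant in $A$, covariant in $X,Y$) and a presheaf of units $\mathbb{V}(A;N)$, with natural isomorphisms $$\mathbb{V}(A;(X\triangleleft Y)\triangleleft Z):=\mathbb{V}(A;\bullet\triangleleft Z)\diamond\mathbb{V}(\bullet;X\triangleleft Y)\;\cong\;\mathbb{V}(A;X\triangleleft\bullet)\diamond\mathbb{V}(\bullet;Y\triangleleft Z)=:\mathbb{V}(A;X\triangleleft(Y\triangleleft Z)),$$ $$\mathbb{V}(A;\bullet\triangleleft X)\diamond\mathbb{V}(\bullet;N)\cong\mathbb{V}(A;X),\qquad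 \mathbb{V}(A;X\triangleleft\bullet)\diamond\mathbb{V}(\bullet;N)\cong\mathbb{V}(A;X)$$ satisfying the pentagon and triangle equations. A *produoidal category* is a category $\mathbb{V}$ with two promonoidal structures $(\otimes,I)$ (parallel) and $(\triangleleft,N)$ (sequential) and natural transformations (laxators) $$\psi_2:\mathbb{V}(\bullet;(X\triangleleft Y)\otimes(Z\triangleleft W))\to\mathbb{V}(\bullet;(X\otimes Z)\triangleleft(Y\otimes W)),\qquad \psi_0:\mathbb{V}(\bullet;I)\to\mathbb{V}(\bullet;I\triangleleft I),$$ $$\varphi_2:\mathbb{V}(\bullet;N\otimes N)\to\mathbb{V}(\bullet;N),\qquad \varphi_0:\mathbb{V}(\bullet;I)\to\mathbb{V}(\bullet;N)$$ (nested expressions again denote profunctor composition) satisfying the coherence equations of duoidal categories: $\psi_2$ is compatible with both associators; $(\psi_2,\psi_0)$ is compatible with the left and right unitors of $\otimes$ and $(\psi_2,\varphi_2)$ with those of $\triangleleft$; $(N,\varphi_2,\varphi_0)$ satisfies the associativity and unit equations of a $\otimes$-monoid; $(I,\psi_0,\varphi_0)$ satisfies the coassociativity and counit equations of a $\triangleleft$-comonoid.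 It is *normal* if $\varphi_0$ is an isomorphism. It is *symmetric* if it is endowed with a natural isomorphism $\mathbb{V}(\bullet;X\otimes Y)\cong\mathbb{V}(\bullet;Y\otimes X)$ satisfying the symmetry and hexagon equations. **Lenses.** The category $\mathcal{L}\mathbb{C}$ of monoidal lenses has as objects the pairs $\binom{A}{B}$ of objects of $\mathbb{C}$, and as morphisms the elements of $$\mathcal{L}\mathbb{C}\left(\tbinom{A}{B};\tbinom{X}{Y}\right)=\mathbb{C}(A;\bullet\otimes X)\diamond\mathbb{C}(\bullet\otimes Y;B).$$ The identity is the class of the inverse and the forward left unitor, with residual the unit object $E$. The composite of the classes of $(M,f,g)$ and $(P,a,b)$ is the class of $\big(M\otimes P,\ (M\otimes a)\circ f,\ g\circ(M\otimes b)\big)$, up to associators. **Proposition.** Monoidal lenses form a normal symmetric produoidal category whose two units (sequential and parallel) and whose sequential and parallel splits are $$\begin{aligned} \mathcal{L}\mathbb{C}\left(\tbinom{A}{B};N\right)&=\mathcal{L}\mathbb{C}\left(\tbinom{A}{B};I\right)=\mathbb{C}(A;B),\\ \mathcal{L}\mathbb{C}\left(\tbinom{A}{B};\tbinom{X}{Y}\triangleleft\tbinom{X'}{Y'}\right)&=\mathbb{C}(A;\bullet_1\otimes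 X)\diamond\mathbb{C}(\bullet_1\otimes Y;\bullet_2\otimes X')\diamond\mathbb{C}(\bullet_2\otimes Y';B),\\ \mathcal{L}\mathbb{C}\left(\tbinom{A}{B};\tbinom{X}{Y}\otimes\tbinom{X'}{Y'}\right)&=\mathbb{C}(A;\bullet\otimes X\otimes X')\diamond\mathbb{C}(\bullet\otimes Y\otimes Y';B). \end{aligned}$$ Here a lens into $\binom{A}{B}$ acts by surrounding the given morphisms, tensoring its residual on the left of theirs. On the splits, lenses out of $\binom{X}{Y}$ and $\binom{X'}{Y'}$ act by being inserted in the two holes; in the parallel case their residuals are first collected on the left by means of the symmetry of $\mathbb{C}$. Moreover, the parallel tensor is representable: $\left(\binom{X}{Y},\binom{X'}{Y'}\right)\mapsto\binom{X\otimes X'}{Y\otimes Y'}$ extends to a functor $\mathcal{L}\mathbb{C}\times\mathcal{L}\mathbb{C}\to\mathcal{L}\mathbb{C}$, given on classes by tensoring representatives and exchanging the middle factors, and there is an isomorphism $$\mathcal{L}\mathbb{C}\left(\tbinom{A}{B};\tbinom{X}{Y}\otimes\tbinom{X'}{Y'}\right)\cong\mathcal{L}\mathbb{C}\left(\tbinom{A}{B};\tbinom{X\otimes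 X'}{Y\otimes Y'}\right),$$ natural in all variables. -/

import Mathlib

open CategoryTheory MonoidalCategory Opposite

namespace Produo

universe v u w₁ w₂ w₃ w₄ v'

section Coends

variable {J : Type u} [Category.{v'} J]

/-- The functor `(U, U') ↦ F U' × G U`, whose coend is the composition of `F` and `G`. -/
def pairing (F : J ⥤ Type w₁) (G : Jᵒᵖ ⥤ Type w₂) : Jᵒᵖ ⥤ J ⥤ Type (max u w₁ w₂) where
  obj U :=
    { obj := fun U' => ULift.{u} (F.obj U' × G.obj U)
      map := fun f => ↾fun x => ⟨(F.map f x.down.1, x.down.2)⟩ }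
  map g := { app := fun _ => ↾fun x => ⟨(x.down.1, G.map g x.down.2)⟩ }

/-- The coend `∫^U F U × G U`, i.e. the set of pairs quotiented by dinatural equivalence. -/
def Comp (F : J ⥤ Type w₁) (G : Jᵒᵖ ⥤ Type w₂) : Type (max u w₁ w₂) :=
  Limits.Types.coend.{max w₁ w₂} (pairing F G)

namespace Comp

variable {F : J ⥤ Type w₁} {G : Jᵒᵖ ⥤ Type w₂}

/-- The class of the pair `(x, y)`. -/
def mk (U : J) (x : F.obj U) (y : G.obj (op U)) : Comp F G :=
  Quot.mk _ ⟨U, ⟨(x, y)⟩⟩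

theorem ind {p : Comp F G → Prop}
    (h : ∀ (U : J) (x : F.obj U) (y : G.obj (op U)), p (mk U x y)) (z : Comp F G) : p z :=
  Quot.ind (fun a => h a.1 a.2.down.1 a.2.down.2) z

theorem slide {U U' : J} (f : U ⟶ U') (x : F.obj U) (y : G.obj (op U')) :
    (mk U' (F.map f x) y : Comp F G) = mk U x (G.map f.op y) :=
  (Quot.sound (Limits.Types.coendRel.mk (F := pairing F G) f ⟨(x, y)⟩)).symm

/-- Maps out of a coend are dinatural families. -/
def lift {β : Sort w₃} (φ : ∀ U : J, F.obj U → G.obj (op U) → β)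
    (h : ∀ (U U' : J) (f : U ⟶ U') (x : F.obj U) (y : G.obj (op U')),
      φ U' (F.map f x) y = φ U x (G.map f.op y)) : Comp F G → β :=
  Quot.lift (fun a => φ a.1 a.2.down.1 a.2.down.2) (by
    rintro _ _ ⟨f, x⟩
    exact (h _ _ f x.down.1 x.down.2).symm)

@[simp]
theorem lift_mk {β : Sort w₃} (φ : ∀ U : J, F.obj U → G.obj (op U) → β)
    (h : ∀ (U U' : J) (f : U ⟶ U') (x : F.obj U) (y : G.obj (op U')),
      φ U' (F.map f x) y = φ U x (G.map f.op y)) (U : J) (x : F.obj U) (y : G.obj (op U)) :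
    lift φ h (mk U x y) = φ U x y :=
  rfl

/-- Functoriality of the coend in both variables. -/
def map {F F' : J ⥤ Type w₁} {G G' : Jᵒᵖ ⥤ Type w₂} (σ : F ⟶ F') (γ : G ⟶ G') :
    Comp F G → Comp F' G' :=
  lift (fun U x y => mk U (σ.app U x) (γ.app (op U) y)) (by
    intro U U' f x y
    rw [NatTrans.naturality_apply σ f x, slide, ← NatTrans.naturality_apply γ f.op y])

@[simp]
theorem map_mk {F F' : J ⥤ Type w₁} {G G' : Jᵒᵖ ⥤ Type w₂} (σ : F ⟶ F') (γ : G ⟶ G')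
    (U : J) (x : F.obj U) (y : G.obj (op U)) :
    map σ γ (mk U x y) = mk U (σ.app U x) (γ.app (op U) y) :=
  rfl

end Comp

/-- The external product `(X, Y) ↦ P X × Q Y` of two presheaves. -/
def ext {K : Type u} [Category.{v'} K] (P : Jᵒᵖ ⥤ Type w₁) (Q : Kᵒᵖ ⥤ Type w₂) :
    (J × K)ᵒᵖ ⥤ Type (max w₁ w₂) where
  obj X := P.obj (op X.unop.1) × Q.obj (op X.unop.2)
  map f := ↾fun x => (P.map f.unop.1.op x.1, Q.map f.unop.2.op x.2)

end Coends

section Nesting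

variable {V : Type u} [Category.{max u v} V]
variable {J : Type u} [Category.{v'} J]

/-- Presheaves on `V`. -/
abbrev Psh (V : Type u) [Category.{max u v} V] := Vᵒᵖ ⥤ Type (max u v)

/-- The composition `S(•; -) ⋄ G(-)` of a profunctor from `J` to `V` and a presheaf on `J`. -/
def subst (S : Profunctor.{max u v} J V) (G : Jᵒᵖ ⥤ Type (max u v)) : Psh.{v} V where
  obj A := Comp (S.flip.obj A) G
  map f := ↾Comp.map (S.flip.map f) (𝟙 G)
  map_id A := by
    ext x
    induction x using Comp.ind
    simp [Comp.map]
  map_comp f g := by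
    ext x
    induction x using Comp.ind
    simp

/-- Functoriality of `subst` in both variables. -/
def substMap {S S' : Profunctor.{max u v} J V} {G G' : Jᵒᵖ ⥤ Type (max u v)}
    (σ : S ⟶ S') (γ : G ⟶ G') : subst S G ⟶ subst S' G' where
  app A := ↾Comp.map ((flipFunctor _ _ _).map σ |>.app A) γ
  naturality := by
    intro A B f
    ext x
    induction x using Comp.ind
    simp [subst, ← NatTrans.naturality_apply]

/-- The insertion of `S(•; U)` at an element of `G U`. -/
def ins {S : Profunctor.{max u v} J V} {G : Jᵒᵖ ⥤ Type (max u v)} (U : J) (y : G.obj (op U)) :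
    S.obj U ⟶ subst S G where
  app A := ↾fun x => Comp.mk (F := S.flip.obj A) U x y

theorem map_ins {S : Profunctor.{max u v} J V} {G : Jᵒᵖ ⥤ Type (max u v)} {U U' : J}
    (f : U ⟶ U') (y : G.obj (op U')) :
    S.map f ≫ ins U' y = (ins U (G.map f.op y) : S.obj U ⟶ subst S G) := by
  ext A x
  exact Comp.slide (F := S.flip.obj A) f x y

/-- Maps of presheaves out of `subst S G` are dinatural families. -/
def desc {S : Profunctor.{max u v} J V} {G : Jᵒᵖ ⥤ Type (max u v)} {X : Psh.{v} V}
    (φ : ∀ U : J, G.obj (op U) → (S.obj U ⟶ X))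
    (h : ∀ (U U' : J) (f : U ⟶ U') (y : G.obj (op U')), S.map f ≫ φ U' y = φ U (G.map f.op y)) :
    subst S G ⟶ X where
  app A := ↾Comp.lift (fun U x y => (φ U y).app A x) (by
    intro U U' f x y
    rw [← h]
    rfl)
  naturality := by
    intro A B f
    ext x
    induction x using Comp.ind with
    | h U x y => exact NatTrans.naturality_apply (φ U y) f x

@[simp]
theorem ins_desc {S : Profunctor.{max u v} J V} {G : Jᵒᵖ ⥤ Type (max u v)} {X : Psh.{v} V}
    (φ : ∀ U : J, G.obj (op U) → (S.obj U ⟶ X))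
    (h : ∀ (U U' : J) (f : U ⟶ U') (y : G.obj (op U')), S.map f ≫ φ U' y = φ U (G.map f.op y))
    (U : J) (y : G.obj (op U)) : ins U y ≫ desc φ h = φ U y :=
  rfl

theorem subst_hom_ext {S : Profunctor.{max u v} J V} {G : Jᵒᵖ ⥤ Type (max u v)} {X : Psh.{v} V}
    {a b : subst S G ⟶ X} (h : ∀ (U : J) (y : G.obj (op U)), ins U y ≫ a = ins U y ≫ b) :
    a = b := by
  ext A x
  induction x using Comp.ind with
  | h U x y => exact ConcreteCategory.congr_hom (NatTrans.congr_app (h U y) A) x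

/-- `(P, Q) ↦ V(•; P ◁ Q)`: both ports of the split profunctor `T = V(•; - ◁ -)` are composed
with presheaves, `V(•; •₁ ◁ •₂) ⋄ P(•₁) ⋄ Q(•₂)`. -/
def conv (T : Profunctor.{max u v} (V × V) V) : Psh.{v} V × Psh.{v} V ⥤ Psh.{v} V where
  obj P := subst T (ext P.1 P.2)
  map η := substMap (𝟙 T)
    { app := fun X => ↾fun x => (η.1.app (op X.unop.1) x.1, η.2.app (op X.unop.2) x.2)
      naturality := by
        intro X Y f
        ext x
        exact congrArg₂ Prod.mk (NatTrans.naturality_apply η.1 f.unop.1.op x.1)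
          (NatTrans.naturality_apply η.2 f.unop.2.op x.2) }
  map_id P := subst_hom_ext (fun _ _ => rfl)
  map_comp η θ := subst_hom_ext (fun _ _ => rfl)

theorem map_comm (T : Profunctor.{max u v} (V × V) V) {X X' Y Y' : V} (f : X ⟶ X')
    (g : Y ⟶ Y') :
    T.map (Prod.mkHom f (𝟙 Y)) ≫ T.map (Prod.mkHom (𝟙 X') g) =
      T.map (Prod.mkHom (𝟙 X) g) ≫ T.map (Prod.mkHom f (𝟙 Y')) := by
  rw [← T.map_comp, ← T.map_comp]
  simp

theorem map_split (T : Profunctor.{max u v} (V × V) V) {X Y : V × V} (f : X ⟶ Y) :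
    T.map f = T.map (Prod.mkHom (𝟙 X.1) f.2) ≫ T.map (Prod.mkHom f.1 (𝟙 Y.2)) := by
  rw [← T.map_comp]
  simp

/-- `(P, Z) ↦ V(•; P ◁ Z)`, the composition `V(•; •₁ ◁ Z) ⋄ P(•₁)`. -/
def convLeft (T : Profunctor.{max u v} (V × V) V) : Psh.{v} V × V ⥤ Psh.{v} V where
  obj P := subst (Prod.sectL V P.2 ⋙ T) P.1
  map η := substMap
    { app := fun U => T.map (Prod.mkHom (𝟙 U) η.2)
      naturality := by
        intro U U' f
        exact map_comm T f η.2 } η.1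
  map_id P := subst_hom_ext (fun U y =>
    congrArg (fun g => g ≫ ins (S := Prod.sectL V P.2 ⋙ T) U y) (T.map_id (U, P.2)))
  map_comp {P Q R} η θ := subst_hom_ext (fun U y => by
    have h := T.map_comp (Prod.mkHom (𝟙 U) η.2) (Prod.mkHom (𝟙 U) θ.2)
    rw [prod_comp, Category.comp_id] at h
    exact congrArg (fun g => g ≫ ins (S := Prod.sectL V R.2 ⋙ T) (G := R.1) U
      (θ.1.app _ (η.1.app _ y))) h)

/-- `(X, P) ↦ V(•; X ◁ P)`, the composition `V(•; X ◁ •₂) ⋄ P(•₂)`. -/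
def convRight (T : Profunctor.{max u v} (V × V) V) : V × Psh.{v} V ⥤ Psh.{v} V where
  obj P := subst (Prod.sectR P.1 V ⋙ T) P.2
  map η := substMap
    { app := fun U => T.map (Prod.mkHom η.1 (𝟙 U))
      naturality := by
        intro U U' f
        exact (map_comm T η.1 f).symm } η.2
  map_id P := subst_hom_ext (fun U y =>
    congrArg (fun g => g ≫ ins (S := Prod.sectR P.1 V ⋙ T) U y) (T.map_id (P.1, U)))
  map_comp {P Q R} η θ := subst_hom_ext (fun U y => by
    have h := T.map_comp (Prod.mkHom η.1 (𝟙 U)) (Prod.mkHom θ.1 (𝟙 U))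
    rw [prod_comp, Category.comp_id] at h
    exact congrArg (fun g => g ≫ ins (S := Prod.sectR R.1 V ⋙ T) (G := R.2) U
      (θ.2.app _ (η.2.app _ y))) h)

/-- `((X, Y), Z) ↦ V(•; (X ◁ Y) ◁ Z)`. -/
def nestLeft (T : Profunctor.{max u v} (V × V) V) : Profunctor.{max u v} ((V × V) × V) V :=
  T.prod (𝟭 V) ⋙ convLeft T

/-- `(X, (Y, Z)) ↦ V(•; X ◁ (Y ◁ Z))`. -/
def nestRight (T : Profunctor.{max u v} (V × V) V) : Profunctor.{max u v} (V × (V × V)) V :=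
  (𝟭 V).prod T ⋙ convRight T

/-- `X ↦ V(•; N ◁ X)`, for a presheaf `N`. -/
def unitLeft (T : Profunctor.{max u v} (V × V) V) (N : Psh.{v} V) : Profunctor.{max u v} V V :=
  Prod.sectR N V ⋙ convLeft T

/-- `X ↦ V(•; X ◁ N)`, for a presheaf `N`. -/
def unitRight (T : Profunctor.{max u v} (V × V) V) (N : Psh.{v} V) : Profunctor.{max u v} V V :=
  Prod.sectL V N ⋙ convRight T

/-- `((X, Y), (Z, W)) ↦ V(•; (X ◁ Y) ⊗ (Z ◁ W))`, where `T` is the profunctor of `⊗` and `S` the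
profunctor of `◁`. -/
def nestBoth (T S : Profunctor.{max u v} (V × V) V) :
    Profunctor.{max u v} ((V × V) × (V × V)) V :=
  S.prod S ⋙ conv T

/-- `((X, Y), (Z, W)) ↦ ((X, Z), (Y, W))`. -/
def middleSwap (V : Type u) [Category.{max u v} V] :
    (V × V) × (V × V) ⥤ (V × V) × (V × V) where
  obj X := ((X.1.1, X.2.1), (X.1.2, X.2.2))
  map f := Prod.mkHom (Prod.mkHom f.1.1 f.2.1) (Prod.mkHom f.1.2 f.2.2)

end Nesting

section Extension

variable {V : Type u} [Category.{max u v} V]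

theorem psh_ext {P Q : Psh.{v} V} {a b : P ⟶ Q}
    (h : ∀ (A : Vᵒᵖ) (x : P.obj A), a.app A x = b.app A x) : a = b := by
  ext A x
  exact h A x

section Elements

variable {J : Type u} [Category.{v'} J]

/-- The class of a pair `(x, y)` in `S(A; -) ⋄ G(-)`. -/
def el (S : Profunctor.{max u v} J V) (G : Jᵒᵖ ⥤ Type (max u v)) {A : Vᵒᵖ} (U : J)
    (x : (S.obj U).obj A) (y : G.obj (op U)) : (subst S G).obj A :=
  Comp.mk (F := S.flip.obj A) U x y

theorem el_slide {S : Profunctor.{max u v} J V} {G : Jᵒᵖ ⥤ Type (max u v)} {A : Vᵒᵖ} {U U' : J}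
    (f : U ⟶ U') (x : (S.obj U).obj A) (y : G.obj (op U')) :
    el S G U' ((S.map f).app A x) y = el S G U x (G.map f.op y) :=
  Comp.slide (F := S.flip.obj A) f x y

theorem el_fst {K : Type u} [Category.{v'} K] {S : Profunctor.{max u v} (J × K) V}
    {G : Jᵒᵖ ⥤ Type (max u v)} {H : Kᵒᵖ ⥤ Type (max u v)} {A : Vᵒᵖ} {U U' : J} {Z : K}
    (f : U ⟶ U') (x : (S.obj (U, Z)).obj A) (y : G.obj (op U')) (z : H.obj (op Z)) :
    el S (ext G H) (U', Z) ((S.map (Prod.mkHom f (𝟙 Z))).app A x) (y, z) =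
      el S (ext G H) (U, Z) x (G.map f.op y, z) :=
  (el_slide _ _ _).trans (congrArg (el S (ext G H) (U, Z) x)
    (congrArg (Prod.mk (G.map f.op y)) (Functor.map_id_apply H _ z)))

theorem el_snd {K : Type u} [Category.{v'} K] {S : Profunctor.{max u v} (J × K) V}
    {G : Jᵒᵖ ⥤ Type (max u v)} {H : Kᵒᵖ ⥤ Type (max u v)} {A : Vᵒᵖ} {U : J} {Z Z' : K}
    (f : Z ⟶ Z') (x : (S.obj (U, Z)).obj A) (y : G.obj (op U)) (z : H.obj (op Z')) :
    el S (ext G H) (U, Z') ((S.map (Prod.mkHom (𝟙 U) f)).app A x) (y, z) =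
      el S (ext G H) (U, Z) x (y, H.map f.op z) :=
  (el_slide _ _ _).trans (congrArg (el S (ext G H) (U, Z) x)
    (congrArg (fun w => Prod.mk w (H.map f.op z)) (Functor.map_id_apply G _ y)))

theorem map_id_el (S : Profunctor.{max u v} J V) (U : J) {A : Vᵒᵖ} (x : (S.obj U).obj A) :
    (S.map (𝟙 U)).app A x = x := by
  simp

end Elements

/-- Regrouping of nested coends. -/
def spreadLeft (T : Profunctor.{max u v} (V × V) V) (P Q R : Psh.{v} V) :
    (conv T).obj ((conv T).obj (P, Q), R) ⟶ subst (nestLeft T) (ext (ext P Q) R) :=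
  desc (fun UZ c => Comp.lift
    (fun XY s pq =>
      (ins (S := Prod.sectL V UZ.2 ⋙ T) (G := T.obj XY) UZ.1 s ≫
        ins (S := nestLeft T) (G := ext (ext P Q) R) (XY, UZ.2) (pq, c.2) :
        T.obj UZ ⟶ subst (nestLeft T) (ext (ext P Q) R)))
    (by
      intro X X' f s y
      refine psh_ext (fun A t => ?_)
      exact (congrArg (fun w => el (nestLeft T) (ext (ext P Q) R) (X', UZ.2) w (y, c.2))
        (congrArg (fun t' => el (Prod.sectL V UZ.2 ⋙ T) (T.obj X') UZ.1 t' ((T.map f).app _ s))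
          (map_id_el T UZ t).symm)).trans
        (el_fst (S := nestLeft T) (G := ext P Q) (H := R) f
          (el (Prod.sectL V UZ.2 ⋙ T) (T.obj X) UZ.1 t s) y c.2)) c.1) (by
    rintro ⟨U, Z⟩ ⟨U', Z'⟩ ⟨f, g⟩ ⟨c, r⟩
    induction c using Comp.ind with
    | h X s y =>
      refine psh_ext (fun A t => ?_)
      refine Eq.trans ?_ (el_snd (S := nestLeft T) (G := ext P Q) (H := R) g
        (el (Prod.sectL V Z ⋙ T) (T.obj X) U t ((T.obj X).map f.op s)) y r)
      refine congrArg (fun w => el (nestLeft T) (ext (ext P Q) R) (X, Z') w (y, r)) ?_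
      refine Eq.trans ?_ (congrArg (fun s' => el (Prod.sectL V Z' ⋙ T) (T.obj X) U
        ((T.map (Prod.mkHom (𝟙 U) g)).app A t) s')
          (map_id_el T X ((T.obj X).map f.op s)).symm)
      refine Eq.trans ?_ (el_slide (S := Prod.sectL V Z' ⋙ T) (G := T.obj X) f
        ((T.map (Prod.mkHom (𝟙 U) g)).app A t) s)
      exact congrArg (fun t' => el (Prod.sectL V Z' ⋙ T) (T.obj X) U' t' s)
        (ConcreteCategory.congr_hom (NatTrans.congr_app (map_split T (Prod.mkHom f g)) A) t))

/-- Regrouping of nested coends. -/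
def gatherRight (T : Profunctor.{max u v} (V × V) V) (P Q R : Psh.{v} V) :
    subst (prod.associator V V V ⋙ nestRight T) (ext (ext P Q) R) ⟶
      (conv T).obj (P, (conv T).obj (Q, R)) :=
  desc (fun X y => desc
    (fun U s => ins (S := T) (G := ext P ((conv T).obj (Q, R))) (X.1.1, U)
      (y.1.1, el T (ext Q R) (X.1.2, X.2) s (y.1.2, y.2)))
    (by
      intro U U' f s
      refine psh_ext (fun A t => ?_)
      exact el_snd (S := T) (G := P) (H := (conv T).obj (Q, R)) f t y.1.1
        (el T (ext Q R) (X.1.2, X.2) s (y.1.2, y.2))))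
    (by
      rintro ⟨⟨X, Y⟩, Z⟩ ⟨⟨X', Y'⟩, Z'⟩ ⟨⟨f, g⟩, h⟩ ⟨⟨p, q⟩, r⟩
      refine subst_hom_ext (fun U s => ?_)
      refine psh_ext (fun A t => ?_)
      exact (congrArg (fun w => el T (ext P ((conv T).obj (Q, R))) (X', U)
          ((T.map (Prod.mkHom f (𝟙 U))).app A t) (p, w))
          (el_slide (S := T) (G := ext Q R) (Prod.mkHom g h) s (q, r))).trans
        (el_fst (S := T) (G := P) (H := (conv T).obj (Q, R)) f t p
          (el T (ext Q R) (Y, Z) s (Q.map g.op q, R.map h.op r))))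

/-- Regrouping of nested coends. -/
def spreadBoth (T S : Profunctor.{max u v} (V × V) V) (P Q R W : Psh.{v} V) :
    (conv T).obj ((conv S).obj (P, Q), (conv S).obj (R, W)) ⟶
      subst (nestBoth T S) (ext (ext P Q) (ext R W)) :=
  desc (fun U c => Comp.lift
    (fun X s p => Comp.lift
      (fun Y t q =>
        (ins (S := T) (G := ext (S.obj X) (S.obj Y)) U (s, t) ≫
          ins (S := nestBoth T S) (G := ext (ext P Q) (ext R W)) (X, Y) (p, q) :
          T.obj U ⟶ subst (nestBoth T S) (ext (ext P Q) (ext R W))))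
      (by
        intro Y Y' f t q
        refine psh_ext (fun A x => ?_)
        exact (congrArg (fun s' => el (nestBoth T S) (ext (ext P Q) (ext R W)) (X, Y')
            (el T (ext (S.obj X) (S.obj Y')) U x (s', (S.map f).app _ t)) (p, q))
            (map_id_el S X s).symm).trans
          (el_snd (S := nestBoth T S) (G := ext P Q) (H := ext R W) f
            (el T (ext (S.obj X) (S.obj Y)) U x (s, t)) p q)) c.2)
    (by
      intro X X' f s p
      obtain ⟨c₁, c₂⟩ := c
      induction c₂ using Comp.ind with
      | h Y t q =>
        refine psh_ext (fun A x => ?_)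
        exact (congrArg (fun t' => el (nestBoth T S) (ext (ext P Q) (ext R W)) (X', Y)
            (el T (ext (S.obj X') (S.obj Y)) U x ((S.map f).app _ s, t')) (p, q))
            (map_id_el S Y t).symm).trans
          (el_fst (S := nestBoth T S) (G := ext P Q) (H := ext R W) f
            (el T (ext (S.obj X) (S.obj Y)) U x (s, t)) p q)) c.1)
    (by
      rintro U U' f ⟨c₁, c₂⟩
      induction c₁ using Comp.ind with
      | h X s p =>
        induction c₂ using Comp.ind with
        | h Y t q =>
          refine psh_ext (fun A x => ?_)
          exact congrArg (fun w => el (nestBoth T S) (ext (ext P Q) (ext R W)) (X, Y) w (p, q))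
            (el_slide (S := T) (G := ext (S.obj X) (S.obj Y)) f x (s, t)))

/-- Regrouping of nested coends. -/
def gatherBoth (T S : Profunctor.{max u v} (V × V) V) (P Q R W : Psh.{v} V) :
    subst (middleSwap V ⋙ nestBoth S T) (ext (ext P Q) (ext R W)) ⟶
      (conv S).obj ((conv T).obj (P, R), (conv T).obj (Q, W)) :=
  desc (fun X y => desc
    (fun U s => ins (S := S) (G := ext ((conv T).obj (P, R)) ((conv T).obj (Q, W))) U
      (el T (ext P R) (X.1.1, X.2.1) s.1 (y.1.1, y.2.1),
       el T (ext Q W) (X.1.2, X.2.2) s.2 (y.1.2, y.2.2)))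
    (by
      rintro U U' f ⟨s, t⟩
      refine psh_ext (fun A x => ?_)
      exact el_slide (S := S) (G := ext ((conv T).obj (P, R)) ((conv T).obj (Q, W))) f x
        (el T (ext P R) (X.1.1, X.2.1) s (y.1.1, y.2.1),
          el T (ext Q W) (X.1.2, X.2.2) t (y.1.2, y.2.2))))
    (by
      rintro ⟨⟨X, Y⟩, ⟨Z, Z'⟩⟩ ⟨⟨X₁, Y₁⟩, ⟨Z₁, Z₁'⟩⟩ ⟨⟨f, g⟩, ⟨h, k⟩⟩ ⟨⟨p, q⟩, ⟨r, w⟩⟩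
      refine subst_hom_ext (fun U s => ?_)
      obtain ⟨s, t⟩ := s
      refine psh_ext (fun A x => ?_)
      exact congrArg₂ (fun a b => el S (ext ((conv T).obj (P, R)) ((conv T).obj (Q, W))) U x (a, b))
        (el_slide (S := T) (G := ext P R) (Prod.mkHom f h) s (p, r))
        (el_slide (S := T) (G := ext Q W) (Prod.mkHom g k) t (q, w)))

/-- Regrouping of nested coends. -/
def spreadUnitLeft (T : Profunctor.{max u v} (V × V) V) (N P : Psh.{v} V) :
    (conv T).obj (N, P) ⟶ subst (unitLeft T N) P :=
  desc (fun X y => (ins (S := Prod.sectL V X.2 ⋙ T) (G := N) X.1 y.1 ≫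
    ins (S := unitLeft T N) (G := P) X.2 y.2 : T.obj X ⟶ subst (unitLeft T N) P))
    (by
      rintro ⟨U, Z⟩ ⟨U', Z'⟩ ⟨f, g⟩ ⟨n, p⟩
      refine psh_ext (fun A t => ?_)
      refine Eq.trans ?_ (el_slide (S := unitLeft T N) (G := P) g
        (el (Prod.sectL V Z ⋙ T) N U t (N.map f.op n)) p)
      refine congrArg (fun w => el (unitLeft T N) P Z' w p) ?_
      refine Eq.trans ?_ (el_slide (S := Prod.sectL V Z' ⋙ T) (G := N) f
        ((T.map (Prod.mkHom (𝟙 U) g)).app A t) n)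
      exact congrArg (fun t' => el (Prod.sectL V Z' ⋙ T) N U' t' n)
        (ConcreteCategory.congr_hom (NatTrans.congr_app (map_split T (Prod.mkHom f g)) A) t))

/-- Regrouping of nested coends. -/
def spreadUnitRight (T : Profunctor.{max u v} (V × V) V) (N P : Psh.{v} V) :
    (conv T).obj (P, N) ⟶ subst (unitRight T N) P :=
  desc (fun X y => (ins (S := Prod.sectR X.1 V ⋙ T) (G := N) X.2 y.2 ≫
    ins (S := unitRight T N) (G := P) X.1 y.1 : T.obj X ⟶ subst (unitRight T N) P))
    (by
      rintro ⟨U, Z⟩ ⟨U', Z'⟩ ⟨f, g⟩ ⟨p, n⟩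
      refine psh_ext (fun A t => ?_)
      refine Eq.trans ?_ (el_slide (S := unitRight T N) (G := P) f
        (el (Prod.sectR U V ⋙ T) N Z t (N.map g.op n)) p)
      refine congrArg (fun w => el (unitRight T N) P U' w p) ?_
      refine Eq.trans ?_ (el_slide (S := Prod.sectR U' V ⋙ T) (G := N) g
        ((T.map (Prod.mkHom f (𝟙 Z))).app A t) n)
      exact congrArg (fun t' => el (Prod.sectR U' V ⋙ T) N Z' t' n)
        (ConcreteCategory.congr_hom (NatTrans.congr_app
          ((map_split T (Prod.mkHom f g)).trans (map_comm T f g).symm) A) t))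

/-- The co-Yoneda map `∫^X V(•; X) × P X → P`, given by the action of the morphisms of `V`. -/
def act (P : Psh.{v} V) : subst yoneda P ⟶ P :=
  desc (fun _ p => yonedaEquiv.symm p) (by
    intro U U' f y
    refine psh_ext (fun A x => ?_)
    simp [yonedaEquiv])

/-- Exchange of the arguments. -/
def flipConv (T : Profunctor.{max u v} (V × V) V) (P Q : Psh.{v} V) :
    subst (CategoryTheory.Prod.swap V V ⋙ T) (ext P Q) ⟶ (conv T).obj (Q, P) :=
  desc (fun X y => ins (S := T) (G := ext Q P) (X.2, X.1) (y.2, y.1))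
    (by
      rintro ⟨U, Z⟩ ⟨U', Z'⟩ ⟨f, g⟩ ⟨p, q⟩
      refine psh_ext (fun A t => ?_)
      exact el_slide (S := T) (G := ext Q P) (Prod.mkHom g f) t (q, p))

end Extension

section Structures

variable {V : Type u} [Category.{max u v} V]

/-- A promonoidal structure on `V` with splits `T = V(•; • ◁ •)` and units `N = V(•; N)`. The
associator and the unitors are natural isomorphisms of profunctors. Two-dimensional composites with
other profunctors are written by letting these isomorphisms act on arbitrary presheaves (with
representable presheaves standing for the objects of `V`): see `assocExt`, `lunitExt`, `runitExt`. -/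
structure PromonoidalData (T : Profunctor.{max u v} (V × V) V) (N : Psh.{v} V) where
  /-- `V(•; (X ◁ Y) ◁ Z) ≅ V(•; X ◁ (Y ◁ Z))` -/
  assoc : nestLeft T ≅ prod.associator V V V ⋙ nestRight T
  /-- `V(•; N ◁ X) ≅ V(•; X)` -/
  lunit : unitLeft T N ≅ yoneda
  /-- `V(•; X ◁ N) ≅ V(•; X)` -/
  runit : unitRight T N ≅ yoneda

namespace PromonoidalData

variable {T : Profunctor.{max u v} (V × V) V} {N : Psh.{v} V}

/-- The associator `V(•; (P ◁ Q) ◁ R) → V(•; P ◁ (Q ◁ R))`, whiskered with presheaves. -/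
def assocExt (M : PromonoidalData T N) (P Q R : Psh.{v} V) :
    (conv T).obj ((conv T).obj (P, Q), R) ⟶ (conv T).obj (P, (conv T).obj (Q, R)) :=
  spreadLeft T P Q R ≫ substMap M.assoc.hom (𝟙 _) ≫ gatherRight T P Q R

/-- The left unitor `V(•; N ◁ P) → P`, whiskered with a presheaf. -/
def lunitExt (M : PromonoidalData T N) (P : Psh.{v} V) : (conv T).obj (N, P) ⟶ P :=
  spreadUnitLeft T N P ≫ substMap M.lunit.hom (𝟙 _) ≫ act P

/-- The right unitor `V(•; P ◁ N) → P`, whiskered with a presheaf. -/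
def runitExt (M : PromonoidalData T N) (P : Psh.{v} V) : (conv T).obj (P, N) ⟶ P :=
  spreadUnitRight T N P ≫ substMap M.runit.hom (𝟙 _) ≫ act P

end PromonoidalData

/-- `η ◁ θ`, for maps of presheaves `η` and `θ`. -/
def convMap (T : Profunctor.{max u v} (V × V) V) {P P' Q Q' : Psh.{v} V} (η : P ⟶ P')
    (θ : Q ⟶ Q') : (conv T).obj (P, Q) ⟶ (conv T).obj (P', Q') :=
  (conv T).map (Prod.mkHom η θ)

/-- Promonoidal categories: the isomorphisms satisfy the pentagon and triangle equations. -/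
structure Promonoidal (T : Profunctor.{max u v} (V × V) V) (N : Psh.{v} V) extends
    PromonoidalData T N where
  pentagon (P Q R S : Psh.{v} V) :
    convMap T (toPromonoidalData.assocExt P Q R) (𝟙 S) ≫
        toPromonoidalData.assocExt P ((conv T).obj (Q, R)) S ≫
        convMap T (𝟙 P) (toPromonoidalData.assocExt Q R S) =
      toPromonoidalData.assocExt ((conv T).obj (P, Q)) R S ≫
        toPromonoidalData.assocExt P Q ((conv T).obj (R, S))
  triangle (P Q : Psh.{v} V) :
    toPromonoidalData.assocExt P N Q ≫ convMap T (𝟙 P) (toPromonoidalData.lunitExt Q) =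
      convMap T (toPromonoidalData.runitExt P) (𝟙 Q)

/-- The data of a produoidal category: promonoidal structures `(⊗, I)` and `(◁, N)`, with splits
`par = V(•; • ⊗ •)` and `seq = V(•; • ◁ •)`, and the four natural laxators. -/
structure ProduoidalData (par : Profunctor.{max u v} (V × V) V) (I : Psh.{v} V)
    (seq : Profunctor.{max u v} (V × V) V) (N : Psh.{v} V) where
  parallel : Promonoidal par I
  sequential : Promonoidal seq N
  /-- `V(•; (X ◁ Y) ⊗ (Z ◁ W)) → V(•; (X ⊗ Z) ◁ (Y ⊗ W))` -/
  psi₂ : nestBoth par seq ⟶ middleSwap V ⋙ nestBoth seq par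
  /-- `V(•; I) → V(•; I ◁ I)` -/
  psi₀ : I ⟶ (conv seq).obj (I, I)
  /-- `V(•; N ⊗ N) → V(•; N)` -/
  phi₂ : (conv par).obj (N, N) ⟶ N
  /-- `V(•; I) → V(•; N)` -/
  phi₀ : I ⟶ N

namespace ProduoidalData

variable {par seq : Profunctor.{max u v} (V × V) V} {I N : Psh.{v} V}

/-- The laxator `V(•; (P ◁ Q) ⊗ (R ◁ S)) → V(•; (P ⊗ R) ◁ (Q ⊗ S))`, whiskered with presheaves. -/
def psi₂Ext (M : ProduoidalData par I seq N) (P Q R S : Psh.{v} V) :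
    (conv par).obj ((conv seq).obj (P, Q), (conv seq).obj (R, S)) ⟶
      (conv seq).obj ((conv par).obj (P, R), (conv par).obj (Q, S)) :=
  spreadBoth par seq P Q R S ≫ substMap M.psi₂ (𝟙 _) ≫ gatherBoth par seq P Q R S

end ProduoidalData

/-- Produoidal categories: the laxators satisfy the coherence equations of duoidal categories. -/
structure Produoidal (par : Profunctor.{max u v} (V × V) V) (I : Psh.{v} V)
    (seq : Profunctor.{max u v} (V × V) V) (N : Psh.{v} V) extends
    ProduoidalData par I seq N where
  /-- Compatibility of `psi₂` with the associator of `⊗`. -/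
  psi₂_assoc_par (A B C D E F : Psh.{v} V) :
    convMap par (toProduoidalData.psi₂Ext A B C D) (𝟙 ((conv seq).obj (E, F))) ≫
        toProduoidalData.psi₂Ext ((conv par).obj (A, C)) ((conv par).obj (B, D)) E F ≫
        convMap seq (parallel.assocExt A C E) (parallel.assocExt B D F) =
      parallel.assocExt ((conv seq).obj (A, B)) ((conv seq).obj (C, D)) ((conv seq).obj (E, F)) ≫
        convMap par (𝟙 ((conv seq).obj (A, B))) (toProduoidalData.psi₂Ext C D E F) ≫
        toProduoidalData.psi₂Ext A B ((conv par).obj (C, E)) ((conv par).obj (D, F))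
  /-- Compatibility of `psi₂` with the associator of `◁`. -/
  psi₂_assoc_seq (A B C D E F : Psh.{v} V) :
    toProduoidalData.psi₂Ext ((conv seq).obj (A, B)) C ((conv seq).obj (D, E)) F ≫
        convMap seq (toProduoidalData.psi₂Ext A B D E) (𝟙 ((conv par).obj (C, F))) ≫
        sequential.assocExt ((conv par).obj (A, D)) ((conv par).obj (B, E))
          ((conv par).obj (C, F)) =
      convMap par (sequential.assocExt A B C) (sequential.assocExt D E F) ≫
        toProduoidalData.psi₂Ext A ((conv seq).obj (B, C)) D ((conv seq).obj (E, F)) ≫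
        convMap seq (𝟙 ((conv par).obj (A, D))) (toProduoidalData.psi₂Ext B C E F)
  /-- Compatibility with the left unitor of `⊗`. -/
  lunit_par (A B : Psh.{v} V) :
    convMap par psi₀ (𝟙 ((conv seq).obj (A, B))) ≫ toProduoidalData.psi₂Ext I I A B ≫
        convMap seq (parallel.lunitExt A) (parallel.lunitExt B) =
      parallel.lunitExt ((conv seq).obj (A, B))
  /-- Compatibility with the right unitor of `⊗`. -/
  runit_par (A B : Psh.{v} V) :
    convMap par (𝟙 ((conv seq).obj (A, B))) psi₀ ≫ toProduoidalData.psi₂Ext A B I I ≫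
        convMap seq (parallel.runitExt A) (parallel.runitExt B) =
      parallel.runitExt ((conv seq).obj (A, B))
  /-- Compatibility with the left unitor of `◁`. -/
  lunit_seq (A B : Psh.{v} V) :
    toProduoidalData.psi₂Ext N A N B ≫ convMap seq phi₂ (𝟙 ((conv par).obj (A, B))) ≫
        sequential.lunitExt ((conv par).obj (A, B)) =
      convMap par (sequential.lunitExt A) (sequential.lunitExt B)
  /-- Compatibility with the right unitor of `◁`. -/
  runit_seq (A B : Psh.{v} V) :
    toProduoidalData.psi₂Ext A N B N ≫ convMap seq (𝟙 ((conv par).obj (A, B))) phi₂ ≫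
        sequential.runitExt ((conv par).obj (A, B)) =
      convMap par (sequential.runitExt A) (sequential.runitExt B)
  /-- `N` is a `⊗`-monoid: associativity. -/
  phi₂_assoc :
    convMap par phi₂ (𝟙 N) ≫ phi₂ = parallel.assocExt N N N ≫ convMap par (𝟙 N) phi₂ ≫ phi₂
  /-- `N` is a `⊗`-monoid: left unitality. -/
  phi₂_lunit : convMap par phi₀ (𝟙 N) ≫ phi₂ = parallel.lunitExt N
  /-- `N` is a `⊗`-monoid: right unitality. -/
  phi₂_runit : convMap par (𝟙 N) phi₀ ≫ phi₂ = parallel.runitExt N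
  /-- `I` is a `◁`-comonoid: coassociativity. -/
  psi₀_assoc :
    psi₀ ≫ convMap seq psi₀ (𝟙 I) ≫ sequential.assocExt I I I = psi₀ ≫ convMap seq (𝟙 I) psi₀
  /-- `I` is a `◁`-comonoid: left counitality. -/
  psi₀_lunit : psi₀ ≫ convMap seq phi₀ (𝟙 I) ≫ sequential.lunitExt I = 𝟙 I
  /-- `I` is a `◁`-comonoid: right counitality. -/
  psi₀_runit : psi₀ ≫ convMap seq (𝟙 I) phi₀ ≫ sequential.runitExt I = 𝟙 I

/-- Normality: the laxator `V(•; I) → V(•; N)` is an isomorphism. -/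
def Produoidal.IsNormal {par seq : Profunctor.{max u v} (V × V) V} {I N : Psh.{v} V}
    (M : Produoidal par I seq N) : Prop :=
  IsIso M.phi₀

/-- The symmetry `V(•; P ⊗ Q) → V(•; Q ⊗ P)`, whiskered with presheaves. -/
def symmExt {T : Profunctor.{max u v} (V × V) V} (σ : T ≅ CategoryTheory.Prod.swap V V ⋙ T)
    (P Q : Psh.{v} V) : (conv T).obj (P, Q) ⟶ (conv T).obj (Q, P) :=
  substMap σ.hom (𝟙 _) ≫ flipConv T P Q

/-- Symmetric produoidal categories: the parallel splits carry a natural isomorphism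
`V(•; X ⊗ Y) ≅ V(•; Y ⊗ X)` satisfying the symmetry and hexagon equations. -/
structure SymmetricProduoidal (par : Profunctor.{max u v} (V × V) V) (I : Psh.{v} V)
    (seq : Profunctor.{max u v} (V × V) V) (N : Psh.{v} V) extends
    Produoidal par I seq N where
  symm : par ≅ CategoryTheory.Prod.swap V V ⋙ par
  symmetry (X Y : V) : symm.hom.app (X, Y) ≫ symm.hom.app (Y, X) = 𝟙 (par.obj (X, Y))
  hexagon (P Q R : Psh.{v} V) :
    parallel.assocExt P Q R ≫ symmExt symm P ((conv par).obj (Q, R)) ≫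
        parallel.assocExt Q R P =
      convMap par (symmExt symm P Q) (𝟙 R) ≫ parallel.assocExt Q P R ≫
        convMap par (𝟙 Q) (symmExt symm P R)

end Structures

section Lenses

variable {C : Type u} [Category.{v} C] [MonoidalCategory C]

/-- The set `∫^M C(A; M ⊗ X) × C(M ⊗ Y; B)`. -/
abbrev LensSet (A B X Y : C) : Type (max u v) :=
  Comp (tensorRight X ⋙ coyoneda.obj (op A)) ((tensorRight Y).op ⋙ yoneda.obj B)

namespace LensSet

/-- The class of the pair of `f : A ⟶ M ⊗ X` and `g : M ⊗ Y ⟶ B`. -/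
def mk {A B X Y : C} (M : C) (f : A ⟶ M ⊗ X) (g : M ⊗ Y ⟶ B) : LensSet A B X Y :=
  Comp.mk (F := tensorRight X ⋙ coyoneda.obj (op A)) (G := (tensorRight Y).op ⋙ yoneda.obj B) M f g

theorem ind {A B X Y : C} {p : LensSet A B X Y → Prop}
    (h : ∀ (M : C) (f : A ⟶ M ⊗ X) (g : M ⊗ Y ⟶ B), p (mk M f g)) (z : LensSet A B X Y) : p z :=
  Comp.ind h z

theorem slide {A B X Y : C} {M M' : C} (m : M ⟶ M') (f : A ⟶ M ⊗ X) (g : M' ⊗ Y ⟶ B) :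
    mk M' (f ≫ m ▷ X) g = mk M f (m ▷ Y ≫ g) :=
  Comp.slide (F := tensorRight X ⋙ coyoneda.obj (op A))
    (G := (tensorRight Y).op ⋙ yoneda.obj B) m f g

theorem slide_iso {A B X Y : C} {M M' : C} (m : M ≅ M') (f : A ⟶ M ⊗ X) (g : M ⊗ Y ⟶ B)
    {f' : A ⟶ M' ⊗ X} {g' : M' ⊗ Y ⟶ B} (hf : f' = f ≫ m.hom ▷ X) (hg : g = m.hom ▷ Y ≫ g') :
    mk M f g = mk M' f' g' := by
  rw [hf, hg, slide]

/-- Maps out of the set of lenses are dinatural families. -/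
def lift {A B X Y : C} {β : Sort*} (φ : ∀ M : C, (A ⟶ M ⊗ X) → (M ⊗ Y ⟶ B) → β)
    (h : ∀ (M M' : C) (m : M ⟶ M') (f : A ⟶ M ⊗ X) (g : M' ⊗ Y ⟶ B),
      φ M' (f ≫ m ▷ X) g = φ M f (m ▷ Y ≫ g)) : LensSet A B X Y → β :=
  Comp.lift (F := tensorRight X ⋙ coyoneda.obj (op A))
    (G := (tensorRight Y).op ⋙ yoneda.obj B) φ h

@[simp]
theorem lift_mk {A B X Y : C} {β : Sort*} (φ : ∀ M : C, (A ⟶ M ⊗ X) → (M ⊗ Y ⟶ B) → β)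
    (h : ∀ (M M' : C) (m : M ⟶ M') (f : A ⟶ M ⊗ X) (g : M' ⊗ Y ⟶ B),
      φ M' (f ≫ m ▷ X) g = φ M f (m ▷ Y ≫ g)) (M : C) (f : A ⟶ M ⊗ X) (g : M ⊗ Y ⟶ B) :
    lift φ h (mk M f g) = φ M f g :=
  rfl

/-- The lens with trivial residual. -/
protected def id (A B : C) : LensSet A B A B :=
  mk (𝟙_ C) (λ_ A).inv (λ_ B).hom

/-- Composition of lenses, on representatives `(M, f, g)` and `(P, a, b)`: the residual is `M ⊗ P`,
with `f` followed by `M ◁ a`, and `M ◁ b` followed by `g`. -/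
def comp {A B X Y U V : C} (k : LensSet A B X Y) (l : LensSet X Y U V) : LensSet A B U V :=
  lift (fun M f g => lift
    (fun P a b => mk (M ⊗ P) (f ≫ M ◁ a ≫ (α_ M P U).inv) ((α_ M P V).hom ≫ M ◁ b ≫ g))
    (by
      intro P P' p a b
      have := slide (M ◁ p) (f ≫ M ◁ a ≫ (α_ M P U).inv) ((α_ M P' V).hom ≫ M ◁ b ≫ g)
      simpa using this) l)
    (by
      intro M M' m f g
      induction l using ind with
      | h P a b =>
        refine (congrArg (fun z => mk _ z _) ?_).trans ((slide (m ▷ P)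
          (f ≫ M ◁ a ≫ (α_ M P U).inv) ((α_ M' P V).hom ≫ M' ◁ b ≫ g)).trans
            (congrArg (mk _ _) ?_))
        · simp [← whisker_exchange_assoc]
        · simp [whisker_exchange_assoc]) k

@[simp]
theorem mk_comp_mk {A B X Y U V : C} (M P : C) (f : A ⟶ M ⊗ X) (g : M ⊗ Y ⟶ B)
    (a : X ⟶ P ⊗ U) (b : P ⊗ V ⟶ Y) :
    comp (mk M f g) (mk P a b) =
      mk (M ⊗ P) (f ≫ M ◁ a ≫ (α_ M P U).inv) ((α_ M P V).hom ≫ M ◁ b ≫ g) :=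
  rfl

theorem id_comp {A B X Y : C} (k : LensSet A B X Y) : comp (LensSet.id A B) k = k := by
  induction k using ind with
  | h M f g =>
    refine slide_iso (λ_ M) _ _ ?_ ?_ <;> simp

theorem comp_id {A B X Y : C} (k : LensSet A B X Y) : comp k (LensSet.id X Y) = k := by
  induction k using ind with
  | h M f g =>
    refine slide_iso (ρ_ M) _ _ ?_ ?_ <;> simp

theorem assoc {A B X Y U V Z W : C} (k : LensSet A B X Y) (l : LensSet X Y U V)
    (m : LensSet U V Z W) : comp (comp k l) m = comp k (comp l m) := by
  induction k using ind with
  | h M f g =>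
    induction l using ind with
    | h P a b =>
      induction m using ind with
      | h Q c d =>
        refine slide_iso (α_ M P Q) _ _ ?_ ?_ <;> simp

/-- Reindexing of lenses along a morphism into the first object. -/
def pre {A' A B X Y : C} (h : A' ⟶ A) (k : LensSet A B X Y) : LensSet A' B X Y :=
  Comp.map (Functor.whiskerLeft (tensorRight X) (coyoneda.map h.op)) (𝟙 _) k

@[simp]
theorem pre_mk {A' A B X Y : C} (h : A' ⟶ A) (M : C) (f : A ⟶ M ⊗ X) (g : M ⊗ Y ⟶ B) :
    pre h (mk M f g) = mk M (h ≫ f) g :=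
  rfl

theorem pre_comp {A' A B X Y U V : C} (h : A' ⟶ A) (k : LensSet A B X Y) (l : LensSet X Y U V) :
    pre h (comp k l) = comp (pre h k) l := by
  induction k using ind with
  | h M f g =>
    induction l using ind with
    | h P a b => simp

end LensSet

/-- The objects of the category of monoidal lenses: pairs of objects of `C`. -/
@[ext]
structure Lens (C : Type u) where
  /-- the object `A` of the pair `(A, B)` -/
  fst : C
  /-- the object `B` of the pair `(A, B)` -/
  snd : C

/-- The category of monoidal lenses, whose morphisms `(A, B) ⟶ (X, Y)` are the elements of
`∫^M C(A; M ⊗ X) × C(M ⊗ Y; B)`. -/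
instance : Category.{max u v} (Lens C) where
  Hom A X := LensSet A.fst A.snd X.fst X.snd
  id A := LensSet.id A.fst A.snd
  comp k l := LensSet.comp k l
  id_comp := LensSet.id_comp
  comp_id := LensSet.comp_id
  assoc := LensSet.assoc

/-- The sequential units `(A, B) ↦ C(A; B)` of monoidal lenses. A lens `(M, f, g)` acts on
`h : A ⟶ B` by `f ≫ M ◁ h ≫ g`. -/
def lensUnit (C : Type u) [Category.{v} C] [MonoidalCategory C] :
    (Lens C)ᵒᵖ ⥤ Type (max u v) where
  obj A := ULift.{u} (A.unop.fst ⟶ A.unop.snd)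
  map {A A'} k := ↾fun h => LensSet.lift (fun M f g => ⟨f ≫ M ◁ h.down ≫ g⟩)
    (by
      intro M M' m f g
      simp [whisker_exchange_assoc]) k.unop
  map_id A := by
    ext h
    change (λ_ A.unop.fst).inv ≫ _ ◁ h.down ≫ (λ_ A.unop.snd).hom = h.down
    simp
  map_comp {A B D} k l := by
    ext h
    obtain ⟨k⟩ := k
    obtain ⟨l⟩ := l
    induction k using LensSet.ind with
    | h M f g =>
      induction l using LensSet.ind with
      | h P a b =>
        change (a ≫ P ◁ f ≫ (α_ _ _ _).inv) ≫ _ ◁ h.down ≫ (α_ _ _ _).hom ≫ P ◁ g ≫ b =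
          a ≫ P ◁ (f ≫ M ◁ h.down ≫ g) ≫ b
        simp

section Symmetric

variable [SymmetricCategory C]

namespace LensSet

/-- The tensor product of two lenses, on representatives `(M, f, g)` and `(P, a, b)`: the residual
is `M ⊗ P`, and the morphisms are `f ⊗ a` and `g ⊗ b` up to the exchange of the middle objects. -/
def tensor {A B X Y A' B' X' Y' : C} (k : LensSet A B X Y) (l : LensSet A' B' X' Y') :
    LensSet (A ⊗ A') (B ⊗ B') (X ⊗ X') (Y ⊗ Y') :=
  lift (fun M f g => lift
    (fun P a b => mk (M ⊗ P) ((f ⊗ₘ a) ≫ tensorμ M X P X') (tensorμ M P Y Y' ≫ (g ⊗ₘ b)))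
    (by
      intro P P' p a b
      refine (congrArg (fun z => mk _ z _) ?_).trans ((slide (M ◁ p)
        ((f ⊗ₘ a) ≫ tensorμ M X P X') (tensorμ M P' Y Y' ≫ (g ⊗ₘ b))).trans
          (congrArg (mk _ _) ?_))
      · have h := tensorμ_natural (𝟙 M) (𝟙 X) p (𝟙 X')
        simp only [id_tensorHom, tensorHom_id, id_whiskerRight] at h
        rw [Category.assoc, ← h, ← id_tensorHom, tensorHom_comp_tensorHom_assoc, Category.comp_id]
      · have h := tensorμ_natural (𝟙 M) p (𝟙 Y) (𝟙 Y')
        simp only [id_tensorHom, tensorHom_id, id_whiskerRight] at h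
        rw [reassoc_of% h, ← id_tensorHom, tensorHom_comp_tensorHom, Category.id_comp]) l)
    (by
      intro M M' m f g
      induction l using ind with
      | h P a b =>
        rw [lift_mk, lift_mk]
        refine (congrArg (fun z => mk _ z _) ?_).trans ((slide (m ▷ P)
          ((f ⊗ₘ a) ≫ tensorμ M X P X') (tensorμ M' P Y Y' ≫ (g ⊗ₘ b))).trans
            (congrArg (mk _ _) ?_))
        · have h := tensorμ_natural m (𝟙 X) (𝟙 P) (𝟙 X')
          simp only [tensorHom_id, id_whiskerRight] at h
          rw [Category.assoc, ← h, ← tensorHom_id (m ▷ X), tensorHom_comp_tensorHom_assoc,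
            Category.comp_id]
        · have h := tensorμ_natural m (𝟙 P) (𝟙 Y) (𝟙 Y')
          simp only [tensorHom_id, id_whiskerRight] at h
          rw [reassoc_of% h, ← tensorHom_id (m ▷ Y), tensorHom_comp_tensorHom, Category.id_comp]) k

@[simp]
theorem mk_tensor_mk {A B X Y A' B' X' Y' : C} (M P : C) (f : A ⟶ M ⊗ X) (g : M ⊗ Y ⟶ B)
    (a : A' ⟶ P ⊗ X') (b : P ⊗ Y' ⟶ B') :
    tensor (mk M f g) (mk P a b) =
      mk (M ⊗ P) ((f ⊗ₘ a) ≫ tensorμ M X P X') (tensorμ M P Y Y' ≫ (g ⊗ₘ b)) :=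
  rfl

theorem id_tensor_id (A B A' B' : C) :
    tensor (LensSet.id A B) (LensSet.id A' B') = LensSet.id (A ⊗ A') (B ⊗ B') := by
  refine slide_iso (λ_ (𝟙_ C)) _ _ ?_ ?_
  · have h := leftUnitor_monoidal A A'
    rw [← cancel_mono (λ_ (A ⊗ A')).hom, Category.assoc, Category.assoc, ← h,
      tensorHom_comp_tensorHom]
    simp
  · rw [tensor_left_unitality, hom_inv_whiskerRight_assoc]

theorem comp_tensor_comp {A B X Y U V A' B' X' Y' U' V' : C} (k : LensSet A B X Y)
    (l : LensSet X Y U V) (k' : LensSet A' B' X' Y') (l' : LensSet X' Y' U' V') :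
    tensor (comp k l) (comp k' l') = comp (tensor k k') (tensor l l') := by
  induction k using ind with
  | h M f g =>
    induction l using ind with
    | h P a b =>
      induction k' using ind with
      | h M' f' g' =>
        induction l' using ind with
        | h P' a' b' =>
          refine slide_iso ⟨tensorμ M P M' P', tensorδ M P M' P', by simp, by simp⟩ _ _ ?_ ?_
          · have h := associator_monoidal M P U M' P' U'
            rw [← cancel_mono (α_ _ _ _).hom]
            simp only [Category.assoc, whiskerLeft_comp, Iso.inv_hom_id, Category.comp_id, h]
            rw [tensorHom_comp_tensorHom_assoc]
            simp only [Category.assoc, Iso.inv_hom_id, Category.comp_id]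
            have h' := tensorμ_natural (𝟙 M) a (𝟙 M') a'
            simp only [id_tensorHom, whiskerLeft_id] at h'
            rw [← tensorHom_comp_tensorHom_assoc, reassoc_of% h']
          · have h := tensor_associativity M M' P P' V V'
            have e : tensorμ M P M' P' ≫ tensorμ M M' P P' = 𝟙 _ := by
              have : tensorμ M M' P P' = tensorδ M P M' P' := by
                simp [tensorμ, tensorδ, SymmetricCategory.braiding_swap_eq_inv_braiding]
              rw [this, tensorμ_tensorδ]
            rw [whiskerLeft_comp_assoc, tensorμ_natural_right_assoc]
            rw [← reassoc_of% h, ← comp_whiskerRight_assoc, e]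
            simp

end LensSet

/-- The functor `((X, Y), (X', Y')) ↦ (X ⊗ X', Y ⊗ Y')`. -/
def lensTensor (C : Type u) [Category.{v} C] [MonoidalCategory C] [SymmetricCategory C] :
    Lens C × Lens C ⥤ Lens C where
  obj X := ⟨X.1.fst ⊗ X.2.fst, X.1.snd ⊗ X.2.snd⟩
  map k := LensSet.tensor k.1 k.2
  map_id _ := LensSet.id_tensor_id _ _ _ _
  map_comp _ _ := LensSet.comp_tensor_comp _ _ _ _

/-- The parallel splits of monoidal lenses,
`((X, Y), (X', Y')) ↦ ∫^M C(A; M ⊗ (X ⊗ X')) × C(M ⊗ (Y ⊗ Y'); B)`. Lenses into `(A, B)` act by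
precomposition; a pair of lenses out of `(X, Y)` and `(X', Y')` acts by composition with its tensor
product. -/
def lensPar (C : Type u) [Category.{v} C] [MonoidalCategory C] [SymmetricCategory C] :
    Profunctor.{max u v} (Lens C × Lens C) (Lens C) where
  obj P :=
    { obj := fun A => LensSet A.unop.fst A.unop.snd (P.1.fst ⊗ P.2.fst) (P.1.snd ⊗ P.2.snd)
      map := fun k => ↾fun z => LensSet.comp k.unop z
      map_id := fun _ => by
        ext z
        exact LensSet.id_comp z
      map_comp := fun k l => by
        ext z
        exact LensSet.assoc l.unop k.unop z }
  map k :=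
    { app := fun _ => ↾fun z => LensSet.comp z (LensSet.tensor k.1 k.2)
      naturality := fun _ _ k' => by
        ext z
        exact LensSet.assoc k'.unop z _ }
  map_id P := by
    ext A z
    exact (congrArg (LensSet.comp z) (LensSet.id_tensor_id _ _ _ _)).trans (LensSet.comp_id z)
  map_comp k l := by
    ext A z
    exact (congrArg (LensSet.comp z) (LensSet.comp_tensor_comp _ _ _ _)).trans
      (LensSet.assoc z _ _).symm

end Symmetric

namespace LensSet

theorem pre_id {A B X Y : C} (k : LensSet A B X Y) : pre (𝟙 A) k = k := by
  induction k using ind with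
  | h M f g => simp

theorem pre_pre {A'' A' A B X Y : C} (h' : A'' ⟶ A') (h : A' ⟶ A) (k : LensSet A B X Y) :
    pre h' (pre h k) = pre (h' ≫ h) k := by
  induction k using ind with
  | h M f g => simp

end LensSet

/-- The functor `A ↦ ∫^M C(A; M ⊗ X) × C(M ⊗ Y; B)`. -/
def lensFrom (B X Y : C) : Cᵒᵖ ⥤ Type (max u v) where
  obj A := LensSet A.unop B X Y
  map h := ↾fun k => LensSet.pre h.unop k
  map_id _ := by
    ext k
    exact LensSet.pre_id k
  map_comp h h' := by
    ext k
    exact (LensSet.pre_pre h'.unop h.unop k).symm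

/-- The set `∫^M C(A; M ⊗ X) × ∫^M' C(M ⊗ Y; M' ⊗ X') × C(M' ⊗ Y'; B)`. -/
abbrev SeqSet (A B X Y X' Y' : C) : Type (max u v) :=
  Comp (tensorRight X ⋙ coyoneda.obj (op A)) ((tensorRight Y).op ⋙ lensFrom B X' Y')

namespace SeqSet

/-- The class of the pair of `f : A ⟶ M ⊗ X` and an element of
`∫^M' C(M ⊗ Y; M' ⊗ X') × C(M' ⊗ Y'; B)`. -/
def mk {A B X Y X' Y' : C} (M : C) (f : A ⟶ M ⊗ X) (l : LensSet (M ⊗ Y) B X' Y') :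
    SeqSet A B X Y X' Y' :=
  Comp.mk (F := tensorRight X ⋙ coyoneda.obj (op A))
    (G := (tensorRight Y).op ⋙ lensFrom B X' Y') M f l

theorem ind {A B X Y X' Y' : C} {p : SeqSet A B X Y X' Y' → Prop}
    (h : ∀ (M : C) (f : A ⟶ M ⊗ X) (l : LensSet (M ⊗ Y) B X' Y'), p (mk M f l))
    (z : SeqSet A B X Y X' Y') : p z :=
  Comp.ind h z

theorem slide {A B X Y X' Y' : C} {M M' : C} (m : M ⟶ M') (f : A ⟶ M ⊗ X)
    (l : LensSet (M' ⊗ Y) B X' Y') : mk M' (f ≫ m ▷ X) l = mk M f (LensSet.pre (m ▷ Y) l) :=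
  Comp.slide (F := tensorRight X ⋙ coyoneda.obj (op A))
    (G := (tensorRight Y).op ⋙ lensFrom B X' Y') m f l

theorem slide_eq {A B X Y X' Y' : C} {M M' : C} (m : M ⟶ M') {f : A ⟶ M ⊗ X} {f' : A ⟶ M' ⊗ X}
    {l : LensSet (M ⊗ Y) B X' Y'} {l' : LensSet (M' ⊗ Y) B X' Y'} (hf : f' = f ≫ m ▷ X)
    (hl : l = LensSet.pre (m ▷ Y) l') : mk M f l = mk M' f' l' := by
  rw [hf, hl, slide]

/-- Maps out of the coend are dinatural families. -/
def lift {A B X Y X' Y' : C} {β : Sort*}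
    (φ : ∀ M : C, (A ⟶ M ⊗ X) → LensSet (M ⊗ Y) B X' Y' → β)
    (h : ∀ (M M' : C) (m : M ⟶ M') (f : A ⟶ M ⊗ X) (l : LensSet (M' ⊗ Y) B X' Y'),
      φ M' (f ≫ m ▷ X) l = φ M f (LensSet.pre (m ▷ Y) l)) : SeqSet A B X Y X' Y' → β :=
  Comp.lift (F := tensorRight X ⋙ coyoneda.obj (op A))
    (G := (tensorRight Y).op ⋙ lensFrom B X' Y') φ h

@[simp]
theorem lift_mk {A B X Y X' Y' : C} {β : Sort*}
    (φ : ∀ M : C, (A ⟶ M ⊗ X) → LensSet (M ⊗ Y) B X' Y' → β)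
    (h : ∀ (M M' : C) (m : M ⟶ M') (f : A ⟶ M ⊗ X) (l : LensSet (M' ⊗ Y) B X' Y'),
      φ M' (f ≫ m ▷ X) l = φ M f (LensSet.pre (m ▷ Y) l)) (M : C) (f : A ⟶ M ⊗ X)
    (l : LensSet (M ⊗ Y) B X' Y') : lift φ h (mk M f l) = φ M f l :=
  rfl

/-- The action of lenses `(A', B') ⟶ (A, B)`: a lens `(R, a, b)` sends `(M, f, g, h)`, with
`f : A ⟶ M ⊗ X`, `g : M ⊗ Y ⟶ M' ⊗ X'` and `h : M' ⊗ Y' ⟶ B`, to the element with residuals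
`R ⊗ M` and `R ⊗ M'` given by `a` followed by `R ◁ f`, by `R ◁ g`, and by `R ◁ h` followed by
`b`. -/
def pre {A' B' A B X Y X' Y' : C} (k : LensSet A' B' A B) (z : SeqSet A B X Y X' Y') :
    SeqSet A' B' X Y X' Y' :=
  LensSet.lift (fun R a b => lift
    (fun M f l => mk (R ⊗ M) (a ≫ R ◁ f ≫ (α_ R M X).inv)
      (LensSet.comp (LensSet.mk R (α_ R M Y).hom b) l))
    (by
      intro M M' m f l
      refine (slide_eq (R ◁ m) ?_ ?_).symm
      · simp
      · induction l using LensSet.ind with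
        | h P c d => simp) z)
    (by
      intro R R' r a b
      induction z using ind with
      | h M f l =>
        rw [lift_mk, lift_mk]
        refine (slide_eq (r ▷ M) ?_ ?_).symm
        · simp [← whisker_exchange_assoc]
        · rw [LensSet.pre_comp, LensSet.pre_mk, ← LensSet.slide]
          simp) k

/-- The action of lenses out of `(X, Y)` and `(X', Y')`: lenses `(R, c, d)` and `(R', c', d')` send
`(M, f, g, h)`, with `f : A ⟶ M ⊗ X`, `g : M ⊗ Y ⟶ M' ⊗ X'` and `h : M' ⊗ Y' ⟶ B`, to the element
with residuals `M ⊗ R` and `M' ⊗ R'` given by `f` followed by `M ◁ c`, by `M ◁ d` followed by `g`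
and `M' ◁ c'`, and by `M' ◁ d'` followed by `h`. -/
def post {A B X Y X' Y' U V U' V' : C} (z : SeqSet A B X Y X' Y') (k : LensSet X Y U V)
    (k' : LensSet X' Y' U' V') : SeqSet A B U V U' V' :=
  lift (fun M f l => LensSet.lift
    (fun R c d => mk (M ⊗ R) (f ≫ M ◁ c ≫ (α_ M R U).inv)
      (LensSet.comp (LensSet.pre ((α_ M R V).hom ≫ M ◁ d) l) k'))
    (by
      intro R R' r c d
      refine (slide_eq (M ◁ r) ?_ ?_).symm
      · simp
      · rw [LensSet.pre_comp, LensSet.pre_pre]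
        simp) k)
    (by
      intro M M' m f l
      induction k using LensSet.ind with
      | h R c d =>
        rw [LensSet.lift_mk, LensSet.lift_mk]
        refine (slide_eq (m ▷ R) ?_ ?_).symm
        · simp [← whisker_exchange_assoc]
        · rw [LensSet.pre_comp, LensSet.pre_pre, LensSet.pre_pre]
          simp [whisker_exchange]) z

@[simp]
theorem pre_mk {A' B' A B X Y X' Y' : C} (R : C) (a : A' ⟶ R ⊗ A) (b : R ⊗ B ⟶ B') (M : C)
    (f : A ⟶ M ⊗ X) (l : LensSet (M ⊗ Y) B X' Y') :
    pre (LensSet.mk R a b) (mk M f l) = mk (R ⊗ M) (a ≫ R ◁ f ≫ (α_ R M X).inv)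
      (LensSet.comp (LensSet.mk R (α_ R M Y).hom b) l) :=
  rfl

@[simp]
theorem post_mk {A B X Y X' Y' U V U' V' : C} (M : C) (f : A ⟶ M ⊗ X)
    (l : LensSet (M ⊗ Y) B X' Y') (R : C) (c : X ⟶ R ⊗ U) (d : R ⊗ V ⟶ Y)
    (k' : LensSet X' Y' U' V') :
    post (mk M f l) (LensSet.mk R c d) k' = mk (M ⊗ R) (f ≫ M ◁ c ≫ (α_ M R U).inv)
      (LensSet.comp (LensSet.pre ((α_ M R V).hom ≫ M ◁ d) l) k') :=
  rfl

theorem id_pre {A B X Y X' Y' : C} (z : SeqSet A B X Y X' Y') : pre (LensSet.id A B) z = z := by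
  induction z using ind with
  | h M f l =>
    refine slide_eq (λ_ M).hom (by simp) ?_
    induction l using LensSet.ind with
    | h P c d =>
      refine LensSet.slide_iso (λ_ P) _ _ ?_ ?_ <;> simp

theorem comp_pre {A'' B'' A' B' A B X Y X' Y' : C} (k : LensSet A'' B'' A' B')
    (l : LensSet A' B' A B) (z : SeqSet A B X Y X' Y') :
    pre (LensSet.comp k l) z = pre k (pre l z) := by
  induction k using LensSet.ind with
  | h R a b =>
    induction l using LensSet.ind with
    | h S c d =>
      induction z using ind with
      | h M f l =>
        refine slide_eq (α_ R S M).hom (by simp) ?_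
        induction l using LensSet.ind with
        | h P p q =>
          refine LensSet.slide_iso (α_ R S P) _ _ ?_ ?_ <;> simp

theorem post_id {A B X Y X' Y' : C} (z : SeqSet A B X Y X' Y') :
    post z (LensSet.id X Y) (LensSet.id X' Y') = z := by
  induction z using ind with
  | h M f l =>
    refine slide_eq (ρ_ M).hom (by simp) ?_
    rw [LensSet.comp_id]
    simp

theorem post_comp {A B X Y X' Y' U V U' V' W Z W' Z' : C} (z : SeqSet A B X Y X' Y')
    (k : LensSet X Y U V) (k' : LensSet X' Y' U' V') (l : LensSet U V W Z)
    (l' : LensSet U' V' W' Z') :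
    post z (LensSet.comp k l) (LensSet.comp k' l') = post (post z k k') l l' := by
  induction z using ind with
  | h M f z =>
    induction k using LensSet.ind with
    | h R c d =>
      induction l using LensSet.ind with
      | h S a b =>
        refine (slide_eq (α_ M R S).hom (by simp) ?_).symm
        simp only [LensSet.pre_comp, LensSet.pre_pre, LensSet.assoc]
        simp

theorem pre_post {A' B' A B X Y X' Y' U V U' V' : C} (k : LensSet A' B' A B)
    (z : SeqSet A B X Y X' Y') (l : LensSet X Y U V) (l' : LensSet X' Y' U' V') :
    post (pre k z) l l' = pre k (post z l l') := by
  induction k using LensSet.ind with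
  | h R a b =>
    induction z using ind with
    | h M f z =>
      induction l using LensSet.ind with
      | h S c d =>
        refine slide_eq (α_ R M S).hom (by simp) ?_
        simp only [LensSet.pre_comp, LensSet.pre_mk, ← LensSet.assoc]
        induction z using LensSet.ind with
        | h P p q => simp

end SeqSet

/-- The sequential splits of monoidal lenses,
`((X, Y), (X', Y')) ↦ ∫^M C(A; M ⊗ X) × ∫^M' C(M ⊗ Y; M' ⊗ X') × C(M' ⊗ Y'; B)`. -/
def lensSeq (C : Type u) [Category.{v} C] [MonoidalCategory C] :
    Profunctor.{max u v} (Lens C × Lens C) (Lens C) where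
  obj P :=
    { obj := fun A => SeqSet A.unop.fst A.unop.snd P.1.fst P.1.snd P.2.fst P.2.snd
      map := fun k => ↾fun z => SeqSet.pre k.unop z
      map_id := fun _ => by
        ext z
        exact SeqSet.id_pre z
      map_comp := fun k l => by
        ext z
        exact SeqSet.comp_pre l.unop k.unop z }
  map k :=
    { app := fun _ => ↾fun z => SeqSet.post z k.1 k.2
      naturality := fun _ _ k' => by
        ext z
        exact SeqSet.pre_post k'.unop z _ _ }
  map_id P := by
    ext A z
    exact SeqSet.post_id z
  map_comp k l := by
    ext A z
    exact SeqSet.post_comp z _ _ _ _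

end Lenses
end Produo

namespace Produo

universe v u w₁ w₂ w₃ w₄ v'

section LensMonoidal

variable {C : Type u} [Category.{v} C] [MonoidalCategory C]

namespace Lens

/-- The lens with residual `M` given by `f : A ⟶ M ⊗ X` and `g : M ⊗ Y ⟶ B`. -/
def lens {A B X Y : C} (M : C) (f : A ⟶ M ⊗ X) (g : M ⊗ Y ⟶ B) : (⟨A, B⟩ : Lens C) ⟶ ⟨X, Y⟩ :=
  LensSet.mk M f g

/-- The lens with trivial residual given by `f : A ⟶ X` and `g : Y ⟶ B`. -/
def ofHoms {A B X Y : C} (f : A ⟶ X) (g : Y ⟶ B) : (⟨A, B⟩ : Lens C) ⟶ ⟨X, Y⟩ :=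
  lens (𝟙_ C) (f ≫ (λ_ X).inv) ((λ_ Y).hom ≫ g)

theorem lens_ind {A B : Lens C} {p : (A ⟶ B) → Prop}
    (h : ∀ (M : C) (f : A.fst ⟶ M ⊗ B.fst) (g : M ⊗ B.snd ⟶ A.snd), p (lens M f g))
    (k : A ⟶ B) : p k :=
  LensSet.ind h k

theorem lens_comp {A B X Y U W : C} (M P : C) (f : A ⟶ M ⊗ X) (g : M ⊗ Y ⟶ B) (a : X ⟶ P ⊗ U)
    (b : P ⊗ W ⟶ Y) :
    lens M f g ≫ lens P a b =
      lens (M ⊗ P) (f ≫ M ◁ a ≫ (α_ M P U).inv) ((α_ M P W).hom ≫ M ◁ b ≫ g) :=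
  rfl

theorem lens_slide {A B X Y M M' : C} (m : M ⟶ M') {f : A ⟶ M ⊗ X} {f' : A ⟶ M' ⊗ X}
    {g : M ⊗ Y ⟶ B} {g' : M' ⊗ Y ⟶ B} (hf : f' = f ≫ m ▷ X) (hg : g = m ▷ Y ≫ g') :
    lens M f g = lens M' f' g' := by
  subst hf hg
  exact (LensSet.slide m f g').symm

theorem ofHoms_id (A : Lens C) : ofHoms (𝟙 A.fst) (𝟙 A.snd) = 𝟙 A :=
  lens_slide (𝟙 _) (by simp) (by simp)

@[simp]
theorem ofHoms_lens {A B A' B' X Y : C} (f : A ⟶ A') (g : B' ⟶ B) (M : C) (a : A' ⟶ M ⊗ X)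
    (b : M ⊗ Y ⟶ B') : ofHoms f g ≫ lens M a b = lens M (f ≫ a) (b ≫ g) :=
  lens_slide (λ_ M).hom (by simp) (by simp)

@[simp]
theorem lens_ofHoms {A B A' B' X Y : C} (f : A' ⟶ X) (g : Y ⟶ B') (M : C) (a : A ⟶ M ⊗ A')
    (b : M ⊗ B' ⟶ B) : lens M a b ≫ ofHoms f g = lens M (a ≫ M ◁ f) (M ◁ g ≫ b) :=
  lens_slide (ρ_ M).hom (by simp) (by simp)

@[simp]
theorem ofHoms_comp {A B A' B' X Y : C} (f : A ⟶ A') (g : B' ⟶ B) (f' : A' ⟶ X) (g' : Y ⟶ B') :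
    ofHoms f g ≫ ofHoms f' g' = ofHoms (f ≫ f') (g' ≫ g) :=
  (ofHoms_lens _ _ _ _ _).trans (by simp [ofHoms])

theorem ofHoms_comp_comp {A₀ B₀ A₁ B₁ A₂ B₂ A₃ B₃ : C} (f : A₀ ⟶ A₁) (g : B₁ ⟶ B₀) (f' : A₁ ⟶ A₂)
    (g' : B₂ ⟶ B₁) (f'' : A₂ ⟶ A₃) (g'' : B₃ ⟶ B₂) :
    ofHoms f g ≫ ofHoms f' g' ≫ ofHoms f'' g'' = ofHoms (f ≫ f' ≫ f'') ((g'' ≫ g') ≫ g) := by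
  simp

/-- An isomorphism of pairs. -/
def isoOfIsos {A B X Y : C} (f : A ≅ X) (g : B ≅ Y) : (⟨A, B⟩ : Lens C) ≅ ⟨X, Y⟩ where
  hom := ofHoms f.hom g.inv
  inv := ofHoms f.inv g.hom
  hom_inv_id := by simpa using ofHoms_id (⟨A, B⟩ : Lens C)
  inv_hom_id := by simpa using ofHoms_id (⟨X, Y⟩ : Lens C)

variable [SymmetricCategory C]

instance : MonoidalCategoryStruct (Lens C) where
  tensorObj X Y := ⟨X.fst ⊗ Y.fst, X.snd ⊗ Y.snd⟩
  tensorUnit := ⟨𝟙_ C, 𝟙_ C⟩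
  tensorHom k l := LensSet.tensor k l
  whiskerLeft X _ _ k := LensSet.tensor (LensSet.id X.fst X.snd) k
  whiskerRight k Y := LensSet.tensor k (LensSet.id Y.fst Y.snd)
  associator X Y Z := isoOfIsos (α_ X.fst Y.fst Z.fst) (α_ X.snd Y.snd Z.snd)
  leftUnitor X := isoOfIsos (λ_ X.fst) (λ_ X.snd)
  rightUnitor X := isoOfIsos (ρ_ X.fst) (ρ_ X.snd)

theorem tensor_lens {A B X Y A' B' X' Y' : C} (M P : C) (f : A ⟶ M ⊗ X) (g : M ⊗ Y ⟶ B)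
    (a : A' ⟶ P ⊗ X') (b : P ⊗ Y' ⟶ B') :
    lens M f g ⊗ₘ lens P a b =
      lens (M ⊗ P) ((f ⊗ₘ a) ≫ tensorμ M X P X') (tensorμ M P Y Y' ≫ (g ⊗ₘ b)) :=
  rfl

@[simp]
theorem tensor_ofHoms {A B X Y A' B' X' Y' : C} (f : A ⟶ X) (g : Y ⟶ B) (f' : A' ⟶ X')
    (g' : Y' ⟶ B') : ofHoms f g ⊗ₘ ofHoms f' g' = ofHoms (f ⊗ₘ f') (g ⊗ₘ g') := by
  refine (tensor_lens _ _ _ _ _ _).trans (lens_slide (λ_ (𝟙_ C)).hom ?_ ?_)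
  · have h := leftUnitor_monoidal X X'
    rw [← cancel_mono (λ_ (X ⊗ X')).hom]
    simp only [Category.assoc, Iso.inv_hom_id, Category.comp_id, ← h]
    simp
  · rw [tensor_left_unitality, Category.assoc, hom_inv_whiskerRight_assoc, Category.assoc,
      tensorHom_comp_tensorHom]

theorem associator_hom (X Y Z : Lens C) :
    (α_ X Y Z).hom = ofHoms (α_ X.fst Y.fst Z.fst).hom (α_ X.snd Y.snd Z.snd).inv :=
  rfl

theorem associator_inv (X Y Z : Lens C) :
    (α_ X Y Z).inv = ofHoms (α_ X.fst Y.fst Z.fst).inv (α_ X.snd Y.snd Z.snd).hom :=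
  rfl

theorem leftUnitor_hom (X : Lens C) : (λ_ X).hom = ofHoms (λ_ X.fst).hom (λ_ X.snd).inv :=
  rfl

theorem rightUnitor_hom (X : Lens C) : (ρ_ X).hom = ofHoms (ρ_ X.fst).hom (ρ_ X.snd).inv :=
  rfl

theorem tensor_ofHoms_id {A B X Y : C} (f : A ⟶ X) (g : Y ⟶ B) (Z : Lens C) :
    ofHoms f g ⊗ₘ 𝟙 Z = ofHoms (f ▷ Z.fst) (g ▷ Z.snd) := by
  rw [← ofHoms_id, tensor_ofHoms, tensorHom_id, tensorHom_id]

theorem id_tensor_ofHoms {A B X Y : C} (f : A ⟶ X) (g : Y ⟶ B) (Z : Lens C) :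
    𝟙 Z ⊗ₘ ofHoms f g = ofHoms (Z.fst ◁ f) (Z.snd ◁ g) := by
  rw [← ofHoms_id, tensor_ofHoms, id_tensorHom, id_tensorHom]

theorem lens_tensor_associator {A B A' B' A'' B'' X Y X' Y' X'' Y'' : C} (M P Q : C)
    (f : A ⟶ M ⊗ X) (g : M ⊗ Y ⟶ B) (a : A' ⟶ P ⊗ X') (b : P ⊗ Y' ⟶ B') (c : A'' ⟶ Q ⊗ X'')
    (d : Q ⊗ Y'' ⟶ B'') :
    lens ((M ⊗ P) ⊗ Q) ((((f ⊗ₘ a) ≫ tensorμ M X P X') ⊗ₘ c) ≫ tensorμ (M ⊗ P) (X ⊗ X') Q X'')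
          (tensorμ (M ⊗ P) Q (Y ⊗ Y') Y'' ≫ ((tensorμ M P Y Y' ≫ (g ⊗ₘ b)) ⊗ₘ d)) ≫
        ofHoms (α_ X X' X'').hom (α_ Y Y' Y'').inv =
      ofHoms (α_ A A' A'').hom (α_ B B' B'').inv ≫
        lens (M ⊗ (P ⊗ Q)) ((f ⊗ₘ ((a ⊗ₘ c) ≫ tensorμ P X' Q X'')) ≫
            tensorμ M X (P ⊗ Q) (X' ⊗ X''))
          (tensorμ M (P ⊗ Q) Y (Y' ⊗ Y'') ≫ (g ⊗ₘ (tensorμ P Q Y' Y'' ≫ (b ⊗ₘ d)))) := by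
  rw [lens_ofHoms, ofHoms_lens]
  refine lens_slide (α_ M P Q).hom ?_ ?_
  · have h := tensor_associativity M X P X' Q X''
    rw [tensorHom_def' (α_ M P Q).hom, ← Category.assoc, ← Category.assoc] at h
    have e₁ : ((f ⊗ₘ a) ≫ tensorμ M X P X') ⊗ₘ c =
        ((f ⊗ₘ a) ⊗ₘ c) ≫ tensorμ M X P X' ▷ (Q ⊗ X'') := by
      rw [← tensorHom_id, tensorHom_comp_tensorHom, Category.comp_id]
    have e₂ : f ⊗ₘ ((a ⊗ₘ c) ≫ tensorμ P X' Q X'') =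
        (f ⊗ₘ (a ⊗ₘ c)) ≫ (M ⊗ X) ◁ tensorμ P X' Q X'' := by
      rw [← id_tensorHom, tensorHom_comp_tensorHom, Category.comp_id]
    rw [e₁, e₂]
    simp only [Category.assoc] at h ⊢
    rw [h, associator_naturality_assoc]
  · have h := associator_monoidal M P Q Y Y' Y''
    rw [tensorHom_def (α_ M P Q).hom] at h
    have e₁ : (tensorμ M P Y Y' ≫ (g ⊗ₘ b)) ⊗ₘ d =
        tensorμ M P Y Y' ▷ (Q ⊗ Y'') ≫ ((g ⊗ₘ b) ⊗ₘ d) := by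
      rw [← tensorHom_id, tensorHom_comp_tensorHom, Category.id_comp]
    have e₂ : g ⊗ₘ (tensorμ P Q Y' Y'' ≫ (b ⊗ₘ d)) =
        (M ⊗ Y) ◁ tensorμ P Q Y' Y'' ≫ (g ⊗ₘ (b ⊗ₘ d)) := by
      rw [← id_tensorHom, tensorHom_comp_tensorHom, Category.id_comp]
    rw [e₁, e₂, ← cancel_mono (α_ B B' B'').hom]
    simp only [Category.assoc, Iso.inv_hom_id, Category.comp_id] at h ⊢
    rw [associator_naturality, reassoc_of% h, ← whisker_exchange_assoc, whiskerLeft_inv_hom_assoc]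

theorem associator_nat {X Y Z X' Y' Z' : Lens C} (k : X ⟶ X') (l : Y ⟶ Y') (m : Z ⟶ Z') :
    ((k ⊗ₘ l) ⊗ₘ m) ≫ (α_ X' Y' Z').hom = (α_ X Y Z).hom ≫ (k ⊗ₘ (l ⊗ₘ m)) := by
  induction k using lens_ind with
  | h M f g =>
    induction l using lens_ind with
    | h P a b =>
      induction m using lens_ind with
      | h Q c d => exact lens_tensor_associator M P Q f g a b c d

theorem lens_leftUnitor {A B X Y : C} (M : C) (f : A ⟶ M ⊗ X) (g : M ⊗ Y ⟶ B) :
    lens (𝟙_ C ⊗ M) (((λ_ (𝟙_ C)).inv ⊗ₘ f) ≫ tensorμ (𝟙_ C) (𝟙_ C) M X)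
          (tensorμ (𝟙_ C) M (𝟙_ C) Y ≫ ((λ_ (𝟙_ C)).hom ⊗ₘ g)) ≫
        ofHoms (λ_ X).hom (λ_ Y).inv =
      ofHoms (λ_ A).hom (λ_ B).inv ≫ lens M f g := by
  rw [lens_ofHoms, ofHoms_lens]
  refine lens_slide (λ_ M).hom ?_ ?_
  · have h := tensor_left_unitality M X
    rw [tensorHom_def' (λ_ M).hom] at h
    rw [tensorHom_def']
    simp only [Category.assoc]
    rw [← h, leftUnitor_naturality]
  · have h := leftUnitor_monoidal M Y
    rw [MonoidalCategory.tensorHom_def] at h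
    rw [MonoidalCategory.tensorHom_def (λ_ (𝟙_ C)).hom, ← cancel_mono (λ_ B).hom]
    simp only [Category.assoc, leftUnitor_naturality, Iso.inv_hom_id, Category.comp_id]
    rw [← reassoc_of% h, ← whisker_exchange_assoc, whiskerLeft_inv_hom_assoc]

theorem lens_rightUnitor {A B X Y : C} (M : C) (f : A ⟶ M ⊗ X) (g : M ⊗ Y ⟶ B) :
    lens (M ⊗ 𝟙_ C) ((f ⊗ₘ (λ_ (𝟙_ C)).inv) ≫ tensorμ M X (𝟙_ C) (𝟙_ C))
          (tensorμ M (𝟙_ C) Y (𝟙_ C) ≫ (g ⊗ₘ (λ_ (𝟙_ C)).hom)) ≫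
        ofHoms (ρ_ X).hom (ρ_ Y).inv =
      ofHoms (ρ_ A).hom (ρ_ B).inv ≫ lens M f g := by
  rw [lens_ofHoms, ofHoms_lens]
  refine lens_slide (ρ_ M).hom ?_ ?_
  · have h := tensor_right_unitality M X
    rw [tensorHom_def' (ρ_ M).hom] at h
    rw [MonoidalCategory.tensorHom_def]
    simp only [Category.assoc]
    rw [← h, rightUnitor_naturality]
  · have h := rightUnitor_monoidal M Y
    rw [MonoidalCategory.tensorHom_def] at h
    rw [tensorHom_def', ← cancel_mono (ρ_ B).hom]
    simp only [Category.assoc, rightUnitor_naturality, Iso.inv_hom_id, Category.comp_id]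
    rw [← reassoc_of% h, ← whisker_exchange_assoc, whiskerLeft_inv_hom_assoc]

theorem leftUnitor_nat {X X' : Lens C} (k : X ⟶ X') :
    (𝟙 (𝟙_ (Lens C)) ⊗ₘ k) ≫ (λ_ X').hom = (λ_ X).hom ≫ k := by
  induction k using lens_ind with
  | h M f g => exact lens_leftUnitor M f g

theorem rightUnitor_nat {X X' : Lens C} (k : X ⟶ X') :
    (k ⊗ₘ 𝟙 (𝟙_ (Lens C))) ≫ (ρ_ X').hom = (ρ_ X).hom ≫ k := by
  induction k using lens_ind with
  | h M f g => exact lens_rightUnitor M f g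

theorem tensorμ_braiding (M X P Y : C) :
    tensorμ M X P Y ≫ ((β_ M P).hom ⊗ₘ (β_ X Y).hom) =
      (β_ (M ⊗ X) (P ⊗ Y)).hom ≫ tensorμ P Y M X := by
  simp [tensorμ, SymmetricCategory.braiding_swap_eq_inv_braiding Y M, MonoidalCategory.tensorHom_def]

theorem tensorμ_braiding' (M P X Y : C) :
    tensorμ M P X Y ≫ (β_ (M ⊗ X) (P ⊗ Y)).hom =
      ((β_ M P).hom ⊗ₘ (β_ X Y).hom) ≫ tensorμ P M Y X := by
  simp [tensorμ, SymmetricCategory.braiding_swap_eq_inv_braiding Y M,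
    SymmetricCategory.braiding_swap_eq_inv_braiding X P, MonoidalCategory.tensorHom_def]

/-- The symmetry of the category of lenses. -/
def braid (X Y : Lens C) : X ⊗ Y ≅ Y ⊗ X :=
  isoOfIsos (β_ X.fst Y.fst) (β_ X.snd Y.snd)

theorem braid_hom (X Y : Lens C) :
    (braid X Y).hom = ofHoms (β_ X.fst Y.fst).hom (β_ X.snd Y.snd).inv :=
  rfl

theorem lens_braid {A B A' B' X Y X' Y' : C} (M P : C) (f : A ⟶ M ⊗ X) (g : M ⊗ Y ⟶ B)
    (a : A' ⟶ P ⊗ X') (b : P ⊗ Y' ⟶ B') :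
    lens (M ⊗ P) ((f ⊗ₘ a) ≫ tensorμ M X P X') (tensorμ M P Y Y' ≫ (g ⊗ₘ b)) ≫
        ofHoms (β_ X X').hom (β_ Y Y').inv =
      ofHoms (β_ A A').hom (β_ B B').inv ≫
        lens (P ⊗ M) ((a ⊗ₘ f) ≫ tensorμ P X' M X) (tensorμ P M Y' Y ≫ (b ⊗ₘ g)) := by
  rw [lens_ofHoms, ofHoms_lens]
  refine lens_slide (β_ M P).hom ?_ ?_
  · have h := tensorμ_braiding M X P X'
    rw [tensorHom_def'] at h
    simp only [Category.assoc]
    rw [h, BraidedCategory.braiding_naturality_assoc]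
  · have h := tensorμ_braiding' M P Y Y'
    rw [MonoidalCategory.tensorHom_def, ← whisker_exchange] at h
    rw [← cancel_mono (β_ B B').hom]
    simp only [Category.assoc, Iso.inv_hom_id, Category.comp_id] at h ⊢
    rw [BraidedCategory.braiding_naturality, reassoc_of% h, whiskerLeft_inv_hom_assoc]

theorem braid_nat {X Y X' Y' : Lens C} (k : X ⟶ X') (l : Y ⟶ Y') :
    (k ⊗ₘ l) ≫ (braid X' Y').hom = (braid X Y).hom ≫ (l ⊗ₘ k) := by
  induction k using lens_ind with
  | h M f g =>
    induction l using lens_ind with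
    | h P a b => exact lens_braid M P f g a b

instance : MonoidalCategory (Lens C) :=
  MonoidalCategory.ofTensorHom
    (id_tensorHom_id := fun X Y => LensSet.id_tensor_id _ _ _ _)
    (id_tensorHom := fun X Y Z f => rfl)
    (tensorHom_id := fun f Y => rfl)
    (tensorHom_comp_tensorHom := fun f g f' g' => (LensSet.comp_tensor_comp f f' g g').symm)
    (associator_naturality := associator_nat)
    (leftUnitor_naturality := leftUnitor_nat)
    (rightUnitor_naturality := rightUnitor_nat)
    (pentagon := fun W X Y Z => by
      simp only [associator_hom, tensor_ofHoms_id, id_tensor_ofHoms]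
      refine (ofHoms_comp_comp _ _ _ _ _ _).trans (Eq.trans ?_ (ofHoms_comp _ _ _ _).symm)
      exact congrArg₂ ofHoms (MonoidalCategory.pentagon _ _ _ _)
        ((Category.assoc _ _ _).trans pentagon_inv))
    (triangle := fun X Y => by
      simp only [associator_hom, leftUnitor_hom, rightUnitor_hom, tensor_ofHoms_id,
        id_tensor_ofHoms]
      refine (ofHoms_comp _ _ _ _).trans ?_
      exact congrArg₂ ofHoms (MonoidalCategory.triangle _ _) (triangle_assoc_comp_left_inv _ _))

instance : SymmetricCategory (Lens C) where
  braiding := braid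
  braiding_naturality_right X _ _ f := braid_nat (𝟙 X) f
  braiding_naturality_left f Z := braid_nat f (𝟙 Z)
  hexagon_forward X Y Z := by
    simp only [← id_tensorHom, ← tensorHom_id]
    simp only [associator_hom, braid_hom, tensor_ofHoms_id, id_tensor_ofHoms]
    refine (ofHoms_comp_comp _ _ _ _ _ _).trans (Eq.trans ?_ (ofHoms_comp_comp _ _ _ _ _ _).symm)
    exact congrArg₂ ofHoms (BraidedCategory.hexagon_forward _ _ _)
      ((Category.assoc _ _ _).trans ((BraidedCategory.hexagon_forward_inv _ _ _).trans
        (Category.assoc _ _ _).symm))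
  hexagon_reverse X Y Z := by
    simp only [← id_tensorHom, ← tensorHom_id]
    simp only [associator_inv, braid_hom, tensor_ofHoms_id, id_tensor_ofHoms]
    refine (ofHoms_comp_comp _ _ _ _ _ _).trans (Eq.trans ?_ (ofHoms_comp_comp _ _ _ _ _ _).symm)
    exact congrArg₂ ofHoms (BraidedCategory.hexagon_reverse _ _ _)
      ((Category.assoc _ _ _).trans ((BraidedCategory.hexagon_reverse_inv _ _ _).trans
        (Category.assoc _ _ _).symm))
  symmetry X Y := by
    refine (ofHoms_comp _ _ _ _).trans (Eq.trans ?_ (ofHoms_id (X ⊗ Y)))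
    exact congrArg₂ ofHoms (SymmetricCategory.symmetry _ _)
      ((Iso.inv_comp_eq _).2 ((Category.comp_id _).trans
        (SymmetricCategory.braiding_swap_eq_inv_braiding X.snd Y.snd)).symm)

end Lens
end LensMonoidal

section Convolution

variable {V : Type u} [Category.{max u v} V]

section Squares

variable {D : Type*} [Category* D] {A A' B B' E E' : D}

theorem square_trans {f : A ⟶ A'} {g : B ⟶ B'} {h : E ⟶ E'} {i : A ⟶ B} {i' : A' ⟶ B'}
    {j : B ⟶ E} {j' : B' ⟶ E'} (s : f ≫ i' = i ≫ g) (t : g ≫ j' = j ≫ h) :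
    f ≫ i' ≫ j' = (i ≫ j) ≫ h := by
  rw [reassoc_of% s, t, Category.assoc]

theorem square_symm {f : A ⟶ A'} {g : B ⟶ B'} {i : A ≅ B} {i' : A' ≅ B'}
    (s : f ≫ i'.hom = i.hom ≫ g) : g ≫ i'.inv = i.inv ≫ f := by
  rw [Iso.eq_inv_comp, ← reassoc_of% s, Iso.hom_inv_id, Category.comp_id]

theorem comp_trans {x : A ⟶ B'} {i : A ⟶ A'} {c : A' ⟶ B} {m : B ⟶ B'} {l : B ⟶ E} {l' : B' ⟶ E'}
    {k : E ⟶ E'} (h : i ≫ c ≫ m = x) (s : m ≫ l' = l ≫ k) : i ≫ (c ≫ l) ≫ k = x ≫ l' := by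
  rw [← h, Category.assoc, Category.assoc, Category.assoc, s]

theorem comp_trans_iso {x : A ⟶ B'} {i : A ⟶ A'} {c : A' ⟶ B} {m : B ⟶ B'} {l : B ⟶ E}
    {l' : B' ⟶ E'} {k : E ⟶ E'} {F : D} {d : F ≅ E} {g : F ⟶ E'} (h : i ≫ c ≫ m = x)
    (s : m ≫ l' = l ≫ k) (t : d.hom ≫ k = g) : i ≫ (c ≫ l ≫ d.inv) ≫ g = x ≫ l' := by
  rw [← h, ← t]
  simp [s]

end Squares

section ConvMap

variable (T : Profunctor.{max u v} (V × V) V)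

theorem convMap_comp {P Q P' Q' P'' Q'' : Psh.{v} V} (η : P ⟶ P') (θ : Q ⟶ Q') (η' : P' ⟶ P'')
    (θ' : Q' ⟶ Q'') :
    convMap T η θ ≫ convMap T η' θ' = convMap T (η ≫ η') (θ ≫ θ') :=
  ((conv T).map_comp (Prod.mkHom η θ) (Prod.mkHom η' θ')).symm

theorem convMap_id (P Q : Psh.{v} V) : convMap T (𝟙 P) (𝟙 Q) = 𝟙 _ :=
  (conv T).map_id (P, Q)

/-- Functoriality of convolution on isomorphisms. -/
def convMapIso {P Q P' Q' : Psh.{v} V} (η : P ≅ P') (θ : Q ≅ Q') :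
    (conv T).obj (P, Q) ≅ (conv T).obj (P', Q') where
  hom := convMap T η.hom θ.hom
  inv := convMap T η.inv θ.inv
  hom_inv_id := by rw [convMap_comp, Iso.hom_inv_id, Iso.hom_inv_id, convMap_id]
  inv_hom_id := by rw [convMap_comp, Iso.inv_hom_id, Iso.inv_hom_id, convMap_id]

theorem ins_convMap {P Q P' Q' : Psh.{v} V} (η : P ⟶ P') (θ : Q ⟶ Q') (U : V × V)
    (p : P.obj (op U.1)) (q : Q.obj (op U.2)) :
    ins (S := T) (G := ext P Q) U (p, q) ≫ convMap T η θ =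
      ins (S := T) (G := ext P' Q') U (η.app _ p, θ.app _ q) :=
  rfl

theorem conv_hom_ext {P Q X : Psh.{v} V} {a b : (conv T).obj (P, Q) ⟶ X}
    (h : ∀ (U : V × V) (p : P.obj (op U.1)) (q : Q.obj (op U.2)),
      ins (S := T) (G := ext P Q) U (p, q) ≫ a = ins (S := T) (G := ext P Q) U (p, q) ≫ b) :
    a = b :=
  subst_hom_ext (fun U y => h U y.1 y.2)

theorem map_ins_conv {P Q : Psh.{v} V} {U U' : V × V} (f : U ⟶ U') (p : P.obj (op U'.1))
    (q : Q.obj (op U'.2)) :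
    T.map f ≫ ins (S := T) (G := ext P Q) U' (p, q) =
      ins (S := T) (G := ext P Q) U (P.map f.1.op p, Q.map f.2.op q) :=
  map_ins (G := ext P Q) f (p, q)

end ConvMap

/-- The map of presheaves classified by an element. -/
def classify {P : Psh.{v} V} {X : V} (p : P.obj (op X)) : yoneda.obj X ⟶ P :=
  yonedaEquiv.symm p

theorem classify_id {P : Psh.{v} V} {X : V} (p : P.obj (op X)) : (classify p).app _ (𝟙 X) = p := by
  simp [classify, yonedaEquiv]

theorem classify_app {P : Psh.{v} V} {X Y : V} (p : P.obj (op X)) (f : Y ⟶ X) :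
    (classify p).app (op Y) f = P.map f.op p := by
  simp [classify, yonedaEquiv]

section Yoneda

variable (T : Profunctor.{max u v} (V × V) V)

/-- The convolution of representable presheaves. -/
def splitIso (X : V × V) : T.obj X ≅ (conv T).obj (yoneda.obj X.1, yoneda.obj X.2) where
  hom := ins (S := T) (G := ext (yoneda.obj X.1) (yoneda.obj X.2)) X (𝟙 X.1, 𝟙 X.2)
  inv := desc (fun U (y : (U.1 ⟶ X.1) × (U.2 ⟶ X.2)) => T.map (Prod.mkHom y.1 y.2))
    (fun U U' f y => (T.map_comp _ _).symm)
  hom_inv_id := T.map_id X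
  inv_hom_id := conv_hom_ext T (fun U p q => by
    refine (map_ins_conv T (Prod.mkHom p q) _ _).trans ?_
    exact congrArg₂ (fun a b => ins (S := T) (G := ext (yoneda.obj X.1) (yoneda.obj X.2)) U (a, b))
      (Category.comp_id p) (Category.comp_id q))

theorem splitIso_naturality {X Y : V × V} (f : X ⟶ Y) :
    T.map f ≫ (splitIso T Y).hom =
      (splitIso T X).hom ≫ convMap T (yoneda.map f.1) (yoneda.map f.2) := by
  refine (map_ins_conv T f _ _).trans ?_
  exact congrArg₂ (fun a b => ins (S := T) (G := ext (yoneda.obj Y.1) (yoneda.obj Y.2)) X (a, b))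
      ((Category.comp_id _).trans (Category.id_comp _).symm)
      ((Category.comp_id _).trans (Category.id_comp _).symm)

/-- The presheaf `V(•; P ◁ Z)`. -/
abbrev leftConv (P : Psh.{v} V) (Z : V) : Psh.{v} V :=
  subst (Prod.sectL V Z ⋙ T) P

/-- Functoriality of `V(•; P ◁ Z)`. -/
abbrev leftConvMap {P Q : Psh.{v} V} {Z W : V} (η : P ⟶ Q) (f : Z ⟶ W) :
    leftConv T P Z ⟶ leftConv T Q W :=
  substMap (S := Prod.sectL V Z ⋙ T) (S' := Prod.sectL V W ⋙ T)
    { app := fun U => T.map (Prod.mkHom (𝟙 U) f)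
      naturality := fun _ _ g => map_comm T g f } η

/-- The presheaf `V(•; Z ◁ P)`. -/
abbrev rightConv (Z : V) (P : Psh.{v} V) : Psh.{v} V :=
  subst (Prod.sectR Z V ⋙ T) P

/-- Functoriality of `V(•; Z ◁ P)`. -/
abbrev rightConvMap {P Q : Psh.{v} V} {Z W : V} (f : Z ⟶ W) (η : P ⟶ Q) :
    rightConv T Z P ⟶ rightConv T W Q :=
  substMap (S := Prod.sectR Z V ⋙ T) (S' := Prod.sectR W V ⋙ T)
    { app := fun U => T.map (Prod.mkHom f (𝟙 U))
      naturality := fun _ _ g => (map_comm T f g).symm } η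

/-- Convolution with a representable presheaf on the right. -/
def convLeftIso (P : Psh.{v} V) (Z : V) :
    leftConv T P Z ≅ (conv T).obj (P, yoneda.obj Z) where
  hom := desc (fun U p => ins (S := T) (G := ext P (yoneda.obj Z)) (U, Z) (p, 𝟙 Z))
    (fun U U' f p => by
      refine (map_ins_conv T (Prod.mkHom f (𝟙 Z)) _ _).trans ?_
      exact congrArg (fun b => ins (S := T) (G := ext P (yoneda.obj Z)) (U, Z)
        (P.map f.op p, b)) (Category.comp_id _))
  inv := desc (fun U (y : P.obj (op U.1) × (U.2 ⟶ Z)) =>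
      T.map (Prod.mkHom (𝟙 U.1) y.2) ≫ ins (S := Prod.sectL V Z ⋙ T) (G := P) U.1 y.1)
    (fun U U' f y => by
      refine Eq.trans ?_ (congrArg (fun z => T.map (Prod.mkHom (𝟙 U.1) (f.2 ≫ y.2)) ≫ z)
        (map_ins (S := Prod.sectL V Z ⋙ T) (G := P) f.1 y.1))
      refine (T.map_comp_assoc _ _ _).symm.trans (Eq.trans ?_ (T.map_comp_assoc _ _ _))
      congr 2
      exact Prod.ext
        ((Category.comp_id f.1).trans (Category.id_comp f.1).symm) (Category.comp_id _).symm)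
  hom_inv_id := subst_hom_ext (fun U p => by
    refine Eq.trans ?_ (Category.id_comp _)
    exact congrArg (fun z => z ≫ ins (S := Prod.sectL V Z ⋙ T) (G := P) U p)
      (T.map_id (U, Z)))
  inv_hom_id := conv_hom_ext T (fun U p q => by
    refine (map_ins_conv T (P := P) (Q := yoneda.obj Z) (Prod.mkHom (𝟙 U.1) q) _ _).trans ?_
    exact congrArg₂ (fun a b => ins (S := T) (G := ext P (yoneda.obj Z)) U (a, b))
      (Functor.map_id_apply P _ p) (Category.comp_id q))

theorem convLeftIso_naturality {P Q : Psh.{v} V} {Z W : V} (η : P ⟶ Q) (f : Z ⟶ W) :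
    leftConvMap T η f ≫ (convLeftIso T Q W).hom =
      (convLeftIso T P Z).hom ≫ convMap T η (yoneda.map f) :=
  subst_hom_ext (fun U p => by
    refine (map_ins_conv T (P := Q) (Q := yoneda.obj W) (Prod.mkHom (𝟙 U) f)
      (η.app _ p) (𝟙 W)).trans ?_
    exact congrArg₂ (fun a b => ins (S := T) (G := ext Q (yoneda.obj W)) (U, Z) (a, b))
      (Functor.map_id_apply Q _ _) ((Category.comp_id _).trans (Category.id_comp _).symm))

/-- Convolution with a representable presheaf on the left. -/
def convRightIso (Z : V) (P : Psh.{v} V) :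
    rightConv T Z P ≅ (conv T).obj (yoneda.obj Z, P) where
  hom := desc (fun U p => ins (S := T) (G := ext (yoneda.obj Z) P) (Z, U) (𝟙 Z, p))
    (fun U U' f p => by
      refine (map_ins_conv T (Prod.mkHom (𝟙 Z) f) _ _).trans ?_
      exact congrArg (fun b => ins (S := T) (G := ext (yoneda.obj Z) P) (Z, U)
        (b, P.map f.op p)) (Category.comp_id _))
  inv := desc (fun U (y : (U.1 ⟶ Z) × P.obj (op U.2)) =>
      T.map (Prod.mkHom y.1 (𝟙 U.2)) ≫ ins (S := Prod.sectR Z V ⋙ T) (G := P) U.2 y.2)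
    (fun U U' f y => by
      refine Eq.trans ?_ (congrArg (fun z => T.map (Prod.mkHom (f.1 ≫ y.1) (𝟙 U.2)) ≫ z)
        (map_ins (S := Prod.sectR Z V ⋙ T) (G := P) f.2 y.2))
      refine (T.map_comp_assoc _ _ _).symm.trans (Eq.trans ?_ (T.map_comp_assoc _ _ _))
      congr 2
      exact Prod.ext (Category.comp_id _).symm
        ((Category.comp_id f.2).trans (Category.id_comp f.2).symm))
  hom_inv_id := subst_hom_ext (fun U p => by
    refine Eq.trans ?_ (Category.id_comp _)
    exact congrArg (fun z => z ≫ ins (S := Prod.sectR Z V ⋙ T) (G := P) U p)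
      (T.map_id (Z, U)))
  inv_hom_id := conv_hom_ext T (fun U p q => by
    refine (map_ins_conv T (P := yoneda.obj Z) (Q := P) (Prod.mkHom p (𝟙 U.2)) _ _).trans ?_
    exact congrArg₂ (fun a b => ins (S := T) (G := ext (yoneda.obj Z) P) U (a, b))
      (Category.comp_id p) (Functor.map_id_apply P _ q))

theorem convRightIso_naturality {P Q : Psh.{v} V} {Z W : V} (f : Z ⟶ W) (η : P ⟶ Q) :
    rightConvMap T f η ≫ (convRightIso T W Q).hom =
      (convRightIso T Z P).hom ≫ convMap T (yoneda.map f) η :=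
  subst_hom_ext (fun U p => by
    refine (map_ins_conv T (P := yoneda.obj W) (Q := Q) (Prod.mkHom f (𝟙 U))
      (𝟙 W) (η.app _ p)).trans ?_
    exact congrArg₂ (fun a b => ins (S := T) (G := ext (yoneda.obj W) Q) (Z, U) (a, b))
      ((Category.comp_id _).trans (Category.id_comp _).symm) (Functor.map_id_apply Q _ _))

/-- The splits `V(•; (X ◁ Y) ◁ Z)` as an iterated convolution. -/
def nestLeftIso (X Y Z : V) : (nestLeft T).obj ((X, Y), Z) ≅
    (conv T).obj ((conv T).obj (yoneda.obj X, yoneda.obj Y), yoneda.obj Z) :=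
  convLeftIso T (T.obj (X, Y)) Z ≪≫ convMapIso T (splitIso T (X, Y)) (Iso.refl _)

/-- The splits `V(•; X ◁ (Y ◁ Z))` as an iterated convolution. -/
def nestRightIso (X Y Z : V) : (nestRight T).obj (X, (Y, Z)) ≅
    (conv T).obj (yoneda.obj X, (conv T).obj (yoneda.obj Y, yoneda.obj Z)) :=
  convRightIso T X (T.obj (Y, Z)) ≪≫ convMapIso T (Iso.refl _) (splitIso T (Y, Z))

/-- The splits `V(•; (X ◁ Y) ⊗ (Z ◁ W))` as an iterated convolution. -/
def nestBothIso (S : Profunctor.{max u v} (V × V) V) (X Y : V × V) : (nestBoth T S).obj (X, Y) ≅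
    (conv T).obj ((conv S).obj (yoneda.obj X.1, yoneda.obj X.2),
      (conv S).obj (yoneda.obj Y.1, yoneda.obj Y.2)) :=
  convMapIso T (splitIso S X) (splitIso S Y)

theorem nestLeftIso_naturality {X Y Z X' Y' Z' : V} (f : X ⟶ X') (g : Y ⟶ Y') (h : Z ⟶ Z') :
    (nestLeft T).map (Prod.mkHom (Prod.mkHom f g) h) ≫ (nestLeftIso T X' Y' Z').hom =
      (nestLeftIso T X Y Z).hom ≫
        convMap T (convMap T (yoneda.map f) (yoneda.map g)) (yoneda.map h) := by
  change leftConvMap T (T.map (Prod.mkHom f g)) h ≫ (convLeftIso T _ Z').hom ≫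
      convMap T (splitIso T (X', Y')).hom (𝟙 _) =
    ((convLeftIso T _ Z).hom ≫ convMap T (splitIso T (X, Y)).hom (𝟙 _)) ≫ _
  rw [← Category.assoc, convLeftIso_naturality, Category.assoc, Category.assoc, convMap_comp,
    convMap_comp, splitIso_naturality, Category.comp_id, Category.id_comp]

theorem nestRightIso_naturality {X Y Z X' Y' Z' : V} (f : X ⟶ X') (g : Y ⟶ Y') (h : Z ⟶ Z') :
    (nestRight T).map (Prod.mkHom f (Prod.mkHom g h)) ≫ (nestRightIso T X' Y' Z').hom =
      (nestRightIso T X Y Z).hom ≫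
        convMap T (yoneda.map f) (convMap T (yoneda.map g) (yoneda.map h)) := by
  change rightConvMap T f (T.map (Prod.mkHom g h)) ≫ (convRightIso T X' _).hom ≫
      convMap T (𝟙 _) (splitIso T (Y', Z')).hom =
    ((convRightIso T X _).hom ≫ convMap T (𝟙 _) (splitIso T (Y, Z)).hom) ≫ _
  rw [← Category.assoc, convRightIso_naturality, Category.assoc, Category.assoc, convMap_comp,
    convMap_comp, splitIso_naturality, Category.comp_id, Category.id_comp]

theorem nestBothIso_naturality (S : Profunctor.{max u v} (V × V) V) {X Y X' Y' : V × V}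
    (f : X ⟶ X') (g : Y ⟶ Y') :
    (nestBoth T S).map (Prod.mkHom f g) ≫ (nestBothIso T S X' Y').hom =
      (nestBothIso T S X Y).hom ≫ convMap T (convMap S (yoneda.map f.1) (yoneda.map f.2))
        (convMap S (yoneda.map g.1) (yoneda.map g.2)) := by
  change convMap T (S.map f) (S.map g) ≫ convMap T (splitIso S X').hom (splitIso S Y').hom =
    convMap T (splitIso S X).hom (splitIso S Y).hom ≫ _
  rw [convMap_comp, convMap_comp, splitIso_naturality, splitIso_naturality]

theorem splitIso_classify {P Q : Psh.{v} V} {X : V × V} (p : P.obj (op X.1))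
    (q : Q.obj (op X.2)) :
    (splitIso T X).hom ≫ convMap T (classify p) (classify q) =
      ins (S := T) (G := ext P Q) X (p, q) := by
  refine (ins_convMap T (classify p) (classify q) X (𝟙 X.1) (𝟙 X.2)).trans ?_
  rw [classify_id, classify_id]

theorem splitIso_classify_app {P Q : Psh.{v} V} {X : V × V} {A : Vᵒᵖ} (s : (T.obj X).obj A)
    (p : P.obj (op X.1)) (q : Q.obj (op X.2)) :
    (convMap T (classify p) (classify q)).app A ((splitIso T X).hom.app A s) =
      el T (ext P Q) X s (p, q) :=
  ConcreteCategory.congr_hom (NatTrans.congr_app (splitIso_classify T p q) A) s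

theorem ins_convLeftIso_classify {P Q : Psh.{v} V} {X : V × V} (p : P.obj (op X.1))
    (q : Q.obj (op X.2)) :
    ins (S := Prod.sectL V X.2 ⋙ T) (G := P) X.1 p ≫ (convLeftIso T P X.2).hom ≫
        convMap T (𝟙 P) (classify q) =
      ins (S := T) (G := ext P Q) X (p, q) := by
  refine (ins_convMap T (𝟙 P) (classify q) X p (𝟙 X.2)).trans ?_
  rw [classify_id]
  rfl

theorem ins_convRightIso_classify {P Q : Psh.{v} V} {X : V × V} (p : P.obj (op X.1))
    (q : Q.obj (op X.2)) :
    ins (S := Prod.sectR X.1 V ⋙ T) (G := Q) X.2 q ≫ (convRightIso T X.1 Q).hom ≫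
        convMap T (classify p) (𝟙 Q) =
      ins (S := T) (G := ext P Q) X (p, q) := by
  refine (ins_convMap T (classify p) (𝟙 Q) X (𝟙 X.1) q).trans ?_
  rw [classify_id]
  rfl

theorem conv_conv_hom_ext {P Q R W : Psh.{v} V} {a b : (conv T).obj ((conv T).obj (P, Q), R) ⟶ W}
    (h : ∀ (U X Y Z : V) (s : (T.obj (X, Y)).obj (op U)) (p : P.obj (op X)) (q : Q.obj (op Y))
      (r : R.obj (op Z)),
      ins (S := T) (G := ext ((conv T).obj (P, Q)) R) (U, Z) (el T (ext P Q) (X, Y) s (p, q), r) ≫ a =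
        ins (S := T) (G := ext ((conv T).obj (P, Q)) R) (U, Z)
          (el T (ext P Q) (X, Y) s (p, q), r) ≫ b) : a = b :=
  conv_hom_ext T (fun U c r => by
    induction c using Comp.ind with
    | h X s y => exact h U.1 X.1 X.2 U.2 s y.1 y.2 r)

theorem ins_nestLeftIso_classify {P Q R : Psh.{v} V} {U X Y Z : V}
    (s : (T.obj (X, Y)).obj (op U)) (p : P.obj (op X)) (q : Q.obj (op Y)) (r : R.obj (op Z)) :
    (ins (S := Prod.sectL V Z ⋙ T) (G := T.obj (X, Y)) U s :
        T.obj (U, Z) ⟶ (nestLeft T).obj ((X, Y), Z)) ≫ (nestLeftIso T X Y Z).hom ≫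
          convMap T (convMap T (classify p) (classify q)) (classify r) =
      ins (S := T) (G := ext ((conv T).obj (P, Q)) R) (U, Z)
        (el T (ext P Q) (X, Y) s (p, q), r) :=
  congrArg₂ (fun a b => ins (S := T) (G := ext ((conv T).obj (P, Q)) R) (U, Z) (a, b))
    (splitIso_classify_app T (X := (X, Y)) s p q)
    (classify_id r)

theorem nestRightIso_classify {P Q R : Psh.{v} V} {X Y Z : V} (p : P.obj (op X))
    (q : Q.obj (op Y)) (r : R.obj (op Z)) :
    (nestRightIso T X Y Z).hom ≫ convMap T (classify p) (convMap T (classify q) (classify r)) =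
      ins (S := prod.associator V V V ⋙ nestRight T) (G := ext (ext P Q) R) ((X, Y), Z)
          ((p, q), r) ≫ gatherRight T P Q R :=
  subst_hom_ext (S := Prod.sectR X V ⋙ T) (G := T.obj (Y, Z)) (fun U s =>
    congrArg₂ (fun a b => ins (S := T) (G := ext P ((conv T).obj (Q, R))) (X, U) (a, b))
      (classify_id p) (splitIso_classify_app T (X := (Y, Z)) s q r))

theorem ins_nestBothIso_classify (S : Profunctor.{max u v} (V × V) V) {P Q R W : Psh.{v} V}
    {U X Y : V × V} (s : (S.obj X).obj (op U.1)) (x : P.obj (op X.1) × Q.obj (op X.2))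
    (t : (S.obj Y).obj (op U.2)) (y : R.obj (op Y.1) × W.obj (op Y.2)) :
    (ins (S := T) (G := ext (S.obj X) (S.obj Y)) U (s, t) :
        T.obj U ⟶ (nestBoth T S).obj (X, Y)) ≫ (nestBothIso T S X Y).hom ≫
          convMap T (convMap S (classify x.1) (classify x.2))
            (convMap S (classify y.1) (classify y.2)) =
      ins (S := T) (G := ext ((conv S).obj (P, Q)) ((conv S).obj (R, W))) U
        (el S (ext P Q) X s x, el S (ext R W) Y t y) :=
  congrArg₂ (fun a b => ins (S := T) (G := ext ((conv S).obj (P, Q)) ((conv S).obj (R, W))) U (a, b))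
    (splitIso_classify_app S s x.1 x.2)
    (splitIso_classify_app S t y.1 y.2)

theorem nestBothIso_classify (S : Profunctor.{max u v} (V × V) V) {P Q R W : Psh.{v} V}
    {X Y : V × V} (x : P.obj (op X.1) × Q.obj (op X.2)) (y : R.obj (op Y.1) × W.obj (op Y.2)) :
    (nestBothIso S T (X.1, Y.1) (X.2, Y.2)).hom ≫
        convMap S (convMap T (classify x.1) (classify y.1))
          (convMap T (classify x.2) (classify y.2)) =
      ins (S := middleSwap V ⋙ nestBoth S T) (G := ext (ext P Q) (ext R W)) (X, Y) (x, y) ≫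
        gatherBoth T S P Q R W :=
  conv_hom_ext S (fun _ s t =>
    ins_nestBothIso_classify S T (X := (X.1, Y.1)) (Y := (X.2, Y.2)) s (x.1, y.1) t (x.2, y.2))

end Yoneda

/-- Associativity and unitality of the convolution of presheaves, up to coherent natural
isomorphism. -/
structure ConvMonoidal (T : Profunctor.{max u v} (V × V) V) (N : Psh.{v} V) where
  /-- the associator -/
  assoc (P Q R : Psh.{v} V) :
    (conv T).obj ((conv T).obj (P, Q), R) ≅ (conv T).obj (P, (conv T).obj (Q, R))
  /-- the left unitor -/
  lunit (P : Psh.{v} V) : (conv T).obj (N, P) ≅ P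
  /-- the right unitor -/
  runit (P : Psh.{v} V) : (conv T).obj (P, N) ≅ P
  assoc_naturality {P Q R P' Q' R' : Psh.{v} V} (η : P ⟶ P') (θ : Q ⟶ Q') (κ : R ⟶ R') :
    convMap T (convMap T η θ) κ ≫ (assoc P' Q' R').hom =
      (assoc P Q R).hom ≫ convMap T η (convMap T θ κ)
  lunit_naturality {P P' : Psh.{v} V} (η : P ⟶ P') :
    convMap T (𝟙 N) η ≫ (lunit P').hom = (lunit P).hom ≫ η
  runit_naturality {P P' : Psh.{v} V} (η : P ⟶ P') :
    convMap T η (𝟙 N) ≫ (runit P').hom = (runit P).hom ≫ η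
  pentagon (P Q R S : Psh.{v} V) :
    convMap T (assoc P Q R).hom (𝟙 S) ≫ (assoc P ((conv T).obj (Q, R)) S).hom ≫
        convMap T (𝟙 P) (assoc Q R S).hom =
      (assoc ((conv T).obj (P, Q)) R S).hom ≫ (assoc P Q ((conv T).obj (R, S))).hom
  triangle (P Q : Psh.{v} V) :
    (assoc P N Q).hom ≫ convMap T (𝟙 P) (lunit Q).hom = convMap T (runit P).hom (𝟙 Q)

namespace ConvMonoidal

variable {T : Profunctor.{max u v} (V × V) V} {N : Psh.{v} V} (M : ConvMonoidal T N)

/-- The restriction of the structure isomorphisms to representable presheaves. -/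
def toData : PromonoidalData T N where
  assoc := NatIso.ofComponents
    (fun X => nestLeftIso T X.1.1 X.1.2 X.2 ≪≫
      M.assoc (yoneda.obj X.1.1) (yoneda.obj X.1.2) (yoneda.obj X.2) ≪≫
        (nestRightIso T X.1.1 X.1.2 X.2).symm)
    (fun f => square_trans (nestLeftIso_naturality T f.1.1 f.1.2 f.2)
      (square_trans (M.assoc_naturality (yoneda.map f.1.1) (yoneda.map f.1.2) (yoneda.map f.2))
        (square_symm (nestRightIso_naturality T f.1.1 f.1.2 f.2))))
  lunit := NatIso.ofComponents
    (fun X => convLeftIso T N X ≪≫ M.lunit (yoneda.obj X))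
    (fun f => square_trans (convLeftIso_naturality T (𝟙 N) f) (M.lunit_naturality _))
  runit := NatIso.ofComponents
    (fun X => convRightIso T X N ≪≫ M.runit (yoneda.obj X))
    (fun f => square_trans (convRightIso_naturality T f (𝟙 N)) (M.runit_naturality _))

theorem lunitExt_eq (P : Psh.{v} V) : M.toData.lunitExt P = (M.lunit P).hom :=
  conv_hom_ext T (fun _ n p =>
    comp_trans (ins_convLeftIso_classify T n p) (M.lunit_naturality (classify p)))

theorem runitExt_eq (P : Psh.{v} V) : M.toData.runitExt P = (M.runit P).hom :=
  conv_hom_ext T (fun _ p n =>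
    comp_trans (ins_convRightIso_classify T p n) (M.runit_naturality (classify p)))

theorem assocExt_eq (P Q R : Psh.{v} V) : M.toData.assocExt P Q R = (M.assoc P Q R).hom :=
  conv_conv_hom_ext T (fun _ _ _ _ s p q r =>
    comp_trans_iso (ins_nestLeftIso_classify T s p q r)
      (M.assoc_naturality (classify p) (classify q) (classify r))
      (nestRightIso_classify T p q r))

/-- The promonoidal structure given by a coherent convolution of presheaves. -/
def toPromonoidal : Promonoidal T N where
  toPromonoidalData := M.toData
  pentagon P Q R S := by
    simp only [assocExt_eq, M.pentagon]
  triangle P Q := by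
    simp only [assocExt_eq, lunitExt_eq, runitExt_eq, M.triangle]

end ConvMonoidal

section Interchange

variable (T S : Profunctor.{max u v} (V × V) V)

/-- The restriction to representable presheaves of a natural interchange of two convolutions. -/
def restrictInterchange
    (ψ : ∀ P Q R W : Psh.{v} V, (conv T).obj ((conv S).obj (P, Q), (conv S).obj (R, W)) ⟶
      (conv S).obj ((conv T).obj (P, R), (conv T).obj (Q, W)))
    (hψ : ∀ {P Q R W P' Q' R' W' : Psh.{v} V} (η : P ⟶ P') (θ : Q ⟶ Q') (κ : R ⟶ R')
      (ι : W ⟶ W'), convMap T (convMap S η θ) (convMap S κ ι) ≫ ψ P' Q' R' W' =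
        ψ P Q R W ≫ convMap S (convMap T η κ) (convMap T θ ι)) :
    nestBoth T S ⟶ middleSwap V ⋙ nestBoth S T where
  app X := (nestBothIso T S X.1 X.2).hom ≫
    ψ (yoneda.obj X.1.1) (yoneda.obj X.1.2) (yoneda.obj X.2.1) (yoneda.obj X.2.2) ≫
      (nestBothIso S T (X.1.1, X.2.1) (X.1.2, X.2.2)).inv
  naturality _ _ f := square_trans (nestBothIso_naturality T S f.1 f.2)
    (square_trans (hψ (yoneda.map f.1.1) (yoneda.map f.1.2) (yoneda.map f.2.1)
      (yoneda.map f.2.2)) (square_symm (nestBothIso_naturality S T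
        (Prod.mkHom f.1.1 f.2.1) (Prod.mkHom f.1.2 f.2.2))))

theorem restrictInterchange_ext
    (ψ : ∀ P Q R W : Psh.{v} V, (conv T).obj ((conv S).obj (P, Q), (conv S).obj (R, W)) ⟶
      (conv S).obj ((conv T).obj (P, R), (conv T).obj (Q, W)))
    (hψ : ∀ {P Q R W P' Q' R' W' : Psh.{v} V} (η : P ⟶ P') (θ : Q ⟶ Q') (κ : R ⟶ R')
      (ι : W ⟶ W'), convMap T (convMap S η θ) (convMap S κ ι) ≫ ψ P' Q' R' W' =
        ψ P Q R W ≫ convMap S (convMap T η κ) (convMap T θ ι)) (P Q R W : Psh.{v} V) :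
    spreadBoth T S P Q R W ≫ substMap (restrictInterchange T S ψ hψ) (𝟙 _) ≫
      gatherBoth T S P Q R W = ψ P Q R W :=
  conv_hom_ext T (fun U c d => by
    induction c using Comp.ind with
    | h X s x =>
      induction d using Comp.ind with
      | h Y t y =>
        exact comp_trans_iso (ins_nestBothIso_classify T S s x t y)
          (hψ (classify x.1) (classify x.2) (classify y.1) (classify y.2))
          (nestBothIso_classify T S x y))

end Interchange

end Convolution

section Restriction

variable {V : Type u} [Category.{max u v} V]

/-- The action of a morphism on an element of a presheaf. -/
def res {P : Psh.{v} V} {X Y : V} (k : X ⟶ Y) (p : P.obj (op Y)) : P.obj (op X) :=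
  P.map k.op p

theorem res_res {P : Psh.{v} V} {X Y Z : V} (f : X ⟶ Y) (g : Y ⟶ Z) (p : P.obj (op Z)) :
    res f (res g p) = res (f ≫ g) p := by
  simp [res]

@[simp]
theorem res_id {P : Psh.{v} V} {X : V} (p : P.obj (op X)) : res (𝟙 X) p = p := by
  simp [res]

theorem res_hom_inv {P : Psh.{v} V} {X Y : V} (e : X ≅ Y) (p : P.obj (op X)) :
    res e.hom (res e.inv p) = p := by
  rw [res_res, e.hom_inv_id, res_id]

theorem res_inv_hom {P : Psh.{v} V} {X Y : V} (e : X ≅ Y) (p : P.obj (op Y)) :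
    res e.inv (res e.hom p) = p := by
  rw [res_res, e.inv_hom_id, res_id]

theorem app_res {P Q : Psh.{v} V} (a : P ⟶ Q) {X Y : V} (k : X ⟶ Y) (p : P.obj (op Y)) :
    a.app _ (res k p) = res k (a.app _ p) :=
  NatTrans.naturality_apply a k.op p

theorem comp_app_el {P Q R : Psh.{v} V} (a : P ⟶ Q) (b : Q ⟶ R) {A : Vᵒᵖ} (x : P.obj A) :
    (a ≫ b).app A x = b.app A (a.app A x) :=
  rfl

theorem id_app_el {P : Psh.{v} V} {A : Vᵒᵖ} (x : P.obj A) : (𝟙 P : P ⟶ P).app A x = x :=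
  rfl

/-- Natural transformations from their action on elements. -/
def pshHom {P Q : Psh.{v} V} (φ : ∀ X : V, P.obj (op X) → Q.obj (op X))
    (h : ∀ (X Y : V) (k : X ⟶ Y) (p : P.obj (op Y)), φ X (res k p) = res k (φ Y p)) : P ⟶ Q where
  app A := ↾φ A.unop
  naturality A B f := by
    ext p
    exact h _ _ f.unop p

@[simp]
theorem pshHom_app {P Q : Psh.{v} V} (φ : ∀ X : V, P.obj (op X) → Q.obj (op X))
    (h : ∀ (X Y : V) (k : X ⟶ Y) (p : P.obj (op Y)), φ X (res k p) = res k (φ Y p)) {X : V}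
    (p : P.obj (op X)) : (pshHom φ h).app (op X) p = φ X p :=
  rfl

end Restriction

section Day

variable (V : Type u) [Category.{max u v} V] [MonoidalCategory V]

/-- The profunctor `V(•; X ⊗ Y)`. -/
abbrev dayPar : Profunctor.{max u v} (V × V) V :=
  MonoidalCategory.tensor V ⋙ yoneda

variable {V}

local notation:70 P:70 " ⊛ " Q:71 => CategoryTheory.Functor.obj (conv (dayPar _)) (P, Q)

/-- The external product of two elements. -/
def parMk {P Q : Psh.{v} V} {X Y : V} (p : P.obj (op X)) (q : Q.obj (op Y)) :
    (P ⊛ Q).obj (op (X ⊗ Y)) :=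
  el (dayPar V) (ext P Q) (X, Y) (𝟙 (X ⊗ Y)) (p, q)

theorem res_parMk {P Q : Psh.{v} V} {X Y X' Y' : V} (k : X' ⟶ X) (l : Y' ⟶ Y) (p : P.obj (op X))
    (q : Q.obj (op Y)) : res (k ⊗ₘ l) (parMk p q) = parMk (res k p) (res l q) := by
  refine Eq.trans ?_ (el_slide (S := dayPar V) (G := ext P Q) (Prod.mkHom k l) (𝟙 (X' ⊗ Y')) (p, q))
  exact congrArg (fun s => el (dayPar V) (ext P Q) (X, Y) s (p, q))
    ((Category.comp_id (k ⊗ₘ l)).trans (Category.id_comp (k ⊗ₘ l)).symm)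

theorem parMk_res_left {P Q : Psh.{v} V} {X Y X' : V} (k : X' ⟶ X) (p : P.obj (op X))
    (q : Q.obj (op Y)) : parMk (res k p) q = res (k ▷ Y) (parMk p q) := by
  rw [← tensorHom_id, res_parMk, res_id]

theorem parMk_res_right {P Q : Psh.{v} V} {X Y Y' : V} (l : Y' ⟶ Y) (p : P.obj (op X))
    (q : Q.obj (op Y)) : parMk p (res l q) = res (X ◁ l) (parMk p q) := by
  rw [← id_tensorHom, res_parMk, res_id]

theorem convMap_parMk {P Q P' Q' : Psh.{v} V} (η : P ⟶ P') (θ : Q ⟶ Q') {X Y : V}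
    (p : P.obj (op X)) (q : Q.obj (op Y)) :
    (convMap (dayPar V) η θ).app _ (parMk p q) = parMk (η.app _ p) (θ.app _ q) :=
  rfl

theorem day_ind {P Q : Psh.{v} V} {U : V} {m : (P ⊛ Q).obj (op U) → Prop}
    (h : ∀ (X Y : V) (k : U ⟶ X ⊗ Y) (p : P.obj (op X)) (q : Q.obj (op Y)),
      m (res k (parMk p q))) (x : (P ⊛ Q).obj (op U)) : m x := by
  induction x using Comp.ind with
  | h X s y =>
    have e : res (P := P ⊛ Q) s (parMk y.1 y.2) = el (dayPar V) (ext P Q) X s y :=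
      congrArg (fun t => el (dayPar V) (ext P Q) X t y) (Category.comp_id s)
    have := h X.1 X.2 s y.1 y.2
    rw [e] at this
    exact this

theorem day_hom_ext {P Q W : Psh.{v} V} {a b : P ⊛ Q ⟶ W}
    (h : ∀ (X Y : V) (p : P.obj (op X)) (q : Q.obj (op Y)),
      a.app _ (parMk p q) = b.app _ (parMk p q)) : a = b :=
  psh_ext (fun A x => by
    induction x using day_ind with
    | h X Y k p q => rw [app_res, app_res, h])

/-- Maps out of the convolution are natural families. -/
def dayDesc {P Q W : Psh.{v} V} (φ : ∀ X Y : V, P.obj (op X) → Q.obj (op Y) → W.obj (op (X ⊗ Y)))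
    (h : ∀ (X Y X' Y' : V) (k : X' ⟶ X) (l : Y' ⟶ Y) (p : P.obj (op X)) (q : Q.obj (op Y)),
      φ X' Y' (res k p) (res l q) = res (k ⊗ₘ l) (φ X Y p q)) : P ⊛ Q ⟶ W :=
  desc (fun U (y : P.obj (op U.1) × Q.obj (op U.2)) =>
      (classify (φ U.1 U.2 y.1 y.2) : yoneda.obj (U.1 ⊗ U.2) ⟶ W))
    (fun U U' f y => psh_ext (fun A s => by
      refine (classify_app _ _).trans (Eq.trans ?_ (classify_app _ _).symm)
      refine (res_res (P := W) s (f.1 ⊗ₘ f.2) (φ U'.1 U'.2 y.1 y.2)).symm.trans ?_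
      exact congrArg (res s) (h _ _ _ _ f.1 f.2 y.1 y.2).symm))

theorem dayDesc_parMk {P Q W : Psh.{v} V}
    (φ : ∀ X Y : V, P.obj (op X) → Q.obj (op Y) → W.obj (op (X ⊗ Y)))
    (h : ∀ (X Y X' Y' : V) (k : X' ⟶ X) (l : Y' ⟶ Y) (p : P.obj (op X)) (q : Q.obj (op Y)),
      φ X' Y' (res k p) (res l q) = res (k ⊗ₘ l) (φ X Y p q)) {X Y : V}
    (p : P.obj (op X)) (q : Q.obj (op Y)) :
    (dayDesc φ h).app _ (parMk p q) = φ X Y p q :=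
  classify_id _

/-- The presheaf `W (- ⊗ Z)`. -/
abbrev shiftRight (W : Psh.{v} V) (Z : V) : Psh.{v} V :=
  (tensorRight Z).op ⋙ W

/-- The presheaf `W (Z ⊗ -)`. -/
abbrev shiftLeft (W : Psh.{v} V) (Z : V) : Psh.{v} V :=
  (tensorLeft Z).op ⋙ W

theorem res_shiftRight {W : Psh.{v} V} {X Y Z : V} (k : X ⟶ Y) (w : W.obj (op (Y ⊗ Z))) :
    res (P := shiftRight W Z) k w = res (P := W) (k ▷ Z) w :=
  rfl

theorem res_shiftLeft {W : Psh.{v} V} {X Y Z : V} (k : X ⟶ Y) (w : W.obj (op (Z ⊗ Y))) :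
    res (P := shiftLeft W Z) k w = res (P := W) (Z ◁ k) w :=
  rfl

section Assoc

variable (P Q R : Psh.{v} V)

/-- The tensor product of an element of `P ⊗ Q` and an element of `R`, reassociated. -/
def assocFixRight {Z : V} (r : R.obj (op Z)) : P ⊛ Q ⟶ shiftRight (P ⊛ (Q ⊛ R)) Z :=
  dayDesc (fun X Y p q => res (P := P ⊛ (Q ⊛ R)) (α_ X Y Z).hom (parMk p (parMk q r)))
    (by
      intro X Y X' Y' k l p q
      rw [parMk_res_left, parMk_res_left, parMk_res_right, res_res, res_res, res_shiftRight,
        res_res]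
      congr 1
      simp [MonoidalCategory.tensorHom_def])

/-- The tensor product of an element of `P` and an element of `Q ⊗ R`, reassociated. -/
def assocFixLeft {X : V} (p : P.obj (op X)) : Q ⊛ R ⟶ shiftLeft ((P ⊛ Q) ⊛ R) X :=
  dayDesc (fun Y Z q r => res (P := (P ⊛ Q) ⊛ R) (α_ X Y Z).inv (parMk (parMk p q) r))
    (by
      intro Y Z Y' Z' k l q r
      rw [parMk_res_right, parMk_res_right, parMk_res_left, res_res, res_res, res_shiftLeft,
        res_res]
      congr 1
      simp [MonoidalCategory.tensorHom_def'])

variable {P Q R}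

theorem assocFixRight_parMk {X Y Z : V} (p : P.obj (op X)) (q : Q.obj (op Y)) (r : R.obj (op Z)) :
    (assocFixRight P Q R r).app _ (parMk p q) =
      res (P := P ⊛ (Q ⊛ R)) (α_ X Y Z).hom (parMk p (parMk q r)) :=
  classify_id (P := shiftRight (P ⊛ (Q ⊛ R)) Z) (X := X ⊗ Y)
    (res (P := P ⊛ (Q ⊛ R)) (α_ X Y Z).hom (parMk p (parMk q r)))

theorem assocFixLeft_parMk {X Y Z : V} (p : P.obj (op X)) (q : Q.obj (op Y)) (r : R.obj (op Z)) :
    (assocFixLeft P Q R p).app _ (parMk q r) =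
      res (P := (P ⊛ Q) ⊛ R) (α_ X Y Z).inv (parMk (parMk p q) r) :=
  classify_id (P := shiftLeft ((P ⊛ Q) ⊛ R) X) (X := Y ⊗ Z)
    (res (P := (P ⊛ Q) ⊛ R) (α_ X Y Z).inv (parMk (parMk p q) r))

theorem assocFixRight_res {U X Y Z : V} (k : U ⟶ X ⊗ Y) (p : P.obj (op X)) (q : Q.obj (op Y))
    (r : R.obj (op Z)) :
    (assocFixRight P Q R r).app (op U) (res k (parMk p q)) =
      res (P := P ⊛ (Q ⊛ R)) (k ▷ Z ≫ (α_ X Y Z).hom) (parMk p (parMk q r)) := by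
  rw [app_res, assocFixRight_parMk, res_shiftRight, res_res]

theorem assocFixLeft_res {U X Y Z : V} (k : U ⟶ Y ⊗ Z) (p : P.obj (op X)) (q : Q.obj (op Y))
    (r : R.obj (op Z)) :
    (assocFixLeft P Q R p).app (op U) (res k (parMk q r)) =
      res (P := (P ⊛ Q) ⊛ R) (X ◁ k ≫ (α_ X Y Z).inv) (parMk (parMk p q) r) := by
  rw [app_res, assocFixLeft_parMk, res_shiftLeft, res_res]

variable (P Q R)

/-- The associator of the convolution. -/
def dayAssocHom : (P ⊛ Q) ⊛ R ⟶ P ⊛ (Q ⊛ R) :=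
  dayDesc (fun U _ x r => (assocFixRight P Q R r).app (op U) x) (by
    intro U Z U' Z' k l x r
    induction x using day_ind with
    | h X Y m p q =>
      rw [res_res, assocFixRight_res, assocFixRight_res, parMk_res_right, parMk_res_right,
        res_res, res_res]
      congr 1
      simp [MonoidalCategory.tensorHom_def', whisker_exchange_assoc])

/-- The inverse of the associator of the convolution. -/
def dayAssocInv : P ⊛ (Q ⊛ R) ⟶ (P ⊛ Q) ⊛ R :=
  dayDesc (fun _ U p x => (assocFixLeft P Q R p).app (op U) x) (by
    intro Z U Z' U' k l p x
    induction x using day_ind with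
    | h X Y m q r =>
      rw [res_res, assocFixLeft_res, assocFixLeft_res, parMk_res_left, parMk_res_left,
        res_res, res_res]
      congr 1
      simp [MonoidalCategory.tensorHom_def, ← whisker_exchange_assoc])

variable {P Q R}

theorem dayAssocHom_parMk {X Y Z : V} (p : P.obj (op X)) (q : Q.obj (op Y)) (r : R.obj (op Z)) :
    (dayAssocHom P Q R).app _ (parMk (parMk p q) r) =
      res (α_ X Y Z).hom (parMk p (parMk q r)) :=
  (classify_id (P := P ⊛ (Q ⊛ R)) (X := (X ⊗ Y) ⊗ Z) _).trans (assocFixRight_parMk p q r)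

theorem dayAssocInv_parMk {X Y Z : V} (p : P.obj (op X)) (q : Q.obj (op Y)) (r : R.obj (op Z)) :
    (dayAssocInv P Q R).app _ (parMk p (parMk q r)) =
      res (α_ X Y Z).inv (parMk (parMk p q) r) :=
  (classify_id (P := (P ⊛ Q) ⊛ R) (X := X ⊗ (Y ⊗ Z)) _).trans (assocFixLeft_parMk p q r)

theorem day_hom_ext_left {W : Psh.{v} V} {a b : (P ⊛ Q) ⊛ R ⟶ W}
    (h : ∀ (X Y Z : V) (p : P.obj (op X)) (q : Q.obj (op Y)) (r : R.obj (op Z)),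
      a.app _ (parMk (parMk p q) r) = b.app _ (parMk (parMk p q) r)) : a = b :=
  day_hom_ext (fun U Z x r => by
    induction x using day_ind with
    | h X Y m p q => rw [parMk_res_left, app_res, app_res, h])

theorem day_hom_ext_right {W : Psh.{v} V} {a b : P ⊛ (Q ⊛ R) ⟶ W}
    (h : ∀ (X Y Z : V) (p : P.obj (op X)) (q : Q.obj (op Y)) (r : R.obj (op Z)),
      a.app _ (parMk p (parMk q r)) = b.app _ (parMk p (parMk q r))) : a = b :=
  day_hom_ext (fun Z U p x => by
    induction x using day_ind with
    | h X Y m q r => rw [parMk_res_right, app_res, app_res, h])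

theorem day_hom_ext_left_left {W S : Psh.{v} V} {a b : ((P ⊛ Q) ⊛ R) ⊛ S ⟶ W}
    (h : ∀ (X Y Z U : V) (p : P.obj (op X)) (q : Q.obj (op Y)) (r : R.obj (op Z))
      (s : S.obj (op U)),
      a.app _ (parMk (parMk (parMk p q) r) s) = b.app _ (parMk (parMk (parMk p q) r) s)) : a = b :=
  day_hom_ext_left (fun U Z X x r s => by
    induction x using day_ind with
    | h X Y m p q => rw [parMk_res_left, parMk_res_left, app_res, app_res, h])

/-- The associator of the convolution. -/
def dayAssoc (P Q R : Psh.{v} V) : (P ⊛ Q) ⊛ R ≅ P ⊛ (Q ⊛ R) where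
  hom := dayAssocHom P Q R
  inv := dayAssocInv P Q R
  hom_inv_id := day_hom_ext_left (fun X Y Z p q r => by
    rw [comp_app_el, dayAssocHom_parMk, app_res, dayAssocInv_parMk, res_hom_inv, id_app_el])
  inv_hom_id := day_hom_ext_right (fun X Y Z p q r => by
    rw [comp_app_el, dayAssocInv_parMk, app_res, dayAssocHom_parMk, res_inv_hom, id_app_el])

end Assoc

section Units

variable {I : Psh.{v} V} (e : I ≅ yoneda.obj (𝟙_ V))

/-- The morphism classified by an element of a presheaf that is represented by the unit object. -/
def toUnit {X : V} (h : I.obj (op X)) : X ⟶ 𝟙_ V :=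
  e.hom.app _ h

/-- The universal element of a presheaf that is represented by the unit object. -/
def univ : I.obj (op (𝟙_ V)) :=
  e.inv.app _ (𝟙 (𝟙_ V))

theorem toUnit_res {X Y : V} (k : X ⟶ Y) (h : I.obj (op Y)) :
    toUnit e (res k h) = k ≫ toUnit e h :=
  app_res e.hom k h

theorem toUnit_univ : toUnit e (univ e) = 𝟙 (𝟙_ V) :=
  ConcreteCategory.congr_hom (NatTrans.congr_app e.inv_hom_id _) _

theorem res_toUnit_univ {X : V} (h : I.obj (op X)) : res (toUnit e h) (univ e) = h := by
  rw [univ, ← app_res]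
  refine Eq.trans (congrArg (e.inv.app _) (Category.comp_id _)) ?_
  exact ConcreteCategory.congr_hom (NatTrans.congr_app e.hom_inv_id _) _

/-- The left unitor of the convolution. -/
def dayLunit (P : Psh.{v} V) : I ⊛ P ≅ P where
  hom := dayDesc (fun _ Y h p => res (toUnit e h ▷ Y ≫ (λ_ Y).hom) p) (by
    intro X Y X' Y' k l h p
    rw [res_res, res_res, toUnit_res]
    congr 1
    simp [MonoidalCategory.tensorHom_def', whisker_exchange_assoc])
  inv := pshHom (fun X p => res (λ_ X).inv (parMk (univ e) p)) (by
    intro X Y k p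
    rw [parMk_res_right, res_res, res_res]
    congr 1
    simp)
  hom_inv_id := day_hom_ext (fun X Y h p => by
    rw [comp_app_el, dayDesc_parMk, app_res, pshHom_app, res_res, Category.assoc,
      Iso.hom_inv_id, Category.comp_id, ← parMk_res_left, res_toUnit_univ, id_app_el])
  inv_hom_id := psh_ext (fun ⟨A⟩ p => by
    rw [comp_app_el, pshHom_app, app_res, dayDesc_parMk, toUnit_univ, res_res,
      id_whiskerRight, Category.id_comp, Iso.inv_hom_id, res_id, id_app_el])

/-- The right unitor of the convolution. -/
def dayRunit (P : Psh.{v} V) : P ⊛ I ≅ P where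
  hom := dayDesc (fun X _ p h => res (X ◁ toUnit e h ≫ (ρ_ X).hom) p) (by
    intro X Y X' Y' k l h p
    rw [res_res, res_res, toUnit_res]
    congr 1
    simp [MonoidalCategory.tensorHom_def, ← whisker_exchange_assoc])
  inv := pshHom (fun X p => res (ρ_ X).inv (parMk p (univ e))) (by
    intro X Y k p
    rw [parMk_res_left, res_res, res_res]
    congr 1
    simp)
  hom_inv_id := day_hom_ext (fun X Y p h => by
    rw [comp_app_el, dayDesc_parMk, app_res, pshHom_app, res_res, Category.assoc,
      Iso.hom_inv_id, Category.comp_id, ← parMk_res_right, res_toUnit_univ, id_app_el])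
  inv_hom_id := psh_ext (fun ⟨A⟩ p => by
    rw [comp_app_el, pshHom_app, app_res, dayDesc_parMk, toUnit_univ, res_res,
      MonoidalCategory.whiskerLeft_id, Category.id_comp, Iso.inv_hom_id, res_id, id_app_el])

theorem dayLunit_parMk {P : Psh.{v} V} {X Y : V} (h : I.obj (op X)) (p : P.obj (op Y)) :
    (dayLunit e P).hom.app _ (parMk h p) = res (toUnit e h ▷ Y ≫ (λ_ Y).hom) p :=
  classify_id _

theorem dayRunit_parMk {P : Psh.{v} V} {X Y : V} (p : P.obj (op X)) (h : I.obj (op Y)) :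
    (dayRunit e P).hom.app _ (parMk p h) = res (X ◁ toUnit e h ≫ (ρ_ X).hom) p :=
  classify_id _

/-- Day convolution is associative and unital. -/
def dayMonoidal : ConvMonoidal (dayPar V) I where
  assoc := dayAssoc
  lunit := dayLunit e
  runit := dayRunit e
  assoc_naturality η θ κ := day_hom_ext_left (fun X Y Z p q r => by
    simp only [comp_app_el, convMap_parMk, dayAssoc, dayAssocHom_parMk, app_res])
  lunit_naturality η := day_hom_ext (fun X Y h p => by
    simp only [comp_app_el, convMap_parMk, dayLunit_parMk, app_res, id_app_el])
  runit_naturality η := day_hom_ext (fun X Y p h => by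
    simp only [comp_app_el, convMap_parMk, dayRunit_parMk, app_res, id_app_el])
  pentagon P Q R S := day_hom_ext_left_left (fun X Y Z U p q r s => by
    simp only [comp_app_el, convMap_parMk, dayAssoc, dayAssocHom_parMk, app_res, id_app_el,
      parMk_res_left, parMk_res_right, res_res]
    rw [Category.assoc, MonoidalCategory.pentagon])
  triangle P Q := day_hom_ext_left (fun X Y Z p h q => by
    simp only [comp_app_el, convMap_parMk, dayAssoc, dayAssocHom_parMk, app_res, id_app_el,
      parMk_res_left, parMk_res_right, res_res, dayLunit_parMk, dayRunit_parMk]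
    congr 1
    simp)

end Units

end Day

section DaySymmetry

variable (V : Type u) [Category.{max u v} V] [MonoidalCategory V] [SymmetricCategory V]

/-- The symmetry of the profunctor `V(•; X ⊗ Y)`. -/
def daySymm : dayPar V ≅ CategoryTheory.Prod.swap V V ⋙ dayPar V :=
  NatIso.ofComponents (fun X => yoneda.mapIso (β_ X.1 X.2)) (fun f =>
    (yoneda.map_comp _ _).symm.trans ((congrArg yoneda.map
      (BraidedCategory.braiding_naturality f.1 f.2)).trans (yoneda.map_comp _ _)))

variable {V}

theorem daySymm_symmetry (X Y : V) :
    (daySymm V).hom.app (X, Y) ≫ (daySymm V).hom.app (Y, X) = 𝟙 ((dayPar V).obj (X, Y)) :=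
  (yoneda.map_comp _ _).symm.trans ((congrArg yoneda.map (SymmetricCategory.symmetry X Y)).trans
    (yoneda.map_id _))

/-- The symmetry of the convolution. -/
def dayBraid (P Q : Psh.{v} V) : (conv (dayPar V)).obj (P, Q) ⟶ (conv (dayPar V)).obj (Q, P) :=
  symmExt (daySymm V) P Q

theorem dayBraid_parMk {P Q : Psh.{v} V} {X Y : V} (p : P.obj (op X)) (q : Q.obj (op Y)) :
    (dayBraid P Q).app _ (parMk p q) = res (β_ X Y).hom (parMk q p) :=
  congrArg (fun k => el (dayPar V) (ext Q P) (Y, X) k (q, p))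
    ((Category.id_comp (β_ X Y).hom).trans (Category.comp_id (β_ X Y).hom).symm)

theorem dayBraid_hexagon (P Q R : Psh.{v} V) :
    (dayAssoc P Q R).hom ≫ dayBraid P ((conv (dayPar V)).obj (Q, R)) ≫ (dayAssoc Q R P).hom =
      convMap (dayPar V) (dayBraid P Q) (𝟙 R) ≫ (dayAssoc Q P R).hom ≫
        convMap (dayPar V) (𝟙 Q) (dayBraid P R) :=
  day_hom_ext_left (fun X Y Z p q r => by
    simp only [comp_app_el, convMap_parMk, dayAssoc, dayAssocHom_parMk, app_res, id_app_el,
      parMk_res_left, parMk_res_right, res_res, dayBraid_parMk]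
    rw [Category.assoc, Category.assoc, BraidedCategory.hexagon_forward])

end DaySymmetry

section LensSeq

open Lens

variable {C : Type u} [Category.{v} C] [MonoidalCategory C]

local notation:70 P:70 " ◂ " Q:71 => CategoryTheory.Functor.obj (conv (lensSeq _)) (P, Q)

theorem lens_pre {A A' B X Y : C} (h : A' ⟶ A) (l : (⟨A, B⟩ : Lens C) ⟶ ⟨X, Y⟩) :
    LensSet.pre h l = ofHoms h (𝟙 B) ≫ l := by
  induction l using lens_ind with
  | h M f g =>
    refine Eq.trans ?_ (ofHoms_lens _ _ _ _ _).symm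
    rw [Category.comp_id]
    rfl

namespace SeqSet

/-- The element of the sequential splits given by two lenses with a common boundary. -/
def split {A Z B X Y X' Y' : C} (k : (⟨A, Z⟩ : Lens C) ⟶ ⟨X, Y⟩)
    (l : (⟨Z, B⟩ : Lens C) ⟶ ⟨X', Y'⟩) : SeqSet A B X Y X' Y' :=
  LensSet.lift (fun M f g => SeqSet.mk M f (LensSet.pre g l)) (by
    intro M M' m f g
    rw [slide, LensSet.pre_pre]) k

theorem split_lens {A Z B X Y X' Y' : C} (M : C) (f : A ⟶ M ⊗ X) (g : M ⊗ Y ⟶ Z)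
    (l : (⟨Z, B⟩ : Lens C) ⟶ ⟨X', Y'⟩) :
    split (lens M f g) l = SeqSet.mk M f (ofHoms g (𝟙 B) ≫ l) :=
  congrArg (SeqSet.mk M f) (lens_pre g l)

theorem mk_eq_split {A B X Y X' Y' : C} (M : C) (f : A ⟶ M ⊗ X)
    (l : (⟨M ⊗ Y, B⟩ : Lens C) ⟶ ⟨X', Y'⟩) :
    SeqSet.mk M f l = split (lens M f (𝟙 (M ⊗ Y))) l :=
  congrArg (SeqSet.mk M f) (LensSet.pre_id l).symm

/-- The universal element of the sequential splits. -/
def gen (A Z B : C) : SeqSet A B A Z Z B :=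
  split (𝟙 (⟨A, Z⟩ : Lens C)) (𝟙 (⟨Z, B⟩ : Lens C))

theorem gen_eq (A Z B : C) :
    gen A Z B = SeqSet.mk (𝟙_ C) (λ_ A).inv (ofHoms (λ_ Z).hom (𝟙 B)) :=
  (split_lens _ _ _ _).trans (congrArg _ (Category.comp_id _))

theorem post_gen {A Z B X Y X' Y' : C} (k : (⟨A, Z⟩ : Lens C) ⟶ ⟨X, Y⟩)
    (l : (⟨Z, B⟩ : Lens C) ⟶ ⟨X', Y'⟩) : post (gen A Z B) k l = split k l := by
  induction k using lens_ind with
  | h R c d =>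
    rw [gen_eq, split_lens]
    refine (post_mk _ _ _ _ _ _ _).trans (slide_eq (λ_ R).hom (by simp) ?_)
    rw [lens_pre, lens_pre]
    change (ofHoms ((α_ (𝟙_ C) R Y).hom ≫ 𝟙_ C ◁ d) (𝟙 B) ≫ ofHoms (λ_ Z).hom (𝟙 B)) ≫ l =
      ofHoms ((λ_ R).hom ▷ Y) (𝟙 B) ≫ ofHoms d (𝟙 B) ≫ l
    rw [ofHoms_comp, ← Category.assoc (ofHoms _ _), ofHoms_comp]
    simp

theorem pre_gen {A' B' A Z B Z' : C} (M : C) (f : A' ⟶ M ⊗ A) (g : M ⊗ B ⟶ B') (h : M ⊗ Z ⟶ Z')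
    (h' : Z' ⟶ M ⊗ Z) (e : h ≫ h' = 𝟙 _) :
    pre (lens M f g) (gen A Z B) = split (lens M f h) (lens M h' g) := by
  rw [gen_eq, split_lens]
  refine (pre_mk _ _ _ _ _ _).trans (slide_eq (ρ_ M).hom (by simp) ?_)
  rw [lens_pre]
  change lens _ _ _ ≫ _ = _
  simp [e]

theorem split_slide {A Z Z' B : C} (h : Z ⟶ Z') :
    split (ofHoms (𝟙 A) h) (𝟙 (⟨Z', B⟩ : Lens C)) = split (𝟙 (⟨A, Z⟩ : Lens C)) (ofHoms h (𝟙 B)) := by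
  refine (split_lens _ _ _ _).trans (Eq.trans ?_ (split_lens _ _ _ _).symm)
  simp

end SeqSet

variable {P Q R W : Psh.{v} (Lens C)}

/-- The element of `P ◁ Q` given by elements of `P` and `Q` with a common boundary. -/
def seqMk {A Z B : C} (p : P.obj (op ⟨A, Z⟩)) (q : Q.obj (op ⟨Z, B⟩)) : (P ◂ Q).obj (op ⟨A, B⟩) :=
  el (lensSeq C) (ext P Q) (⟨A, Z⟩, ⟨Z, B⟩) (SeqSet.gen A Z B) (p, q)

/-- The element of `P ◁ Q` with a given split. -/
def seqEl {A B X Y X' Y' : C} (s : SeqSet A B X Y X' Y') (p : P.obj (op ⟨X, Y⟩))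
    (q : Q.obj (op ⟨X', Y'⟩)) : (P ◂ Q).obj (op ⟨A, B⟩) :=
  el (lensSeq C) (ext P Q) (⟨X, Y⟩, ⟨X', Y'⟩) s (p, q)

theorem seqEl_split {A Z B X Y X' Y' : C} (k : (⟨A, Z⟩ : Lens C) ⟶ ⟨X, Y⟩)
    (l : (⟨Z, B⟩ : Lens C) ⟶ ⟨X', Y'⟩) (p : P.obj (op ⟨X, Y⟩)) (q : Q.obj (op ⟨X', Y'⟩)) :
    seqEl (SeqSet.split k l) p q = seqMk (res k p) (res l q) := by
  have h := el_slide (S := lensSeq C) (G := ext P Q) (A := op ⟨A, B⟩) (U := (⟨A, Z⟩, ⟨Z, B⟩))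
    (U' := (⟨X, Y⟩, ⟨X', Y'⟩)) (Prod.mkHom k l) (SeqSet.gen A Z B) (p, q)
  refine Eq.trans ?_ h
  exact congrArg (fun s => seqEl s p q) (SeqSet.post_gen k l).symm

theorem seq_ind {A B : C} {m : (P ◂ Q).obj (op ⟨A, B⟩) → Prop}
    (h : ∀ (Z : C) (p : P.obj (op ⟨A, Z⟩)) (q : Q.obj (op ⟨Z, B⟩)), m (seqMk p q))
    (x : (P ◂ Q).obj (op ⟨A, B⟩)) : m x := by
  induction x using Comp.ind with
  | h U s y =>
    obtain ⟨⟨X, Y⟩, ⟨X', Y'⟩⟩ := U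
    obtain ⟨p, q⟩ := y
    induction s using SeqSet.ind with
    | h M f l =>
      have e := seqEl_split (P := P) (Q := Q) (lens M f (𝟙 (M ⊗ Y))) l p q
      rw [← SeqSet.mk_eq_split] at e
      exact (congrArg m e).mpr (h _ _ _)

theorem seqMk_slide {A Z Z' B : C} (h : Z ⟶ Z') (p : P.obj (op ⟨A, Z⟩)) (q : Q.obj (op ⟨Z', B⟩)) :
    seqMk (res (ofHoms (𝟙 A) h) p) q = seqMk p (res (ofHoms h (𝟙 B)) q) := by
  have e₁ := seqEl_split (ofHoms (𝟙 A) h) (𝟙 (⟨Z', B⟩ : Lens C)) p q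
  have e₂ := seqEl_split (𝟙 (⟨A, Z⟩ : Lens C)) (ofHoms h (𝟙 B)) p q
  rw [res_id] at e₁ e₂
  rw [← e₁, ← e₂, SeqSet.split_slide]

theorem res_seqMk {A' B' A Z B Z' : C} (M : C) (f : A' ⟶ M ⊗ A) (g : M ⊗ B ⟶ B') (h : M ⊗ Z ⟶ Z')
    (h' : Z' ⟶ M ⊗ Z) (e : h ≫ h' = 𝟙 _) (p : P.obj (op ⟨A, Z⟩)) (q : Q.obj (op ⟨Z, B⟩)) :
    res (lens M f g) (seqMk p q) = seqMk (res (lens M f h) p) (res (lens M h' g) q) := by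
  rw [← seqEl_split, ← SeqSet.pre_gen _ _ _ _ _ e]
  rfl

theorem res_ofHoms_seqMk {A' B' A Z B : C} (f : A' ⟶ A) (g : B ⟶ B') (p : P.obj (op ⟨A, Z⟩))
    (q : Q.obj (op ⟨Z, B⟩)) :
    res (ofHoms f g) (seqMk p q) =
      seqMk (res (ofHoms f (𝟙 Z)) p) (res (ofHoms (𝟙 Z) g) q) := by
  refine (res_seqMk _ _ _ (λ_ Z).hom (λ_ Z).inv (by simp) p q).trans ?_
  simp [ofHoms]

theorem convMap_seqMk {P' Q' : Psh.{v} (Lens C)} (η : P ⟶ P') (θ : Q ⟶ Q') {A Z B : C}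
    (p : P.obj (op ⟨A, Z⟩)) (q : Q.obj (op ⟨Z, B⟩)) :
    (convMap (lensSeq C) η θ).app _ (seqMk p q) = seqMk (η.app _ p) (θ.app _ q) :=
  rfl

theorem seq_hom_ext {a b : P ◂ Q ⟶ W}
    (h : ∀ (A Z B : C) (p : P.obj (op ⟨A, Z⟩)) (q : Q.obj (op ⟨Z, B⟩)),
      a.app _ (seqMk p q) = b.app _ (seqMk p q)) : a = b :=
  psh_ext (fun ⟨⟨A, B⟩⟩ x => by
    induction x using seq_ind with
    | h Z p q => exact h A Z B p q)

/-- Functions out of `P ◁ Q` are dinatural families. -/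
def seqLift {A B : C} {β : Type*} (φ : ∀ Z : C, P.obj (op ⟨A, Z⟩) → Q.obj (op ⟨Z, B⟩) → β)
    (h : ∀ (Z Z' : C) (m : Z ⟶ Z') (p : P.obj (op ⟨A, Z⟩)) (q : Q.obj (op ⟨Z', B⟩)),
      φ Z' (res (ofHoms (𝟙 A) m) p) q = φ Z p (res (ofHoms m (𝟙 B)) q))
    (x : (P ◂ Q).obj (op ⟨A, B⟩)) : β :=
  Comp.lift (F := (lensSeq C).flip.obj (op ⟨A, B⟩)) (G := ext P Q)
    (fun (U : Lens C × Lens C)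
      (s : SeqSet A B U.1.fst U.1.snd U.2.fst U.2.snd) (y : P.obj (op U.1) × Q.obj (op U.2)) =>
      SeqSet.lift (fun M f l => φ (M ⊗ U.1.snd)
        (res (P := P) (X := ⟨A, M ⊗ U.1.snd⟩) (Y := U.1) (lens M f (𝟙 _)) y.1)
        (res (P := Q) (X := ⟨M ⊗ U.1.snd, B⟩) (Y := U.2) l y.2)) (by
          intro M M' m f l
          rw [lens_pre, ← res_res, ← h, res_res, ofHoms_lens]
          refine congrArg (fun k => φ _ (res k y.1) _) (lens_slide m ?_ ?_).symm <;> simp) s)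
    (by
      intro U U' k s y
      induction s using SeqSet.ind with
      | h M f l =>
        obtain ⟨⟨X, Y⟩, ⟨X', Y'⟩⟩ := U
        obtain ⟨⟨X₁, Y₁⟩, ⟨X₁', Y₁'⟩⟩ := U'
        obtain ⟨k, k'⟩ := k
        induction k using lens_ind with
        | h S c d =>
          change φ ((M ⊗ S) ⊗ Y₁)
            (res (lens (M ⊗ S) (f ≫ M ◁ c ≫ (α_ M S X₁).inv) (𝟙 ((M ⊗ S) ⊗ Y₁))) y.1)
            (res (P := Q) (LensSet.comp (LensSet.pre ((α_ M S Y₁).hom ≫ M ◁ d) l) k') y.2) =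
              φ (M ⊗ Y) (res (lens M f (𝟙 (M ⊗ Y))) (res (lens S c d) y.1))
                (res (P := Q) l (res k' y.2))
          have e : LensSet.comp (LensSet.pre ((α_ M S Y₁).hom ≫ M ◁ d) l) k' =
              ofHoms ((α_ M S Y₁).hom ≫ M ◁ d) (𝟙 B) ≫
                (l : (⟨M ⊗ Y, B⟩ : Lens C) ⟶ ⟨X', Y'⟩) ≫ k' := by
            rw [lens_pre]
            exact Category.assoc (ofHoms ((α_ M S Y₁).hom ≫ M ◁ d) (𝟙 B))
              (l : (⟨M ⊗ Y, B⟩ : Lens C) ⟶ ⟨X', Y'⟩) k'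
          rw [e, ← res_res, ← h, res_res, res_res, res_res, ofHoms_lens, lens_comp]
          simp)
    x

theorem seqLift_seqMk {A Z B : C} {β : Type*}
    (φ : ∀ Z : C, P.obj (op ⟨A, Z⟩) → Q.obj (op ⟨Z, B⟩) → β)
    (h : ∀ (Z Z' : C) (m : Z ⟶ Z') (p : P.obj (op ⟨A, Z⟩)) (q : Q.obj (op ⟨Z', B⟩)),
      φ Z' (res (ofHoms (𝟙 A) m) p) q = φ Z p (res (ofHoms m (𝟙 B)) q))
    (p : P.obj (op ⟨A, Z⟩)) (q : Q.obj (op ⟨Z, B⟩)) : seqLift φ h (seqMk p q) = φ Z p q := by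
  rw [seqMk, SeqSet.gen_eq]
  change φ (𝟙_ C ⊗ Z) (res (lens (𝟙_ C) (λ_ A).inv (𝟙 _)) p)
    (res (ofHoms (λ_ Z).hom (𝟙 B)) q) = φ Z p q
  rw [← h, res_res, ofHoms_lens]
  refine congrArg (fun p => φ Z p q) (Eq.trans (congrArg (fun k => res k p) ?_) (res_id p))
  rw [← ofHoms_id]
  simp [ofHoms]

/-- Maps out of `P ◁ Q` are natural families. -/
def seqDesc (φ : ∀ A Z B : C, P.obj (op ⟨A, Z⟩) → Q.obj (op ⟨Z, B⟩) → W.obj (op ⟨A, B⟩))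
    (h : ∀ (A B Z Z' : C) (m : Z ⟶ Z') (p : P.obj (op ⟨A, Z⟩)) (q : Q.obj (op ⟨Z', B⟩)),
      φ A Z' B (res (ofHoms (𝟙 A) m) p) q = φ A Z B p (res (ofHoms m (𝟙 B)) q))
    (h' : ∀ (A' B' A Z B M : C) (f : A' ⟶ M ⊗ A) (g : M ⊗ B ⟶ B') (p : P.obj (op ⟨A, Z⟩))
      (q : Q.obj (op ⟨Z, B⟩)), φ A' (M ⊗ Z) B' (res (lens M f (𝟙 _)) p) (res (lens M (𝟙 _) g) q) =
        res (lens M f g) (φ A Z B p q)) : P ◂ Q ⟶ W :=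
  pshHom (fun X x => seqLift (A := X.fst) (B := X.snd) (fun Z => φ X.fst Z X.snd) (h X.fst X.snd) x) (by
    rintro ⟨A', B'⟩ ⟨A, B⟩ k x
    induction k using lens_ind with
    | h M f g =>
      induction x using seq_ind with
      | h Z p q =>
        refine (congrArg _ (res_seqMk M f g (𝟙 _) (𝟙 _) (by simp) p q)).trans ?_
        rw [seqLift_seqMk, seqLift_seqMk]
        exact h' _ _ _ _ _ M f g p q)

theorem seqDesc_seqMk
    (φ : ∀ A Z B : C, P.obj (op ⟨A, Z⟩) → Q.obj (op ⟨Z, B⟩) → W.obj (op ⟨A, B⟩))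
    (h : ∀ (A B Z Z' : C) (m : Z ⟶ Z') (p : P.obj (op ⟨A, Z⟩)) (q : Q.obj (op ⟨Z', B⟩)),
      φ A Z' B (res (ofHoms (𝟙 A) m) p) q = φ A Z B p (res (ofHoms m (𝟙 B)) q))
    (h' : ∀ (A' B' A Z B M : C) (f : A' ⟶ M ⊗ A) (g : M ⊗ B ⟶ B') (p : P.obj (op ⟨A, Z⟩))
      (q : Q.obj (op ⟨Z, B⟩)), φ A' (M ⊗ Z) B' (res (lens M f (𝟙 _)) p) (res (lens M (𝟙 _) g) q) =
        res (lens M f g) (φ A Z B p q)) {A Z B : C} (p : P.obj (op ⟨A, Z⟩))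
    (q : Q.obj (op ⟨Z, B⟩)) : (seqDesc φ h h').app _ (seqMk p q) = φ A Z B p q :=
  seqLift_seqMk (fun Z => φ A Z B) (h A B) p q

end LensSeq

section LensSeqMonoidal

open Lens

variable {C : Type u} [Category.{v} C] [MonoidalCategory C]

local notation:70 P:70 " ◂ " Q:71 => CategoryTheory.Functor.obj (conv (lensSeq _)) (P, Q)

variable {P Q R W : Psh.{v} (Lens C)}

@[simp]
theorem res_ofHoms_id {A B : C} (p : P.obj (op ⟨A, B⟩)) : res (ofHoms (𝟙 A) (𝟙 B)) p = p :=
  (congrArg (fun k => res k p) (ofHoms_id (⟨A, B⟩ : Lens C))).trans (res_id p)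

theorem res_lens_seqMk {A' B' A Z B : C} (M : C) (f : A' ⟶ M ⊗ A) (g : M ⊗ B ⟶ B')
    (p : P.obj (op ⟨A, Z⟩)) (q : Q.obj (op ⟨Z, B⟩)) :
    res (lens M f g) (seqMk p q) =
      seqMk (res (lens M f (𝟙 (M ⊗ Z))) p) (res (lens M (𝟙 (M ⊗ Z)) g) q) :=
  res_seqMk M f g (𝟙 _) (𝟙 _) (Category.comp_id _) p q

theorem res_left_seqMk {A' A Z B : C} (f : A' ⟶ A) (p : P.obj (op ⟨A, Z⟩))
    (q : Q.obj (op ⟨Z, B⟩)) :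
    res (ofHoms f (𝟙 B)) (seqMk p q) = seqMk (res (ofHoms f (𝟙 Z)) p) q := by
  rw [res_ofHoms_seqMk, res_ofHoms_id]

theorem res_right_seqMk {A Z B B' : C} (g : B ⟶ B') (p : P.obj (op ⟨A, Z⟩))
    (q : Q.obj (op ⟨Z, B⟩)) :
    res (ofHoms (𝟙 A) g) (seqMk p q) = seqMk p (res (ofHoms (𝟙 Z) g) q) := by
  rw [res_ofHoms_seqMk, res_ofHoms_id]

/-- The associator of the sequential convolution. -/
def seqAssocHom (P Q R : Psh.{v} (Lens C)) : (P ◂ Q) ◂ R ⟶ P ◂ (Q ◂ R) :=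
  seqDesc (fun _ _ _ x r => seqLift (fun _ p q => seqMk p (seqMk q r))
      (fun _ _ m p q => by rw [seqMk_slide, res_left_seqMk]) x)
    (by
      intro A B Z Z' m x r
      induction x using seq_ind with
      | h Y p q => rw [res_right_seqMk, seqLift_seqMk, seqLift_seqMk, seqMk_slide])
    (by
      intro A' B' A Z B M f g x r
      induction x using seq_ind with
      | h Y p q => rw [res_lens_seqMk, seqLift_seqMk, seqLift_seqMk, res_lens_seqMk,
          res_lens_seqMk])

/-- The inverse of the associator of the sequential convolution. -/
def seqAssocInv (P Q R : Psh.{v} (Lens C)) : P ◂ (Q ◂ R) ⟶ (P ◂ Q) ◂ R :=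
  seqDesc (fun _ _ _ p x => seqLift (fun _ q r => seqMk (seqMk p q) r)
      (fun _ _ m q r => by rw [← seqMk_slide, res_right_seqMk]) x)
    (by
      intro A B Z Z' m p x
      induction x using seq_ind with
      | h Y q r => rw [res_left_seqMk, seqLift_seqMk, seqLift_seqMk, seqMk_slide])
    (by
      intro A' B' A Z B M f g p x
      induction x using seq_ind with
      | h Y q r => rw [res_lens_seqMk, seqLift_seqMk, seqLift_seqMk, res_lens_seqMk,
          res_lens_seqMk])

theorem seqAssocHom_seqMk {A Y Z B : C} (p : P.obj (op ⟨A, Y⟩)) (q : Q.obj (op ⟨Y, Z⟩))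
    (r : R.obj (op ⟨Z, B⟩)) :
    (seqAssocHom P Q R).app _ (seqMk (seqMk p q) r) = seqMk p (seqMk q r) := by
  rw [seqAssocHom, seqDesc_seqMk, seqLift_seqMk]

theorem seqAssocInv_seqMk {A Y Z B : C} (p : P.obj (op ⟨A, Y⟩)) (q : Q.obj (op ⟨Y, Z⟩))
    (r : R.obj (op ⟨Z, B⟩)) :
    (seqAssocInv P Q R).app _ (seqMk p (seqMk q r)) = seqMk (seqMk p q) r := by
  rw [seqAssocInv, seqDesc_seqMk, seqLift_seqMk]

theorem seq_hom_ext_left {a b : (P ◂ Q) ◂ R ⟶ W}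
    (h : ∀ (A Y Z B : C) (p : P.obj (op ⟨A, Y⟩)) (q : Q.obj (op ⟨Y, Z⟩)) (r : R.obj (op ⟨Z, B⟩)),
      a.app _ (seqMk (seqMk p q) r) = b.app _ (seqMk (seqMk p q) r)) : a = b :=
  seq_hom_ext (fun A Z B x r => by
    induction x using seq_ind with
    | h Y p q => exact h A Y Z B p q r)

theorem seq_hom_ext_right {a b : P ◂ (Q ◂ R) ⟶ W}
    (h : ∀ (A Y Z B : C) (p : P.obj (op ⟨A, Y⟩)) (q : Q.obj (op ⟨Y, Z⟩)) (r : R.obj (op ⟨Z, B⟩)),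
      a.app _ (seqMk p (seqMk q r)) = b.app _ (seqMk p (seqMk q r))) : a = b :=
  seq_hom_ext (fun A Y B p x => by
    induction x using seq_ind with
    | h Z q r => exact h A Y Z B p q r)

/-- The associator of the sequential convolution. -/
def seqAssoc (P Q R : Psh.{v} (Lens C)) : (P ◂ Q) ◂ R ≅ P ◂ (Q ◂ R) where
  hom := seqAssocHom P Q R
  inv := seqAssocInv P Q R
  hom_inv_id := seq_hom_ext_left (fun A Y Z B p q r => by
    rw [comp_app_el, seqAssocHom_seqMk, seqAssocInv_seqMk, id_app_el])
  inv_hom_id := seq_hom_ext_right (fun A Y Z B p q r => by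
    rw [comp_app_el, seqAssocInv_seqMk, seqAssocHom_seqMk, id_app_el])

/-- Morphisms of `C` as elements of the units. -/
def unitEl {A B : C} (h : A ⟶ B) : (lensUnit C).obj (op ⟨A, B⟩) :=
  ULift.up h

theorem unit_ind {A B : C} {m : (lensUnit C).obj (op ⟨A, B⟩) → Prop}
    (h : ∀ f : A ⟶ B, m (unitEl f)) (x : (lensUnit C).obj (op ⟨A, B⟩)) : m x :=
  h x.down

theorem res_unitEl {A B A' B' : C} (M : C) (f : A' ⟶ M ⊗ A) (g : M ⊗ B ⟶ B') (h : A ⟶ B) :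
    res (lens M f g) (unitEl h) = unitEl (f ≫ M ◁ h ≫ g) :=
  rfl

theorem res_ofHoms_unitEl {A B A' B' : C} (f : A' ⟶ A) (g : B ⟶ B') (h : A ⟶ B) :
    res (ofHoms f g) (unitEl h) = unitEl (f ≫ h ≫ g) := by
  rw [ofHoms, res_unitEl]
  simp

/-- The left unitor of the sequential convolution. -/
def seqLunit (P : Psh.{v} (Lens C)) : lensUnit C ◂ P ≅ P where
  hom := seqDesc (fun _ _ B h p => res (ofHoms h.down (𝟙 B)) p)
    (by
      intro A B Z Z' m h p
      induction h using unit_ind with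
      | h h =>
        rw [res_ofHoms_unitEl, res_res]
        simp [unitEl])
    (by
      intro A' B' A Z B M f g h p
      induction h using unit_ind with
      | h h =>
        rw [res_unitEl, res_res, res_res]
        simp [unitEl])
  inv := pshHom (fun A p => seqMk (unitEl (𝟙 A.fst)) p) (by
    rintro ⟨A', B'⟩ ⟨A, B⟩ k p
    induction k using lens_ind with
    | h M f g =>
      refine Eq.trans ?_ (res_lens_seqMk M f g (unitEl (𝟙 A)) p).symm
      have e := seqMk_slide f (unitEl (𝟙 A')) (res (lens M (𝟙 (M ⊗ A)) g) p)
      rw [res_ofHoms_unitEl, res_res, ofHoms_lens] at e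
      rw [res_unitEl]
      simpa using e.symm)
  hom_inv_id := seq_hom_ext (fun A Z B h p => by
    induction h using unit_ind with
    | h h =>
      rw [comp_app_el, seqDesc_seqMk]
      refine (seqMk_slide h (unitEl (𝟙 A)) p).symm.trans ?_
      rw [res_ofHoms_unitEl, id_app_el]
      simp)
  inv_hom_id := psh_ext (fun ⟨⟨A, B⟩⟩ p => by
    rw [comp_app_el, pshHom_app, seqDesc_seqMk]
    exact res_ofHoms_id p)

/-- The right unitor of the sequential convolution. -/
def seqRunit (P : Psh.{v} (Lens C)) : P ◂ lensUnit C ≅ P where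
  hom := seqDesc (fun A _ _ p h => res (ofHoms (𝟙 A) h.down) p)
    (by
      intro A B Z Z' m p h
      induction h using unit_ind with
      | h h =>
        rw [res_ofHoms_unitEl, res_res]
        simp [unitEl])
    (by
      intro A' B' A Z B M f g p h
      induction h using unit_ind with
      | h h =>
        rw [res_unitEl, res_res, res_res]
        simp [unitEl])
  inv := pshHom (fun A p => seqMk p (unitEl (𝟙 A.snd))) (by
    rintro ⟨A', B'⟩ ⟨A, B⟩ k p
    induction k using lens_ind with
    | h M f g =>
      refine Eq.trans ?_ (res_lens_seqMk M f g p (unitEl (𝟙 B))).symm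
      have e := seqMk_slide g (res (lens M f (𝟙 (M ⊗ B))) p) (unitEl (𝟙 B'))
      rw [res_ofHoms_unitEl, res_res, ofHoms_lens] at e
      rw [res_unitEl]
      simpa using e)
  hom_inv_id := seq_hom_ext (fun A Z B p h => by
    induction h using unit_ind with
    | h h =>
      rw [comp_app_el, seqDesc_seqMk]
      refine (seqMk_slide h p (unitEl (𝟙 B))).trans ?_
      rw [res_ofHoms_unitEl, id_app_el]
      simp)
  inv_hom_id := psh_ext (fun ⟨⟨A, B⟩⟩ p => by
    rw [comp_app_el, pshHom_app, seqDesc_seqMk]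
    exact res_ofHoms_id p)

theorem seqLunit_seqMk {A Z B : C} (h : A ⟶ Z) (p : P.obj (op ⟨Z, B⟩)) :
    (seqLunit P).hom.app _ (seqMk (unitEl h) p) = res (ofHoms h (𝟙 B)) p := by
  rw [seqLunit, seqDesc_seqMk, unitEl]

theorem seqRunit_seqMk {A Z B : C} (p : P.obj (op ⟨A, Z⟩)) (h : Z ⟶ B) :
    (seqRunit P).hom.app _ (seqMk p (unitEl h)) = res (ofHoms (𝟙 A) h) p := by
  rw [seqRunit, seqDesc_seqMk, unitEl]

variable (C) in
/-- The splitting of a morphism into an identity followed by itself. -/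
def unitSplit : lensUnit C ⟶ lensUnit C ◂ lensUnit C :=
  pshHom (fun A h => seqMk (unitEl (𝟙 A.fst)) (unitEl h.down)) (by
    rintro ⟨A', B'⟩ ⟨A, B⟩ k h
    induction k using lens_ind with
    | h M f g =>
      induction h using unit_ind with
      | h h =>
        refine Eq.trans ?_ (res_lens_seqMk M f g (unitEl (𝟙 A)) (unitEl h)).symm
        have e := seqMk_slide f (unitEl (𝟙 A')) (unitEl (M ◁ h ≫ g))
        rw [res_ofHoms_unitEl, res_ofHoms_unitEl] at e
        rw [res_unitEl, res_unitEl, res_unitEl]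
        simpa [unitEl] using e.symm)

theorem unitSplit_unitEl {A B : C} (h : A ⟶ B) :
    (unitSplit C).app _ (unitEl h) = seqMk (unitEl (𝟙 A)) (unitEl h) :=
  rfl

theorem unitSplit_comp {A B : C} (h : A ⟶ B) (k : lensUnit C ◂ lensUnit C ⟶ P) :
    (unitSplit C ≫ k).app _ (unitEl h) = k.app _ (seqMk (unitEl (𝟙 A)) (unitEl h)) :=
  rfl

theorem seqMk_ofHoms_iso {A A' Z Z' B B' : C} (f : A' ⟶ A) (i : Z ≅ Z') (g : B ⟶ B')
    (p : P.obj (op ⟨A, Z'⟩)) (q : Q.obj (op ⟨Z', B⟩)) :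
    seqMk (res (ofHoms f i.inv) p) (res (ofHoms i.hom g) q) = res (ofHoms f g) (seqMk p q) := by
  rw [res_ofHoms_seqMk]
  have e₁ : (ofHoms f i.inv : (⟨A', Z⟩ : Lens C) ⟶ ⟨A, Z'⟩) =
      ofHoms (𝟙 A') i.inv ≫ ofHoms f (𝟙 Z') := by
    rw [ofHoms_comp, Category.id_comp, Category.id_comp]
  rw [e₁, ← res_res, seqMk_slide, res_res, ofHoms_comp, Iso.inv_hom_id, Category.comp_id]

variable (C) in
/-- Sequential convolution is associative and unital. -/
def seqMonoidal : ConvMonoidal (lensSeq C) (lensUnit C) where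
  assoc := seqAssoc
  lunit := seqLunit
  runit := seqRunit
  assoc_naturality η θ κ := seq_hom_ext_left (fun A Y Z B p q r => by
    simp only [comp_app_el, convMap_seqMk, seqAssoc, seqAssocHom_seqMk])
  lunit_naturality η := seq_hom_ext (fun A Z B h p => by
    induction h using unit_ind with
    | h h => simp only [comp_app_el, convMap_seqMk, seqLunit_seqMk, app_res, id_app_el])
  runit_naturality η := seq_hom_ext (fun A Z B p h => by
    induction h using unit_ind with
    | h h => simp only [comp_app_el, convMap_seqMk, seqRunit_seqMk, app_res, id_app_el])
  pentagon P Q R S := seq_hom_ext_left (fun A Y Z B x r s => by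
    induction x using seq_ind with
    | h U p q =>
      simp only [comp_app_el, convMap_seqMk, seqAssoc, seqAssocHom_seqMk, id_app_el])
  triangle P Q := seq_hom_ext_left (fun A Y Z B p h q => by
    induction h using unit_ind with
    | h h =>
      simp only [comp_app_el, convMap_seqMk, seqAssoc, seqAssocHom_seqMk, id_app_el,
        seqLunit_seqMk, seqRunit_seqMk, seqMk_slide])

end LensSeqMonoidal

section LensProduoidal

open Lens

variable {C : Type u} [Category.{v} C] [MonoidalCategory C]

theorem unit_lens_res {A' B' A B : C} (M : C) (f : A' ⟶ M ⊗ A) (g : M ⊗ B ⟶ B') (h : A ⟶ B) :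
    lens A' (ρ_ A').inv ((ρ_ A').hom ≫ f ≫ M ◁ h ≫ g) =
      lens M f g ≫ lens A (ρ_ A).inv ((ρ_ A).hom ≫ h) := by
  rw [lens_comp]
  refine lens_slide f ?_ ?_ <;> simp

variable [SymmetricCategory C]

variable (C) in
/-- The unit presheaf acts as the lenses into the unit object. -/
def unitLens : lensUnit C ⟶ yoneda.obj (𝟙_ (Lens C)) :=
  pshHom (fun A h => lens A.fst (ρ_ A.fst).inv ((ρ_ A.fst).hom ≫ h.down)) (by
    rintro ⟨A', B'⟩ ⟨A, B⟩ k h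
    induction k using lens_ind with
    | h M f g => exact unit_lens_res M f g h.down)

variable (C) in
/-- The unit presheaf is represented by the unit object. -/
def unitIso : lensUnit C ≅ yoneda.obj (𝟙_ (Lens C)) where
  hom := unitLens C
  inv := classify (unitEl (𝟙 (𝟙_ C)))
  hom_inv_id := psh_ext (fun ⟨⟨A, B⟩⟩ h => by
    induction h using unit_ind with
    | h h =>
      refine (classify_app (P := lensUnit C) (X := 𝟙_ (Lens C)) (unitEl (𝟙 (𝟙_ C)))
        (lens A (ρ_ A).inv ((ρ_ A).hom ≫ h))).trans ?_
      change unitEl ((ρ_ A).inv ≫ A ◁ 𝟙 (𝟙_ C) ≫ (ρ_ A).hom ≫ h) = unitEl h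
      simp)
  inv_hom_id := psh_ext (fun ⟨⟨A, B⟩⟩ k => by
    induction k using lens_ind with
    | h M f g =>
      refine (congrArg ((unitLens C).app (op ⟨A, B⟩)) (classify_app (P := lensUnit C)
        (X := 𝟙_ (Lens C)) (unitEl (𝟙 (𝟙_ C))) (lens M f g))).trans ?_
      change lens A (ρ_ A).inv ((ρ_ A).hom ≫ f ≫ M ◁ 𝟙 (𝟙_ C) ≫ g) = lens M f g
      change A ⟶ M ⊗ 𝟙_ C at f
      change M ⊗ 𝟙_ C ⟶ B at g
      have e : (ρ_ A).inv ≫ (f ≫ (ρ_ M).hom) ▷ 𝟙_ C = f := by simp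
      have e' : (ρ_ A).hom ≫ f ≫ M ◁ 𝟙 (𝟙_ C) ≫ g = (f ≫ (ρ_ M).hom) ▷ 𝟙_ C ≫ g := by simp
      exact lens_slide (f ≫ (ρ_ M).hom) e.symm e')

theorem toUnit_unitEl {A B : C} (h : A ⟶ B) :
    toUnit (unitIso C) (unitEl h) = lens A (ρ_ A).inv ((ρ_ A).hom ≫ h) :=
  rfl

theorem tensorμ_unit (A X : C) : tensorμ A (𝟙_ C) (𝟙_ C) X = 𝟙 _ := by
  have : (β_ (𝟙_ C) (𝟙_ C)).hom = 𝟙 _ := by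
    rw [braiding_tensorUnit_left]
    simp [unitors_equal]
  simp [tensorμ, this]

theorem absorb_left {A B : C} (h : A ⟶ B) (X Y : C) :
    toUnit (unitIso C) (unitEl h) ▷ (⟨X, Y⟩ : Lens C) ≫ (λ_ (⟨X, Y⟩ : Lens C)).hom =
      lens A (𝟙 (A ⊗ X)) (h ▷ Y) := by
  rw [toUnit_unitEl, leftUnitor_hom, ← tensorHom_id]
  change (lens _ _ _ ⊗ₘ lens (𝟙_ C) (λ_ X).inv (λ_ Y).hom) ≫ _ = _
  refine (congrArg (fun z => z ≫ ofHoms (λ_ X).hom (λ_ Y).inv) (tensor_lens _ _ _ _ _ _)).trans ?_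
  rw [lens_ofHoms, tensorμ_unit, tensorμ_unit]
  refine lens_slide (ρ_ A).hom ?_ ?_
  · rw [Category.comp_id, MonoidalCategory.tensorHom_def, Category.assoc, Category.assoc,
      whiskerLeft_inv_hom_assoc, inv_hom_whiskerRight]
  · rw [Category.id_comp, MonoidalCategory.tensorHom_def', whiskerLeft_inv_hom_assoc,
      comp_whiskerRight]

theorem absorb_right {A B : C} (X Y : C) (h : A ⟶ B) :
    (⟨X, Y⟩ : Lens C) ◁ toUnit (unitIso C) (unitEl h) ≫ (ρ_ (⟨X, Y⟩ : Lens C)).hom =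
      lens A (β_ X A).hom ((β_ A Y).hom ≫ Y ◁ h) := by
  rw [← braiding_leftUnitor, BraidedCategory.braiding_naturality_right_assoc, absorb_left]
  refine (congrArg (fun z => z ≫ lens A (𝟙 (A ⊗ X)) (h ▷ Y)) (braid_hom _ _)).trans ?_
  rw [ofHoms_lens, Category.comp_id]
  change lens A (β_ X A).hom (h ▷ Y ≫ (β_ Y B).inv) = _
  rw [← SymmetricCategory.braiding_swap_eq_inv_braiding, BraidedCategory.braiding_naturality_left]

variable {P Q R W P' Q' R' W' : Psh.{v} (Lens C)}

local notation:70 P:70 " ◂ " Q:71 => CategoryTheory.Functor.obj (conv (lensSeq _)) (P, Q)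
local notation:70 P:70 " ⊛ " Q:71 => CategoryTheory.Functor.obj (conv (lensPar _)) (P, Q)

variable (C) in
/-- Parallel convolution is associative and unital. -/
def parMonoidal : ConvMonoidal (lensPar C) (lensUnit C) :=
  dayMonoidal (unitIso C)

/-- The external product of two elements. -/
def parEl {A B A' B' : C} (p : P.obj (op ⟨A, B⟩)) (q : Q.obj (op ⟨A', B'⟩)) :
    (P ⊛ Q).obj (op ⟨A ⊗ A', B ⊗ B'⟩) :=
  parMk p q

theorem parEl_res_lens {A B X Y A' B' X' Y' : C} (M N : C) (f : A ⟶ M ⊗ X) (g : M ⊗ Y ⟶ B)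
    (f' : A' ⟶ N ⊗ X') (g' : N ⊗ Y' ⟶ B') (p : P.obj (op ⟨X, Y⟩)) (q : Q.obj (op ⟨X', Y'⟩)) :
    parEl (res (lens M f g) p) (res (lens N f' g') q) =
      res (lens (M ⊗ N) ((f ⊗ₘ f') ≫ tensorμ M X N X') (tensorμ M N Y Y' ≫ (g ⊗ₘ g')))
        (parEl p q) :=
  (res_parMk (lens M f g) (lens N f' g') p q).symm

theorem parEl_res_ofHoms {A B X Y A' B' X' Y' : C} (f : A ⟶ X) (g : Y ⟶ B)
    (f' : A' ⟶ X') (g' : Y' ⟶ B') (p : P.obj (op ⟨X, Y⟩)) (q : Q.obj (op ⟨X', Y'⟩)) :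
    parEl (res (ofHoms f g) p) (res (ofHoms f' g') q) =
      res (ofHoms (f ⊗ₘ f') (g ⊗ₘ g')) (parEl p q) :=
  (res_parMk (ofHoms f g) (ofHoms f' g') p q).symm.trans
    (congrArg (fun k => res k (parEl p q)) (tensor_ofHoms f g f' g'))

theorem parEl_res_left {A B X Y A' B' : C} (f : A ⟶ X) (g : Y ⟶ B) (p : P.obj (op ⟨X, Y⟩))
    (q : Q.obj (op ⟨A', B'⟩)) :
    parEl (res (ofHoms f g) p) q = res (ofHoms (f ▷ A') (g ▷ B')) (parEl p q) := by
  have h := parEl_res_ofHoms f g (𝟙 A') (𝟙 B') p q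
  rwa [res_ofHoms_id, tensorHom_id, tensorHom_id] at h

theorem parEl_res_right {A B X Y A' B' : C} (f : A ⟶ X) (g : Y ⟶ B) (p : P.obj (op ⟨A', B'⟩))
    (q : Q.obj (op ⟨X, Y⟩)) :
    parEl p (res (ofHoms f g) q) = res (ofHoms (A' ◁ f) (B' ◁ g)) (parEl p q) := by
  have h := parEl_res_ofHoms (𝟙 A') (𝟙 B') f g p q
  rwa [res_ofHoms_id, id_tensorHom, id_tensorHom] at h

theorem convMap_parEl (η : P ⟶ P') (θ : Q ⟶ Q') {A B A' B' : C} (p : P.obj (op ⟨A, B⟩))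
    (q : Q.obj (op ⟨A', B'⟩)) :
    (convMap (lensPar C) η θ).app _ (parEl p q) = parEl (η.app _ p) (θ.app _ q) :=
  rfl

theorem par_hom_ext {a b : P ⊛ Q ⟶ W}
    (h : ∀ (A B A' B' : C) (p : P.obj (op ⟨A, B⟩)) (q : Q.obj (op ⟨A', B'⟩)),
      a.app _ (parEl p q) = b.app _ (parEl p q)) : a = b :=
  day_hom_ext (fun ⟨A, B⟩ ⟨A', B'⟩ p q => h A B A' B' p q)

theorem par_hom_ext_left {a b : (P ⊛ Q) ⊛ R ⟶ W}
    (h : ∀ (A B A' B' A'' B'' : C) (p : P.obj (op ⟨A, B⟩)) (q : Q.obj (op ⟨A', B'⟩))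
      (r : R.obj (op ⟨A'', B''⟩)),
      a.app _ (parEl (parEl p q) r) = b.app _ (parEl (parEl p q) r)) : a = b :=
  day_hom_ext_left (fun ⟨A, B⟩ ⟨A', B'⟩ ⟨A'', B''⟩ p q r => h A B A' B' A'' B'' p q r)

/-- Maps out of the parallel convolution are natural families. -/
def parDesc (φ : ∀ A B A' B' : C, P.obj (op ⟨A, B⟩) → Q.obj (op ⟨A', B'⟩) →
      W.obj (op ⟨A ⊗ A', B ⊗ B'⟩))
    (h : ∀ (A B X Y A' B' X' Y' M N : C) (f : A ⟶ M ⊗ X) (g : M ⊗ Y ⟶ B)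
      (f' : A' ⟶ N ⊗ X') (g' : N ⊗ Y' ⟶ B') (p : P.obj (op ⟨X, Y⟩)) (q : Q.obj (op ⟨X', Y'⟩)),
      φ A B A' B' (res (lens M f g) p) (res (lens N f' g') q) =
        res (lens (M ⊗ N) ((f ⊗ₘ f') ≫ tensorμ M X N X') (tensorμ M N Y Y' ≫ (g ⊗ₘ g')))
          (φ X Y X' Y' p q)) : P ⊛ Q ⟶ W :=
  dayDesc (fun X Y p q => φ X.fst X.snd Y.fst Y.snd p q) (by
    rintro ⟨X, Y⟩ ⟨X', Y'⟩ ⟨A, B⟩ ⟨A', B'⟩ k l p q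
    induction k using lens_ind with
    | h M f g =>
      induction l using lens_ind with
      | h N f' g' => exact h A B X Y A' B' X' Y' M N f g f' g' p q)

theorem parDesc_parEl (φ : ∀ A B A' B' : C, P.obj (op ⟨A, B⟩) → Q.obj (op ⟨A', B'⟩) →
      W.obj (op ⟨A ⊗ A', B ⊗ B'⟩))
    (h : ∀ (A B X Y A' B' X' Y' M N : C) (f : A ⟶ M ⊗ X) (g : M ⊗ Y ⟶ B)
      (f' : A' ⟶ N ⊗ X') (g' : N ⊗ Y' ⟶ B') (p : P.obj (op ⟨X, Y⟩)) (q : Q.obj (op ⟨X', Y'⟩)),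
      φ A B A' B' (res (lens M f g) p) (res (lens N f' g') q) =
        res (lens (M ⊗ N) ((f ⊗ₘ f') ≫ tensorμ M X N X') (tensorμ M N Y Y' ≫ (g ⊗ₘ g')))
          (φ X Y X' Y' p q)) {A B A' B' : C} (p : P.obj (op ⟨A, B⟩)) (q : Q.obj (op ⟨A', B'⟩)) :
    (parDesc φ h).app _ (parEl p q) = φ A B A' B' p q :=
  dayDesc_parMk (V := Lens C) (X := ⟨A, B⟩) (Y := ⟨A', B'⟩)
    (fun X Y p q => φ X.fst X.snd Y.fst Y.snd p q) _ p q

theorem parAssoc_parEl {A B A' B' A'' B'' : C} (p : P.obj (op ⟨A, B⟩)) (q : Q.obj (op ⟨A', B'⟩))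
    (r : R.obj (op ⟨A'', B''⟩)) :
    ((parMonoidal C).assoc P Q R).hom.app _ (parEl (parEl p q) r) =
      res (ofHoms (α_ A A' A'').hom (α_ B B' B'').inv) (parEl p (parEl q r)) :=
  (dayAssocHom_parMk (V := Lens C) (X := ⟨A, B⟩) (Y := ⟨A', B'⟩) (Z := ⟨A'', B''⟩) p q r).trans
    (congrArg (fun k => res k (parEl p (parEl q r))) (associator_hom _ _ _))

theorem parLunit_parEl {A B X Y : C} (h : A ⟶ B) (p : P.obj (op ⟨X, Y⟩)) :
    ((parMonoidal C).lunit P).hom.app _ (parEl (unitEl h) p) =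
      res (lens A (𝟙 (A ⊗ X)) (h ▷ Y)) p :=
  (dayLunit_parMk (V := Lens C) (X := ⟨A, B⟩) (Y := ⟨X, Y⟩) (unitIso C) (unitEl h) p).trans
    (congrArg (fun k => res k p) (absorb_left h X Y))

theorem parRunit_parEl {A B X Y : C} (p : P.obj (op ⟨X, Y⟩)) (h : A ⟶ B) :
    ((parMonoidal C).runit P).hom.app _ (parEl p (unitEl h)) =
      res (lens A (β_ X A).hom ((β_ A Y).hom ≫ Y ◁ h)) p :=
  (dayRunit_parMk (V := Lens C) (X := ⟨X, Y⟩) (Y := ⟨A, B⟩) (unitIso C) p (unitEl h)).trans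
    (congrArg (fun k => res k p) (absorb_right X Y h))

end LensProduoidal

section LensLaxators

open Lens

variable {C : Type u} [Category.{v} C] [MonoidalCategory C] [SymmetricCategory C]
variable {P Q R W P' Q' R' W' X : Psh.{v} (Lens C)}

local notation:70 P:70 " ◂ " Q:71 => CategoryTheory.Functor.obj (conv (lensSeq _)) (P, Q)
local notation:70 P:70 " ⊛ " Q:71 => CategoryTheory.Functor.obj (conv (lensPar _)) (P, Q)

theorem tensorμ_tensorμ (M X P Y : C) : tensorμ M X P Y ≫ tensorμ M P X Y = 𝟙 _ := by
  have : tensorμ M P X Y = tensorδ M X P Y := by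
    simp [tensorμ, tensorδ, SymmetricCategory.braiding_swap_eq_inv_braiding]
  rw [this, tensorμ_tensorδ]

/-- The sequential composition of two elements of `Q ◁ W` tensored with the fixed elements of a
split of `P ◁ R`. -/
def interchangeFix {A Z B A' B' : C} (p : P.obj (op ⟨A, Z⟩)) (q : Q.obj (op ⟨Z, B⟩))
    (y : (R ◂ W).obj (op ⟨A', B'⟩)) : ((P ⊛ R) ◂ (Q ⊛ W)).obj (op ⟨A ⊗ A', B ⊗ B'⟩) :=
  seqLift (fun _ r w => seqMk (parEl p r) (parEl q w)) (fun _ _ m r w => by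
    rw [parEl_res_right, parEl_res_right, whiskerLeft_id, whiskerLeft_id, seqMk_slide]) y

theorem interchangeFix_seqMk {A Z B A' Z' B' : C} (p : P.obj (op ⟨A, Z⟩)) (q : Q.obj (op ⟨Z, B⟩))
    (r : R.obj (op ⟨A', Z'⟩)) (w : W.obj (op ⟨Z', B'⟩)) :
    interchangeFix p q (seqMk r w) = seqMk (parEl p r) (parEl q w) := by
  rw [interchangeFix, seqLift_seqMk]

/-- The interchange of two composable pairs of elements. -/
def interchangeEl {A B A' B' : C} (x : (P ◂ Q).obj (op ⟨A, B⟩)) (y : (R ◂ W).obj (op ⟨A', B'⟩)) :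
    ((P ⊛ R) ◂ (Q ⊛ W)).obj (op ⟨A ⊗ A', B ⊗ B'⟩) :=
  seqLift (fun _ p q => interchangeFix p q y) (fun _ _ m p q => by
    induction y using seq_ind with
    | h Z' r w =>
      rw [interchangeFix_seqMk, interchangeFix_seqMk, parEl_res_left, parEl_res_left,
        id_whiskerRight, id_whiskerRight, seqMk_slide]) x

theorem interchangeEl_seqMk {A Z B A' Z' B' : C} (p : P.obj (op ⟨A, Z⟩)) (q : Q.obj (op ⟨Z, B⟩))
    (r : R.obj (op ⟨A', Z'⟩)) (w : W.obj (op ⟨Z', B'⟩)) :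
    interchangeEl (seqMk p q) (seqMk r w) = seqMk (parEl p r) (parEl q w) := by
  rw [interchangeEl, seqLift_seqMk, interchangeFix_seqMk]

/-- The interchange of parallel and sequential convolution. -/
def interchange (P Q R W : Psh.{v} (Lens C)) : (P ◂ Q) ⊛ (R ◂ W) ⟶ (P ⊛ R) ◂ (Q ⊛ W) :=
  parDesc (fun _ _ _ _ x y => interchangeEl x y) (by
    intro A B X Y A' B' X' Y' M N f g f' g' x y
    induction x using seq_ind with
    | h Z p q =>
      induction y using seq_ind with
      | h Z' r w =>
        rw [res_lens_seqMk, res_lens_seqMk, interchangeEl_seqMk, interchangeEl_seqMk,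
          parEl_res_lens, parEl_res_lens, id_tensorHom_id, Category.comp_id,
          Category.id_comp]
        exact (res_seqMk _ _ _ _ _ (tensorμ_tensorμ M N Z Z') _ _).symm)

theorem interchange_parEl {A Z B A' Z' B' : C} (p : P.obj (op ⟨A, Z⟩)) (q : Q.obj (op ⟨Z, B⟩))
    (r : R.obj (op ⟨A', Z'⟩)) (w : W.obj (op ⟨Z', B'⟩)) :
    (interchange P Q R W).app _ (parEl (seqMk p q) (seqMk r w)) =
      seqMk (parEl p r) (parEl q w) := by
  rw [interchange, parDesc_parEl, interchangeEl_seqMk]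

theorem par_seq_hom_ext {a b : (P ◂ Q) ⊛ (R ◂ W) ⟶ X}
    (h : ∀ (A Z B A' Z' B' : C) (p : P.obj (op ⟨A, Z⟩)) (q : Q.obj (op ⟨Z, B⟩))
      (r : R.obj (op ⟨A', Z'⟩)) (w : W.obj (op ⟨Z', B'⟩)),
      a.app _ (parEl (seqMk p q) (seqMk r w)) = b.app _ (parEl (seqMk p q) (seqMk r w))) : a = b :=
  par_hom_ext (fun A B A' B' x y => by
    induction x using seq_ind with
    | h Z p q =>
      induction y using seq_ind with
      | h Z' r w => exact h A Z B A' Z' B' p q r w)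

theorem interchange_naturality (η : P ⟶ P') (θ : Q ⟶ Q') (κ : R ⟶ R') (ι : W ⟶ W') :
    convMap (lensPar C) (convMap (lensSeq C) η θ) (convMap (lensSeq C) κ ι) ≫
        interchange P' Q' R' W' =
      interchange P Q R W ≫ convMap (lensSeq C) (convMap (lensPar C) η κ)
        (convMap (lensPar C) θ ι) :=
  par_seq_hom_ext (fun A Z B A' Z' B' p q r w => by
    simp only [comp_app_el, convMap_parEl, convMap_seqMk, interchange_parEl])

variable (C) in
/-- The tensor product of morphisms. -/
def unitTensor : lensUnit C ⊛ lensUnit C ⟶ lensUnit C :=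
  parDesc (fun _ _ _ _ h h' => unitEl (h.down ⊗ₘ h'.down)) (by
    intro A B X Y A' B' X' Y' M N f g f' g' h h'
    induction h using unit_ind with
    | h h =>
      induction h' using unit_ind with
      | h h' =>
        rw [res_unitEl, res_unitEl, res_unitEl]
        refine congrArg unitEl ?_
        change (f ≫ M ◁ h ≫ g) ⊗ₘ (f' ≫ N ◁ h' ≫ g') = ((f ⊗ₘ f') ≫ tensorμ M X N X') ≫
          (M ⊗ N) ◁ (h ⊗ₘ h') ≫ tensorμ M N Y Y' ≫ (g ⊗ₘ g')
        have e := tensorμ_natural (𝟙 M) h (𝟙 N) h'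
        rw [id_tensorHom_id, id_tensorHom, id_tensorHom, id_tensorHom] at e
        rw [Category.assoc, ← reassoc_of% e, reassoc_of% (tensorμ_tensorμ M Y N Y'),
          tensorHom_comp_tensorHom, tensorHom_comp_tensorHom])

theorem unitTensor_parEl {A B A' B' : C} (h : A ⟶ B) (h' : A' ⟶ B') :
    (unitTensor C).app _ (parEl (unitEl h) (unitEl h')) = unitEl (h ⊗ₘ h') := by
  rw [unitTensor, parDesc_parEl]
  rfl

variable (C) in
/-- The data of the produoidal category of lenses. -/
def lensProduoidalData :
    ProduoidalData (lensPar C) (lensUnit C) (lensSeq C) (lensUnit C) where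
  parallel := (parMonoidal C).toPromonoidal
  sequential := (seqMonoidal C).toPromonoidal
  psi₂ := restrictInterchange (lensPar C) (lensSeq C) interchange interchange_naturality
  psi₀ := unitSplit C
  phi₂ := unitTensor C
  phi₀ := 𝟙 _

theorem lens_psi₂Ext (P Q R W : Psh.{v} (Lens C)) :
    (lensProduoidalData C).psi₂Ext P Q R W = interchange P Q R W :=
  restrictInterchange_ext (lensPar C) (lensSeq C) interchange interchange_naturality P Q R W

theorem lens_parallel_assocExt (P Q R : Psh.{v} (Lens C)) :
    (lensProduoidalData C).parallel.assocExt P Q R = ((parMonoidal C).assoc P Q R).hom :=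
  (parMonoidal C).assocExt_eq P Q R

theorem lens_parallel_lunitExt (P : Psh.{v} (Lens C)) :
    (lensProduoidalData C).parallel.lunitExt P = ((parMonoidal C).lunit P).hom :=
  (parMonoidal C).lunitExt_eq P

theorem lens_parallel_runitExt (P : Psh.{v} (Lens C)) :
    (lensProduoidalData C).parallel.runitExt P = ((parMonoidal C).runit P).hom :=
  (parMonoidal C).runitExt_eq P

theorem lens_sequential_assocExt (P Q R : Psh.{v} (Lens C)) :
    (lensProduoidalData C).sequential.assocExt P Q R = seqAssocHom P Q R :=
  (seqMonoidal C).assocExt_eq P Q R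

theorem lens_sequential_lunitExt (P : Psh.{v} (Lens C)) :
    (lensProduoidalData C).sequential.lunitExt P = (seqLunit P).hom :=
  (seqMonoidal C).lunitExt_eq P

theorem lens_sequential_runitExt (P : Psh.{v} (Lens C)) :
    (lensProduoidalData C).sequential.runitExt P = (seqRunit P).hom :=
  (seqMonoidal C).runitExt_eq P

end LensLaxators

section LensCoherence

open Lens

variable (C : Type u) [Category.{v} C] [MonoidalCategory C] [SymmetricCategory C]

/-- Monoidal lenses form a produoidal category. -/
def lensProduoidal : Produoidal (lensPar C) (lensUnit C) (lensSeq C) (lensUnit C) where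
  toProduoidalData := lensProduoidalData C
  psi₂_assoc_par A B D E F G := by
    simp only [lens_psi₂Ext, lens_parallel_assocExt]
    refine par_hom_ext_left (fun X₁ Y₁ X₂ Y₂ X₃ Y₃ x y z => ?_)
    induction x using seq_ind with
    | h Z₁ a b =>
      induction y using seq_ind with
      | h Z₂ d e =>
        induction z using seq_ind with
        | h Z₃ f g =>
          simp only [comp_app_el, convMap_parEl, convMap_seqMk, interchange_parEl,
            parAssoc_parEl, id_app_el, app_res]
          exact seqMk_ofHoms_iso _ (α_ Z₁ Z₂ Z₃) _ _ _
  psi₂_assoc_seq A B D E F G := by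
    simp only [lens_psi₂Ext, lens_sequential_assocExt]
    refine par_seq_hom_ext (fun X Z Y X' Z' Y' x c y f => ?_)
    induction x using seq_ind with
    | h U a b =>
      induction y using seq_ind with
      | h U' d e =>
        simp only [comp_app_el, convMap_parEl, convMap_seqMk, interchange_parEl,
          seqAssocHom_seqMk, id_app_el]
  lunit_par A B := by
    simp only [lens_psi₂Ext, lens_parallel_lunitExt]
    refine par_hom_ext (fun X Y X' Y' h y => ?_)
    induction h using unit_ind with
    | h h =>
      induction y using seq_ind with
      | h Z a b =>
        change (convMap (lensPar C) (unitSplit C) _ ≫ _).app _ _ = _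
        simp only [comp_app_el, convMap_parEl, convMap_seqMk, interchange_parEl,
          parLunit_parEl, id_app_el, unitSplit_unitEl, res_lens_seqMk, id_whiskerRight]
  runit_par A B := by
    simp only [lens_psi₂Ext, lens_parallel_runitExt]
    refine par_hom_ext (fun X Y X' Y' y h => ?_)
    induction h using unit_ind with
    | h h =>
      induction y using seq_ind with
      | h Z a b =>
        change (convMap (lensPar C) _ (unitSplit C) ≫ _).app _ _ = _
        simp only [comp_app_el, convMap_parEl, convMap_seqMk, interchange_parEl,
          parRunit_parEl, id_app_el, unitSplit_unitEl, whiskerLeft_id, Category.comp_id]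
        exact (res_seqMk _ _ _ _ _ (SymmetricCategory.symmetry X' Z) a b).symm
  lunit_seq A B := by
    simp only [lens_psi₂Ext, lens_sequential_lunitExt]
    refine par_seq_hom_ext (fun X Z Y X' Z' Y' h a h' b => ?_)
    induction h using unit_ind with
    | h h =>
      induction h' using unit_ind with
      | h h' =>
        change (_ ≫ convMap (lensSeq C) (unitTensor C) _ ≫ _).app _ _ = _
        simp only [comp_app_el, convMap_parEl, convMap_seqMk, interchange_parEl,
          id_app_el, unitTensor_parEl, seqLunit_seqMk, parEl_res_ofHoms, id_tensorHom_id]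
  runit_seq A B := by
    simp only [lens_psi₂Ext, lens_sequential_runitExt]
    refine par_seq_hom_ext (fun X Z Y X' Z' Y' a h b h' => ?_)
    induction h using unit_ind with
    | h h =>
      induction h' using unit_ind with
      | h h' =>
        change (_ ≫ convMap (lensSeq C) _ (unitTensor C) ≫ _).app _ _ = _
        simp only [comp_app_el, convMap_parEl, convMap_seqMk, interchange_parEl,
          id_app_el, unitTensor_parEl, seqRunit_seqMk, parEl_res_ofHoms, id_tensorHom_id]
  phi₂_assoc := by
    simp only [lens_parallel_assocExt]
    refine par_hom_ext_left (fun X Y X' Y' X'' Y'' h h' h'' => ?_)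
    induction h using unit_ind with
    | h h =>
      induction h' using unit_ind with
      | h h' =>
        induction h'' using unit_ind with
        | h h'' =>
          change (convMap (lensPar C) (unitTensor C) _ ≫ unitTensor C).app _ _ =
            (_ ≫ convMap (lensPar C) _ (unitTensor C) ≫ unitTensor C).app _ _
          simp only [comp_app_el, convMap_parEl, id_app_el, unitTensor_parEl, parAssoc_parEl,
            app_res, res_ofHoms_unitEl]
          simp
  phi₂_lunit := by
    simp only [lens_parallel_lunitExt]
    refine par_hom_ext (fun X Y X' Y' h h' => ?_)
    induction h using unit_ind with
    | h h =>
      induction h' using unit_ind with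
      | h h' =>
        change (convMap (lensPar C) (𝟙 _) _ ≫ unitTensor C).app _ _ = _
        simp only [comp_app_el, convMap_parEl, id_app_el, unitTensor_parEl, parLunit_parEl,
          res_unitEl]
        simp [MonoidalCategory.tensorHom_def']
  phi₂_runit := by
    simp only [lens_parallel_runitExt]
    refine par_hom_ext (fun X Y X' Y' h h' => ?_)
    induction h using unit_ind with
    | h h =>
      induction h' using unit_ind with
      | h h' =>
        change (convMap (lensPar C) _ (𝟙 _) ≫ unitTensor C).app _ _ = _
        simp only [comp_app_el, convMap_parEl, id_app_el, unitTensor_parEl, parRunit_parEl,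
          res_unitEl]
        simp [MonoidalCategory.tensorHom_def]
  psi₀_assoc := by
    simp only [lens_sequential_assocExt]
    refine psh_ext (fun ⟨⟨A, B⟩⟩ h => ?_)
    induction h using unit_ind with
    | h h =>
      refine (unitSplit_comp h _).trans (Eq.trans ?_ (unitSplit_comp h _).symm)
      change (convMap (lensSeq C) (unitSplit C) _ ≫ _).app _ _ =
        (convMap (lensSeq C) _ (unitSplit C)).app _ _
      simp only [comp_app_el, unitSplit_unitEl, convMap_seqMk, id_app_el, seqAssocHom_seqMk]
  psi₀_lunit := by
    simp only [lens_sequential_lunitExt]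
    refine psh_ext (fun ⟨⟨A, B⟩⟩ h => ?_)
    induction h using unit_ind with
    | h h =>
      refine (unitSplit_comp h _).trans ?_
      change (convMap (lensSeq C) (𝟙 _) _ ≫ _).app _ _ = _
      simp only [comp_app_el, convMap_seqMk, id_app_el, seqLunit_seqMk,
        res_ofHoms_id]
  psi₀_runit := by
    simp only [lens_sequential_runitExt]
    refine psh_ext (fun ⟨⟨A, B⟩⟩ h => ?_)
    induction h using unit_ind with
    | h h =>
      refine (unitSplit_comp h _).trans ?_
      change (convMap (lensSeq C) _ (𝟙 _) ≫ _).app _ _ = _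
      simp only [comp_app_el, convMap_seqMk, id_app_el, seqRunit_seqMk,
        res_ofHoms_unitEl, Category.id_comp]

/-- Monoidal lenses form a symmetric produoidal category. -/
def lensSymmetricProduoidal :
    SymmetricProduoidal (lensPar C) (lensUnit C) (lensSeq C) (lensUnit C) where
  toProduoidal := lensProduoidal C
  symm := daySymm (Lens C)
  symmetry := daySymm_symmetry
  hexagon P Q R := by
    change (lensProduoidalData C).parallel.assocExt P Q R ≫ _ ≫
      (lensProduoidalData C).parallel.assocExt Q R P =
        _ ≫ (lensProduoidalData C).parallel.assocExt Q P R ≫ _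
    rw [lens_parallel_assocExt, lens_parallel_assocExt, lens_parallel_assocExt]
    exact dayBraid_hexagon P Q R

end LensCoherence

end Produo

theorem mainTheorem9 (C : Type*) [Category* C] [MonoidalCategory C] [SymmetricCategory C] :
    (∃ S : Produo.SymmetricProduoidal (Produo.lensPar C) (Produo.lensUnit C)
        (Produo.lensSeq C) (Produo.lensUnit C), S.toProduoidal.IsNormal) ∧
      Nonempty (Produo.lensPar C ≅ Produo.lensTensor C ⋙ yoneda) :=
  ⟨⟨Produo.lensSymmetricProduoidal C, inferInstanceAs (IsIso (𝟙 (Produo.lensUnit C)))⟩, ⟨Iso.refl _⟩⟩
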